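/- **Setting.** For $\kappa\in\mathbb C$ with $i\kappa^2\in\mathbb R\setminus(-1,1)$ and Schwartz functions $q,r\in\mathscr S(\mathbb R;\mathbb C)$ define the bounded operators on $L^2(\mathbb R)$ $$\Lambda=(\partial+i\kappa^2)^{-1/2}\,\kappa q\,(\partial-i\kappa^2)^{-1/2},\qquad \Gamma=(\partial-i\kappa^2)^{-1/2}\,\kappa r\,(\partial+i\kappa^2)^{-1/2},$$ where $(\partial\pm i\kappa^2)^{-1/2}$ is the Fourier multiplier with symbol $(i\xi\pm i\kappa^2)^{-1/2}$, $z^{-1/2}=|z|^{-1/2}e^{-\frac i2\arg z}$, $\arg z\in(-\pi,\pi]$, and set $$A(\kappa;q,r)=-\operatorname{sgn}(i\kappa^2)\sum_{m=1}^\infty\frac1m\operatorname{tr}\{(\Lambda\Gamma)^m\}.$$ The functional derivatives $\frac{\delta F}{\delta q},\frac{\delta F}{\delta r}\in\mathscr S$ of a functional $F(q,r)$ are determined by $$\frac{d}{d\theta}\Big|_{\theta=0}F(q+\theta f,r+\theta h)=\int f\,\frac{\delta F}{\delta q}+h\,\frac{\delta F}{\delta r}\,dx\qquad(f,h\in\mathscr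 S),$$ the Poisson bracket is $$\{F,G\}=\int \frac{\delta F}{\delta r}\,\partial_x\Bigl(\frac{\delta G}{\delta q}\Bigr)+\frac{\delta F}{\delta q}\,\partial_x\Bigl(\frac{\delta G}{\delta r}\Bigr)\,dx,$$ and the flow of a Hamiltonian $H$ is $\partial_tq=\partial_x\frac{\delta H}{\delta r}$, $\partial_tr=\partial_x\frac{\delta H}{\delta q}$, for $(q,r)$ evolving in $\mathscr S\times\mathscr S$ ($q$ and $r$ being independent variables). Let $\|q\|_{H^s}^2=\int_{\mathbb R}(4+\xi^2)^s|\hat q(\xi)|^2\,d\xi$ with $\hat q(\xi)=\frac1{\sqrt{2\pi}}\int e^{-i\xi x}q(x)\,dx$, and $B_\delta=\{q:\|q\|_{H^s}\le\delta\}$. **Lemma (Poisson brackets).** Let $s\in(0,\frac12)$. There exists $\delta>0$ such that: 1. For all $\kappa,\varkappa\in\mathbb C$ with $i\kappa^2,i\varkappa^2\in\mathbb R\setminus(-1,1)$ and $\kappa^2\ne\varkappa^2$, and all $q,r\in B_\delta\cap\mathscr S$ (in particular for all $q\in B_\delta\cap\mathscr S$ with $r=-\bar q$), the operators $(\Lambda\Gamma)^m$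 are trace class and the series defining $A(\kappa)$ and $A(\varkappa)$ converge absolutely at $(q,r)$, $A(\kappa)$ and $A(\varkappa)$ have functional derivatives in $\mathscr S$ at $(q,r)$, and $$\{A(\kappa),A(\varkappa)\}=0 .$$ 2. Consequently $A(\varkappa)$ is conserved by every $A(\kappa)$ flow: for all $\kappa,\varkappa$ with $i\kappa^2,i\varkappa^2\in\mathbb R\setminus(-1,1)$, if $t\mapsto(q(t),r(t))$ is a solution of the $A(\kappa)$ flow on an interval $J$, differentiable in $t$ with values in $\mathscr S\times\mathscr S$, with $q(t),r(t)\in B_\delta$ for all $t\in J$, then $A(\varkappa;q(t),r(t))$ is constant on $J$. -/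

import Mathlib

open MeasureTheory SchwartzMap FourierTransform
open scoped InnerProductSpace

namespace DNLS

noncomputable section

/-- The Hilbert space `L²(ℝ; ℂ)`. -/
abbrev L2 : Type := Lp ℂ 2 (volume : Measure ℝ)

/-! ### Trace -/

/-- `T` is trace class with trace `t`: for every orthonormal (Hilbert) basis `b`, the series
`∑ ⟨b i, T b i⟩` converges (unconditionally, hence absolutely), always with the sum `t`. -/
def HasTrace {E : Type} [NormedAddCommGroup E] [InnerProductSpace ℂ E] (T : E →L[ℂ] E) (t : ℂ) :
    Prop :=
  ∀ (ι : Type) (b : HilbertBasis ι ℂ E), HasSum (fun i => ⟪b i, T (b i)⟫_ℂ) t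

/-- `T` is trace class. -/
def IsTraceClass {E : Type} [NormedAddCommGroup E] [InnerProductSpace ℂ E] (T : E →L[ℂ] E) :
    Prop :=
  ∃ t, HasTrace T t

open Classical in
/-- The trace of a trace-class operator (`0` for other operators). -/
def trace {E : Type} [NormedAddCommGroup E] [InnerProductSpace ℂ E] (T : E →L[ℂ] E) : ℂ :=
  if h : IsTraceClass T then h.choose else 0

/-! ### Multiplication operators, Fourier multipliers, and the operators `Λ`, `Γ` -/

open Classical in
/-- Multiplication by an essentially bounded measurable function `m`, as a bounded operator on
`L²(ℝ)` (`0` if `m` is not such a function). -/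
def mulOp (m : ℝ → ℂ) : L2 →L[ℂ] L2 :=
  if h : MemLp m ⊤ volume then
    (ContinuousLinearMap.mul ℂ ℂ).holderL volume ⊤ 2 2 (h.toLp m)
  else 0

/-- The operator `m(-i∂)` on `L²(ℝ)`: the Fourier multiplier with symbol `m(ξ)`, where the
frequency `ξ` is normalised by `∂ ↔ iξ`. Mathlib's Fourier transform has the character
`exp(-2πixy)`, so that `ξ = 2πy`. -/
def fourierMul (m : ℝ → ℂ) : L2 →L[ℂ] L2 :=
  ((Lp.fourierTransformₗᵢ ℝ ℂ).symm.toContinuousLinearEquiv : L2 →L[ℂ] L2) ∘L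
    mulOp (fun y => m (2 * Real.pi * y)) ∘L
    ((Lp.fourierTransformₗᵢ ℝ ℂ).toContinuousLinearEquiv : L2 →L[ℂ] L2)

/-- `(∂ + c)^{-1/2}`, with the branch `z^{-1/2} = |z|^{-1/2} exp(-(i/2) arg z)`,
`arg z ∈ (-π, π]`. -/
def halfInv (c : ℂ) : L2 →L[ℂ] L2 :=
  fourierMul fun ξ => (Complex.I * ξ + c) ^ (-(1 / 2) : ℂ)

/-- `Λ(κ) = (∂ + iκ²)^{-1/2} κ q (∂ - iκ²)^{-1/2}`. -/
def Lam (κ : ℂ) (q : 𝓢(ℝ, ℂ)) : L2 →L[ℂ] L2 :=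
  halfInv (Complex.I * κ ^ 2) ∘L mulOp (fun x => κ * q x) ∘L halfInv (-(Complex.I * κ ^ 2))

/-- `Γ(κ) = (∂ - iκ²)^{-1/2} κ r (∂ + iκ²)^{-1/2}`. -/
def Gam (κ : ℂ) (r : 𝓢(ℝ, ℂ)) : L2 →L[ℂ] L2 :=
  halfInv (-(Complex.I * κ ^ 2)) ∘L mulOp (fun x => κ * r x) ∘L halfInv (Complex.I * κ ^ 2)

/-! ### The logarithmic perturbation determinant -/

/-- The parameters `κ ∈ ℂ` with `iκ² ∈ ℝ \ (-1, 1)`. -/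
def Admissible (κ : ℂ) : Prop :=
  (Complex.I * κ ^ 2).im = 0 ∧ 1 ≤ |(Complex.I * κ ^ 2).re|

/-- `A(κ; q, r) = - sgn(iκ²) ∑_{m ≥ 1} (1/m) tr{(ΛΓ)^m}`. -/
def A (κ : ℂ) (q r : 𝓢(ℝ, ℂ)) : ℂ :=
  -(Real.sign (Complex.I * κ ^ 2).re : ℂ) *
    ∑' m : ℕ, (1 / ((m : ℂ) + 1)) * trace ((Lam κ q ∘L Gam κ r) ^ (m + 1))

/-- The series defining `A(κ; q, r)` makes sense: each `(ΛΓ)^m`, `m ≥ 1`, is of trace class, and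
the series converges absolutely. -/
def AConverges (κ : ℂ) (q r : 𝓢(ℝ, ℂ)) : Prop :=
  (∀ m : ℕ, IsTraceClass ((Lam κ q ∘L Gam κ r) ^ (m + 1))) ∧
    Summable fun m : ℕ => ‖(1 / ((m : ℂ) + 1)) * trace ((Lam κ q ∘L Gam κ r) ^ (m + 1))‖

/-! ### Sobolev norm -/

/-- `‖q‖_{H^s} = (∫ (4 + ξ²)^s |q̂(ξ)|² dξ)^{1/2}` with `q̂(ξ) = (2π)^{-1/2} ∫ exp(-iξx) q(x) dx`;
in terms of Mathlib's transform, `q̂(ξ) = (2π)^{-1/2} (𝓕 q)(ξ / 2π)`. -/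
def sobolevNorm (s : ℝ) (q : 𝓢(ℝ, ℂ)) : ℝ :=
  Real.sqrt (∫ ξ : ℝ, (4 + ξ ^ 2) ^ s *
    ‖((Real.sqrt (2 * Real.pi))⁻¹ : ℂ) * 𝓕 q (ξ / (2 * Real.pi))‖ ^ 2)

/-! ### Functional derivatives, Poisson bracket, Hamiltonian flow -/

/-- The functional derivatives of `F = F(q, r)` at `(q, r)` are `δF/δq = u` and `δF/δr = v`:
for all directions `f, h`,
`d/dθ F(q + θf, r + θh) |_{θ = 0} = ∫ f (δF/δq) dx + ∫ h (δF/δr) dx`. -/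
def HasFunDeriv (F : 𝓢(ℝ, ℂ) → 𝓢(ℝ, ℂ) → ℂ) (q r u v : 𝓢(ℝ, ℂ)) : Prop :=
  ∀ f h : 𝓢(ℝ, ℂ), HasDerivAt (fun θ : ℝ => F (q + θ • f) (r + θ • h))
    ((∫ x, f x * u x) + ∫ x, h x * v x) 0

/-- `F` has functional derivatives at `(q, r)`. -/
def FunDifferentiableAt (F : 𝓢(ℝ, ℂ) → 𝓢(ℝ, ℂ) → ℂ) (q r : 𝓢(ℝ, ℂ)) : Prop :=
  ∃ p : 𝓢(ℝ, ℂ) × 𝓢(ℝ, ℂ), HasFunDeriv F q r p.1 p.2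

open Classical in
/-- The pair `(δF/δq, δF/δr)` at `(q, r)` (`0` if `F` has no functional derivatives there). -/
def funDeriv (F : 𝓢(ℝ, ℂ) → 𝓢(ℝ, ℂ) → ℂ) (q r : 𝓢(ℝ, ℂ)) : 𝓢(ℝ, ℂ) × 𝓢(ℝ, ℂ) :=
  if h : FunDifferentiableAt F q r then h.choose else 0

/-- `δF/δq` at `(q, r)`. -/
def funDerivQ (F : 𝓢(ℝ, ℂ) → 𝓢(ℝ, ℂ) → ℂ) (q r : 𝓢(ℝ, ℂ)) : 𝓢(ℝ, ℂ) := (funDeriv F q r).1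

/-- `δF/δr` at `(q, r)`. -/
def funDerivR (F : 𝓢(ℝ, ℂ) → 𝓢(ℝ, ℂ) → ℂ) (q r : 𝓢(ℝ, ℂ)) : 𝓢(ℝ, ℂ) := (funDeriv F q r).2

/-- The Poisson bracket `{F, G} = ∫ (δF/δr) ∂ₓ(δG/δq) + (δF/δq) ∂ₓ(δG/δr) dx` at `(q, r)`. -/
def poissonBracket (F G : 𝓢(ℝ, ℂ) → 𝓢(ℝ, ℂ) → ℂ) (q r : 𝓢(ℝ, ℂ)) : ℂ :=
  ∫ x, (funDerivR F q r x * deriv (funDerivQ G q r) x +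
    funDerivQ F q r x * deriv (funDerivR G q r) x)

/-- `t ↦ (q t, r t)`, `t ∈ J`, is an integral curve in Schwartz space of the Hamiltonian flow
`∂ₜ q = ∂ₓ(δH/δr)`, `∂ₜ r = ∂ₓ(δH/δq)`. -/
def IsHamiltonianFlow (H : 𝓢(ℝ, ℂ) → 𝓢(ℝ, ℂ) → ℂ) (J : Set ℝ) (q r : ℝ → 𝓢(ℝ, ℂ)) : Prop :=
  ∀ t ∈ J, FunDifferentiableAt H (q t) (r t) ∧
    HasDerivWithinAt q (SchwartzMap.derivCLM ℂ ℂ (funDerivR H (q t) (r t))) J t ∧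
    HasDerivWithinAt r (SchwartzMap.derivCLM ℂ ℂ (funDerivQ H (q t) (r t))) J t

end

end DNLS

namespace DNLS

noncomputable section

open scoped ENNReal

open ContinuousLinearMap (adjoint)

/-! ### Hilbert–Schmidt operators -/

section HilbertSchmidt

variable {E : Type} [NormedAddCommGroup E] [InnerProductSpace ℂ E] {ι κ : Type}

/-! Put μ = iκ², s = sgn μ. Since |κ|² = |μ|, Plancherel bounds the Hilbert–Schmidt norms of Λ and Γ
by ‖q‖₂/√2 and ‖r‖₂/√2, uniformly in κ. The H^s norm dominates the L² norm, so δ = 1 makes every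
series converge. Up to the factor −s, A is a function `logDet` of the pair (Λ, Γ), which depends
linearly on (q, r). Its differential is (S, T) ↦ tr(SΓP) + tr(TPΛ) with P = (1 − ΛΓ)⁻¹
(`hasFDerivAt_tsum_tracePow`).

Let U and V be the partial differentials as functionals of a test function f, and let N(f) be the
trace of (∂−μ)^{-1/2} f (∂−μ)^{-1/2} ΓPΛ minus that of (∂+μ)^{-1/2} f (∂+μ)^{-1/2} ΛΓP. The identity
(∂+a)⁻¹(f' + (a−b)f)(∂+b)⁻¹ = f(∂+b)⁻¹ − (∂+a)⁻¹f and cyclicity of the trace show that their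
densities u, v, n solve weakly the closed system u' = 2μu − κ²r(n − s), v' = −2μv + κ²q(n − s), n' =
−2(qu − rv) (`exists_trace_functional`). The constant s comes from the lowest-order trace, which is
computed on the Fourier side (`pair_halfSandwich_sDeriv`). Elliptic regularity makes u and v
Schwartz functions and n a smooth function vanishing at infinity (`exists_schwartz_solution`).

For two parameters K = κ² and L = ϰ², with gradients (u, v, n) and (ũ, ṽ, ñ), the function −½(n −
s)(ñ − s̃) − K⁻¹(vũ + uṽ) has derivative (L⁻¹ − K⁻¹)(v∂ũ + u∂ṽ) and the same limit at both ends, so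
the bracket vanishes when K ≠ L (`GradientSystem.integral_bracket`). Along a flow of A(κ) the chain
rule writes the derivative of A(ϰ) as such a bracket; when K = L it is the bracket of a functional
with itself. -/

theorem hasSum_norm_inner_sq (b : HilbertBasis ι ℂ E) (x : E) :
    HasSum (fun i => ‖⟪b i, x⟫_ℂ‖ ^ 2) (‖x‖ ^ 2) := by
  have h := (Complex.reCLM.hasSum (b.hasSum_inner_mul_inner x x))
  have h2 : Complex.reCLM ⟪x, x⟫_ℂ = ‖x‖ ^ 2 := by
    rw [inner_self_eq_norm_sq_to_K]
    simp [← Complex.ofReal_pow]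
  rw [h2] at h
  refine h.congr_fun ?_ |> id
  intro i
  rw [← inner_conj_symm x (b i), ← Complex.normSq_eq_norm_sq, mul_comm, Complex.mul_conj]
  simp

theorem tsum_enorm_inner_sq (b : HilbertBasis ι ℂ E) (x : E) :
    ∑' i, ‖⟪b i, x⟫_ℂ‖ₑ ^ 2 = ‖x‖ₑ ^ 2 := by
  have h := hasSum_norm_inner_sq b x
  have h2 := ENNReal.ofReal_tsum_of_nonneg (fun i => sq_nonneg ‖⟪b i, x⟫_ℂ‖) h.summable
  rw [h.tsum_eq] at h2
  simp only [ENNReal.ofReal_pow (norm_nonneg _), ofReal_norm] at h2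
  exact h2.symm

/-- The square of the Hilbert–Schmidt norm of `T`, computed in the basis `b`. -/
def hsSq (b : HilbertBasis ι ℂ E) (T : E →L[ℂ] E) : ℝ≥0∞ := ∑' i, ‖T (b i)‖ₑ ^ 2

theorem hsSq_comp_le (b : HilbertBasis ι ℂ E) (B T : E →L[ℂ] E) :
    hsSq b (B ∘L T) ≤ ‖B‖ₑ ^ 2 * hsSq b T := by
  unfold hsSq
  rw [← ENNReal.tsum_mul_left]
  refine ENNReal.tsum_le_tsum fun i => ?_
  rw [← mul_pow]
  gcongr
  exact B.le_opENorm _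

variable [CompleteSpace E]

-- Parseval turns both sides into the same double sum of squared matrix entries, and values in [0,
-- ∞] allow the interchange. Two applications give independence of the basis.
open ContinuousLinearMap in
theorem hsSq_adjoint (b : HilbertBasis ι ℂ E) (c : HilbertBasis κ ℂ E) (T : E →L[ℂ] E) :
    hsSq c (adjoint T) = hsSq b T := by
  unfold hsSq
  simp_rw [← tsum_enorm_inner_sq b (adjoint T _), ← tsum_enorm_inner_sq c (T _)]
  rw [ENNReal.tsum_comm]
  refine tsum_congr fun i => tsum_congr fun j => ?_
  rw [adjoint_inner_right, ← ofReal_norm, norm_inner_symm, ofReal_norm]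

theorem hsSq_eq (b : HilbertBasis ι ℂ E) (c : HilbertBasis κ ℂ E) (T : E →L[ℂ] E) :
    hsSq b T = hsSq c T := by
  rw [← hsSq_adjoint b b, hsSq_adjoint c b]

variable (E) in
/-- The index set of a chosen Hilbert basis. -/
def stdIndex : Type := (exists_hilbertBasis ℂ E).choose

variable (E) in
/-- A chosen Hilbert basis. -/
def stdBasis : HilbertBasis (stdIndex E) ℂ E := (exists_hilbertBasis ℂ E).choose_spec.choose

theorem memℓp_iff_hsSq (T : E →L[ℂ] E) :
    Memℓp (fun i => T (stdBasis E i)) 2 ↔ hsSq (stdBasis E) T ≠ ⊤ := by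
  rw [memℓp_gen_iff (by norm_num)]
  unfold hsSq
  have h1 : ∀ i, ‖T (stdBasis E i)‖ ^ (2 : ℝ≥0∞).toReal = ((‖T (stdBasis E i)‖₊ ^ 2 : NNReal) : ℝ) := by
    intro i; simp
  simp_rw [h1, NNReal.summable_coe, ← ENNReal.tsum_coe_ne_top_iff_summable]
  simp [enorm_eq_nnnorm]

variable (E) in
/-- The Hilbert–Schmidt operators, as a subspace of the bounded operators. -/
def hsSubmodule : Submodule ℂ (E →L[ℂ] E) where
  carrier := {T | Memℓp (fun i => T (stdBasis E i)) 2}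
  add_mem' hS hT := hS.add hT
  zero_mem' := zero_memℓp
  smul_mem' c _ hT := hT.const_smul c

theorem mem_hsSubmodule {T : E →L[ℂ] E} : T ∈ hsSubmodule E ↔ hsSq (stdBasis E) T ≠ ⊤ :=
  memℓp_iff_hsSq T

variable (E) in
/-- The space of Hilbert–Schmidt operators with the Hilbert–Schmidt norm. -/
def HS : Type := hsSubmodule E

/-! ### The space of Hilbert–Schmidt operators and its trace pairing -/

namespace HS

instance : AddCommGroup (HS E) := inferInstanceAs (AddCommGroup (hsSubmodule E))
instance : Module ℂ (HS E) := inferInstanceAs (Module ℂ (hsSubmodule E))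

variable (E) in
/-- The underlying bounded operator. -/
def toOp : HS E →ₗ[ℂ] E →L[ℂ] E := (hsSubmodule E).subtype

theorem toOp_injective : Function.Injective (toOp E) := Subtype.val_injective

/-- A Hilbert–Schmidt operator from a bounded operator with finite Hilbert–Schmidt norm. -/
def mk (T : E →L[ℂ] E) (h : hsSq (stdBasis E) T ≠ ⊤) : HS E := ⟨T, mem_hsSubmodule.2 h⟩

@[simp] theorem toOp_mk (T : E →L[ℂ] E) (h : hsSq (stdBasis E) T ≠ ⊤) : toOp E (mk T h) = T := rfl

variable (E) in
/-- The images of the chosen basis vectors. -/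
def toLp : HS E →ₗ[ℂ] lp (fun _ : stdIndex E => E) 2 where
  toFun T := ⟨fun i => toOp E T (stdBasis E i), T.2⟩
  map_add' _ _ := rfl
  map_smul' _ _ := rfl

theorem toLp_apply (T : HS E) (i : stdIndex E) : toLp E T i = toOp E T (stdBasis E i) := rfl

theorem toLp_injective : Function.Injective (toLp E) := by
  intro S T h
  apply toOp_injective
  refine ContinuousLinearMap.ext_on
    (Submodule.dense_iff_topologicalClosure_eq_top.2 (stdBasis E).dense_span) ?_
  rintro _ ⟨i, rfl⟩
  rw [← toLp_apply, h, toLp_apply]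

instance : NormedAddCommGroup (HS E) := NormedAddCommGroup.induced _ _ (toLp E) toLp_injective

instance : NormedSpace ℂ (HS E) := NormedSpace.induced ℂ _ _ (toLp E)

theorem norm_def (T : HS E) : ‖T‖ = ‖toLp E T‖ := rfl

theorem enorm_sq (T : HS E) (b : HilbertBasis ι ℂ E) : ‖T‖ₑ ^ 2 = hsSq b (toOp E T) := by
  rw [hsSq_eq b (stdBasis E)]
  have h := lp.hasSum_norm (p := 2) (by norm_num) (toLp E T)
  simp only [ENNReal.toReal_ofNat, Real.rpow_ofNat, ← norm_def] at h
  have h2 := ENNReal.ofReal_tsum_of_nonneg (fun i => sq_nonneg ‖toLp E T i‖) h.summable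
  rw [h.tsum_eq] at h2
  simp only [ENNReal.ofReal_pow (norm_nonneg _), ofReal_norm] at h2
  exact h2

theorem hsSq_ne_top (T : HS E) (b : HilbertBasis ι ℂ E) : hsSq b (toOp E T) ≠ ⊤ := by
  rw [← enorm_sq]; finiteness

theorem norm_le_of_hsSq_le {S : HS E} {C : ℝ} (hC : 0 ≤ C)
    (h : hsSq (stdBasis E) (toOp E S) ≤ ENNReal.ofReal (C ^ 2)) : ‖S‖ ≤ C := by
  rw [← enorm_sq, ENNReal.ofReal_pow hC] at h
  have h2 : ‖S‖ₑ ≤ ENNReal.ofReal C := by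
    exact (ENNReal.pow_le_pow_left_iff two_ne_zero).1 h
  rwa [← ofReal_norm, ENNReal.ofReal_le_ofReal_iff hC] at h2

/-- The adjoint of a Hilbert–Schmidt operator. -/
def adj (T : HS E) : HS E := mk (ContinuousLinearMap.adjoint (toOp E T)) (by
  rw [hsSq_adjoint (stdBasis E)]; exact T.hsSq_ne_top _)

theorem norm_adj (T : HS E) : ‖adj T‖ = ‖T‖ := by
  have h : ‖adj T‖ₑ ^ 2 = ‖T‖ₑ ^ 2 := by
    rw [enorm_sq _ (stdBasis E), enorm_sq _ (stdBasis E), adj, toOp_mk, hsSq_adjoint (stdBasis E)]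
  have h2 : ‖adj T‖ ^ 2 = ‖T‖ ^ 2 := by
    have := congrArg ENNReal.toReal h
    simpa using this
  exact (pow_left_inj₀ (norm_nonneg _) (norm_nonneg _) two_ne_zero).1 h2

/-- Composition with a bounded operator on the left. -/
def mulLeftLM : (E →L[ℂ] E) →ₗ[ℂ] HS E →ₗ[ℂ] HS E :=
  LinearMap.mk₂ ℂ (fun B T => mk (B ∘L toOp E T) (ne_top_of_le_ne_top
      (ENNReal.mul_ne_top (by finiteness) (T.hsSq_ne_top _)) (hsSq_comp_le _ B (toOp E T))))
    (fun _ _ _ => toOp_injective (by ext; simp)) (fun _ _ _ => toOp_injective (by ext; simp))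
    (fun _ _ _ => toOp_injective (by ext; simp)) (fun _ _ _ => toOp_injective (by ext; simp))

theorem norm_mulLeftLM_le (B : E →L[ℂ] E) (T : HS E) : ‖mulLeftLM B T‖ ≤ ‖B‖ * ‖T‖ := by
  refine norm_le_of_hsSq_le (by positivity) ?_
  refine (hsSq_comp_le _ B (toOp E T)).trans (le_of_eq ?_)
  rw [← enorm_sq, mul_pow, ENNReal.ofReal_mul (by positivity)]
  simp [ENNReal.ofReal_pow, ofReal_norm]

variable (E) in
/-- Composition with a bounded operator on the left, as a continuous bilinear map. -/
def mulLeft : (E →L[ℂ] E) →L[ℂ] HS E →L[ℂ] HS E :=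
  LinearMap.mkContinuous₂ mulLeftLM 1 (by simpa using norm_mulLeftLM_le)

@[simp] theorem toOp_mulLeft (B : E →L[ℂ] E) (T : HS E) :
    toOp E (mulLeft E B T) = B * toOp E T := rfl

theorem norm_mulLeft_le (B : E →L[ℂ] E) (T : HS E) : ‖mulLeft E B T‖ ≤ ‖B‖ * ‖T‖ :=
  norm_mulLeftLM_le B T

theorem toOp_adj_mulLeft_adj (B : E →L[ℂ] E) (T : HS E) :
    toOp E (adj (mulLeft E (ContinuousLinearMap.adjoint B) (adj T))) = toOp E T * B := by
  simp [adj, ContinuousLinearMap.mul_def, ContinuousLinearMap.adjoint_comp]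

theorem hsSq_comp_right_ne_top (T : HS E) (B : E →L[ℂ] E) :
    hsSq (stdBasis E) (toOp E T * B) ≠ ⊤ := by
  rw [← toOp_adj_mulLeft_adj]
  exact hsSq_ne_top _ _

/-- Composition with a bounded operator on the right. -/
def mulRightLM : (E →L[ℂ] E) →ₗ[ℂ] HS E →ₗ[ℂ] HS E :=
  LinearMap.mk₂ ℂ (fun B T => mk (toOp E T * B) (hsSq_comp_right_ne_top T B))
    (fun _ _ _ => toOp_injective (by ext; simp)) (fun _ _ _ => toOp_injective (by ext; simp))
    (fun _ _ _ => toOp_injective (by ext; simp)) (fun _ _ _ => toOp_injective (by ext; simp))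

/-- TB = (B*T*)*, and the adjoint preserves the Hilbert–Schmidt norm, so the bound for left
multiplication applies. -/
theorem norm_mulRightLM_le (B : E →L[ℂ] E) (T : HS E) : ‖mulRightLM B T‖ ≤ ‖B‖ * ‖T‖ := by
  have h : mulRightLM B T = adj (mulLeft E (ContinuousLinearMap.adjoint B) (adj T)) :=
    toOp_injective (toOp_adj_mulLeft_adj B T).symm
  rw [h, norm_adj]
  refine (norm_mulLeft_le _ _).trans ?_
  rw [norm_adj, LinearIsometryEquiv.norm_map]

variable (E) in
/-- Composition with a bounded operator on the right, as a continuous bilinear map. -/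
def mulRight : (E →L[ℂ] E) →L[ℂ] HS E →L[ℂ] HS E :=
  LinearMap.mkContinuous₂ mulRightLM 1 (by simpa using norm_mulRightLM_le)

@[simp] theorem toOp_mulRight (B : E →L[ℂ] E) (T : HS E) :
    toOp E (mulRight E B T) = toOp E T * B := rfl

theorem norm_mulRight_le (B : E →L[ℂ] E) (T : HS E) : ‖mulRight E B T‖ ≤ ‖B‖ * ‖T‖ :=
  norm_mulRightLM_le B T

theorem norm_toOp_le (T : HS E) : ‖toOp E T‖ ≤ ‖T‖ := by
  refine ContinuousLinearMap.opNorm_le_bound _ (norm_nonneg _) fun x => ?_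
  have h : ‖toOp E T x‖ₑ ^ 2 ≤ (‖T‖ₑ * ‖x‖ₑ) ^ 2 := by
    rw [← tsum_enorm_inner_sq (stdBasis E), mul_pow, enorm_sq T (stdBasis E),
      ← hsSq_adjoint (stdBasis E) (stdBasis E), hsSq, ← ENNReal.tsum_mul_right]
    refine ENNReal.tsum_le_tsum fun i => ?_
    rw [← ContinuousLinearMap.adjoint_inner_left, ← mul_pow]
    gcongr
    rw [← ofReal_norm, ← ofReal_norm, ← ofReal_norm, ← ENNReal.ofReal_mul (norm_nonneg _)]
    exact ENNReal.ofReal_le_ofReal (norm_inner_le_norm _ _)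
  have h2 := (ENNReal.pow_le_pow_left_iff two_ne_zero).1 h
  rw [← ofReal_norm, ← ofReal_norm, ← ofReal_norm, ← ENNReal.ofReal_mul (norm_nonneg _)] at h2
  exact (ENNReal.ofReal_le_ofReal_iff (by positivity)).1 h2

variable (E) in
/-- The underlying bounded operator, as a continuous linear map. -/
def toOpL : HS E →L[ℂ] E →L[ℂ] E :=
  (toOp E).mkContinuous 1 (by simpa using norm_toOp_le)

@[simp] theorem toOpL_apply (T : HS E) : toOpL E T = toOp E T := rfl

/-- ⟨e, STe⟩ = ⟨S*e, Te⟩, so the trace of ST is an ℓ² inner product and Cauchy–Schwarz bounds it. -/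
theorem inner_toLp_adj (S T : HS E) :
    HasSum (fun i => ⟪stdBasis E i, (toOp E S * toOp E T) (stdBasis E i)⟫_ℂ)
      ⟪toLp E (adj S), toLp E T⟫_ℂ := by
  refine (lp.hasSum_inner (toLp E (adj S)) (toLp E T)).congr_fun fun i => ?_
  simp only [toLp_apply, adj, toOp_mk, ContinuousLinearMap.adjoint_inner_left,
    mul_apply_eq_comp]

/-- The trace of the product of two Hilbert–Schmidt operators. -/
def pairLM : HS E →ₗ[ℂ] HS E →ₗ[ℂ] ℂ :=
  LinearMap.mk₂ ℂ (fun S T => ⟪toLp E (adj S), toLp E T⟫_ℂ)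
    (fun S S' T => (inner_toLp_adj (S + S') T).unique
      (((inner_toLp_adj S T).add (inner_toLp_adj S' T)).congr_fun
        fun i => by simp [add_mul]))
    (fun c S T => (inner_toLp_adj (c • S) T).unique
      (((inner_toLp_adj S T).mul_left c).congr_fun fun i => by simp))
    (fun S T T' => by simp) (fun c S T => by simp)

theorem norm_pairLM_le (S T : HS E) : ‖pairLM S T‖ ≤ ‖S‖ * ‖T‖ := by
  refine (norm_inner_le_norm (𝕜 := ℂ) (toLp E (adj S)) (toLp E T)).trans ?_
  rw [← norm_def, norm_adj, ← norm_def]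

variable (E) in
/-- The trace of the product of two Hilbert–Schmidt operators, as a continuous bilinear map. -/
def pair : HS E →L[ℂ] HS E →L[ℂ] ℂ :=
  LinearMap.mkContinuous₂ pairLM 1 (by simpa using norm_pairLM_le)

theorem norm_pair_le (S T : HS E) : ‖pair E S T‖ ≤ ‖S‖ * ‖T‖ := norm_pairLM_le S T

theorem hasSum_pair (S T : HS E) :
    HasSum (fun i => ⟪stdBasis E i, (toOp E S * toOp E T) (stdBasis E i)⟫_ℂ) (pair E S T) :=
  inner_toLp_adj S T

/-- The entries of S and of T are square summable over pairs of basis vectors. Absolute convergence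
of this double series yields both cyclicity and basis independence of the trace. -/
theorem summable_inner_mul_inner (S T : HS E) (b : HilbertBasis ι ℂ E) (c : HilbertBasis κ ℂ E) :
    Summable fun p : ι × κ =>
      ⟪b p.1, toOp E S (c p.2)⟫_ℂ * ⟪c p.2, toOp E T (b p.1)⟫_ℂ := by
  have key : ∀ (T : HS E) {ι κ : Type} (b : HilbertBasis ι ℂ E) (c : HilbertBasis κ ℂ E),
      Summable fun p : ι × κ => ‖⟪c p.2, toOp E T (b p.1)⟫_ℂ‖ ^ 2 := by
    intro T ι κ b c
    have h := hsSq_ne_top T b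
    unfold hsSq at h
    simp_rw [← tsum_enorm_inner_sq c (toOp E T _)] at h
    rw [← ENNReal.tsum_prod (f := fun i j => ‖⟪c j, toOp E T (b i)⟫_ℂ‖ₑ ^ 2)] at h
    have h2 := ENNReal.summable_toReal h
    simpa using h2
  have h1 := key T b c
  have h2 := (Equiv.prodComm ι κ).summable_iff.2 (key S c b)
  refine .of_norm_bounded (h1.add h2) fun p => ?_
  simp only [norm_mul, Function.comp, Equiv.prodComm_apply, Prod.swap]
  nlinarith [sq_nonneg (‖⟪b p.1, toOp E S (c p.2)⟫_ℂ‖ - ‖⟪c p.2, toOp E T (b p.1)⟫_ℂ‖),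
    sq_nonneg (‖⟪b p.1, toOp E S (c p.2)⟫_ℂ‖), sq_nonneg (‖⟪c p.2, toOp E T (b p.1)⟫_ℂ‖)]

theorem hasSum_inner_comp (S T : HS E) (b : HilbertBasis ι ℂ E) (c : HilbertBasis κ ℂ E) :
    HasSum (fun i => ⟪b i, (toOp E S * toOp E T) (b i)⟫_ℂ)
      (∑' p : ι × κ, ⟪b p.1, toOp E S (c p.2)⟫_ℂ * ⟪c p.2, toOp E T (b p.1)⟫_ℂ) := by
  refine (summable_inner_mul_inner S T b c).hasSum.prod_fiberwise fun i => ?_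
  have h := c.hasSum_inner_mul_inner (ContinuousLinearMap.adjoint (toOp E S) (b i))
    (toOp E T (b i))
  simpa only [ContinuousLinearMap.adjoint_inner_left, mul_apply_eq_comp] using h

/-- The trace of TS in the standard basis, expanded through `b`, is the transpose of the double
series for the trace of ST in `b`, expanded through the standard basis. -/
theorem pair_eq_tsum (S T : HS E) (b : HilbertBasis ι ℂ E) :
    pair E T S = ∑' p : ι × stdIndex E,
      ⟪b p.1, toOp E S (stdBasis E p.2)⟫_ℂ * ⟪stdBasis E p.2, toOp E T (b p.1)⟫_ℂ := by
  rw [(hasSum_pair T S).unique (hasSum_inner_comp T S (stdBasis E) b),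
    ← (Equiv.prodComm ι (stdIndex E)).tsum_eq]
  exact tsum_congr fun p => mul_comm _ _

theorem pair_comm (S T : HS E) : pair E S T = pair E T S := by
  rw [pair_eq_tsum S T (stdBasis E)]
  exact (hasSum_pair S T).unique (hasSum_inner_comp S T (stdBasis E) (stdBasis E))

theorem hasTrace_mul (S T : HS E) : HasTrace (toOp E S * toOp E T) (pair E S T) := by
  intro ι b
  rw [pair_comm, pair_eq_tsum S T b]
  exact hasSum_inner_comp S T b (stdBasis E)

end HS

theorem HasTrace.trace_eq {T : E →L[ℂ] E} {t : ℂ} (h : HasTrace T t) : trace T = t := by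
  have h' : IsTraceClass T := ⟨t, h⟩
  rw [trace, dif_pos h']
  exact (h'.choose_spec _ (stdBasis E)).unique (h _ (stdBasis E))

namespace HS

theorem trace_mul (S T : HS E) : trace (toOp E S * toOp E T) = pair E S T :=
  (hasTrace_mul S T).trace_eq

/-- The pairing depends on the product only. -/
theorem pair_eq_of_mul_eq {S T S' T' : HS E} (h : toOp E S * toOp E T = toOp E S' * toOp E T') :
    pair E S T = pair E S' T' := by
  rw [← trace_mul, ← trace_mul, h]

end HS

end HilbertSchmidt

/-! ### The logarithmic determinant on pairs of Hilbert–Schmidt operators -/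

section LogDet

variable {E : Type} [NormedAddCommGroup E] [InnerProductSpace ℂ E] [CompleteSpace E]

open HS

/-- The product of two Hilbert–Schmidt operators as a bounded operator. -/
def opProd (p : HS E × HS E) : E →L[ℂ] E := toOp E p.1 * toOp E p.2

theorem norm_opProd_le (p : HS E × HS E) : ‖opProd p‖ ≤ ‖p.1‖ * ‖p.2‖ :=
  (norm_mul_le _ _).trans (mul_le_mul (norm_toOp_le _) (norm_toOp_le _) (norm_nonneg _)
    (norm_nonneg _))

theorem norm_opProd_pow_le (p : HS E × HS E) (n : ℕ) :
    ‖opProd p ^ n‖ ≤ (‖p.1‖ * ‖p.2‖) ^ n := by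
  rcases n with _ | n
  · simp only [pow_zero]
    -- Only ‖1‖ ≤ 1 holds in general, because `E` may be trivial.
    exact ContinuousLinearMap.norm_id_le
  · exact (norm_pow_le' _ n.succ_pos).trans (pow_le_pow_left₀ (norm_nonneg _) (norm_opProd_le p) _)

/-- `tr (ΛΓ)^(n+1)`. -/
def tracePow (n : ℕ) (p : HS E × HS E) : ℂ := pair E p.1 (mulRight E (opProd p ^ n) p.2)

theorem hasTrace_opProd_pow (n : ℕ) (p : HS E × HS E) :
    HasTrace (opProd p ^ (n + 1)) (tracePow n p) := by
  have h := hasTrace_mul p.1 (mulRight E (opProd p ^ n) p.2)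
  rwa [toOp_mulRight, ← mul_assoc, ← opProd, ← pow_succ'] at h

theorem norm_tracePow_le (n : ℕ) (p : HS E × HS E) :
    ‖tracePow n p‖ ≤ (‖p.1‖ * ‖p.2‖) ^ (n + 1) := by
  refine (norm_pair_le _ _).trans ?_
  have h := (norm_mulRight_le (opProd p ^ n) p.2).trans
    (mul_le_mul_of_nonneg_right (norm_opProd_pow_le p n) (norm_nonneg _))
  calc _ ≤ ‖p.1‖ * ((‖p.1‖ * ‖p.2‖) ^ n * ‖p.2‖) := by gcongr
    _ = _ := by ring

/-- The functional `(A, B) ↦ tr (A Γ X) + tr (B X Λ)`. -/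
def traceForm (X : E →L[ℂ] E) (p : HS E × HS E) : HS E × HS E →L[ℂ] ℂ :=
  (pair E).flip (mulRight E X p.2) ∘L ContinuousLinearMap.fst ℂ _ _ +
    (pair E).flip (mulLeft E X p.1) ∘L ContinuousLinearMap.snd ℂ _ _

theorem traceForm_apply (X : E →L[ℂ] E) (p v : HS E × HS E) :
    traceForm X p v = pair E v.1 (mulRight E X p.2) + pair E v.2 (mulLeft E X p.1) := rfl

theorem norm_traceForm_le (X : E →L[ℂ] E) (p : HS E × HS E) :
    ‖traceForm X p‖ ≤ ‖X‖ * (‖p.1‖ + ‖p.2‖) := by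
  refine ContinuousLinearMap.opNorm_le_bound _ (by positivity) fun v => ?_
  rw [traceForm_apply]
  calc _ ≤ ‖v.1‖ * (‖X‖ * ‖p.2‖) + ‖v.2‖ * (‖X‖ * ‖p.1‖) := by
        refine (norm_add_le _ _).trans (add_le_add ?_ ?_)
        · exact (norm_pair_le _ _).trans (by gcongr; exact norm_mulRight_le _ _)
        · exact (norm_pair_le _ _).trans (by gcongr; exact norm_mulLeft_le _ _)
    _ ≤ ‖v‖ * (‖X‖ * ‖p.2‖) + ‖v‖ * (‖X‖ * ‖p.1‖) := by
        gcongr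
        · exact norm_fst_le v
        · exact norm_snd_le v
    _ = _ := by ring

/-- One Leibniz term of the differential of (ΛΓ)^n. Cyclicity brings together the powers on the two
sides of the varied factor, so the position of that factor does not matter. Here `pair_eq_of_mul_eq`
regroups a product under the trace and `pair_comm` rotates it. -/
theorem pair_mulRight_pow_mul (p v : HS E × HS E) {n i j : ℕ} (hn : j + 1 + i = n) :
    pair E p.1 (mulRight E (opProd p ^ j *
      (toOp E p.1 * toOp E v.2 + toOp E v.1 * toOp E p.2) * opProd p ^ i) p.2) =
      traceForm (opProd p ^ n) p v := by
  have hpow : opProd p ^ n = opProd p ^ i * opProd p ^ (j + 1) := by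
    rw [← pow_add, ← hn, add_comm]
  rw [mul_add, add_mul, map_add, add_apply, map_add, add_comm, traceForm_apply]
  congr 1
  · rw [pair_eq_of_mul_eq (S' := mulLeft E (opProd p ^ (j + 1)) v.1)
      (T' := mulRight E (opProd p ^ i) p.2) (by simp [pow_succ', opProd, mul_assoc]), pair_comm,
      pair_comm v.1]
    refine pair_eq_of_mul_eq ?_
    simp [mul_assoc, hpow]
  · rw [pair_eq_of_mul_eq (S' := mulLeft E (opProd p ^ (j + 1)) p.1)
      (T' := mulRight E (opProd p ^ i) v.2) (by simp [pow_succ', opProd, mul_assoc]), pair_comm]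
    refine pair_eq_of_mul_eq ?_
    simp [mul_assoc, hpow]

/-- The inner power contributes n equal terms, and the variations of the outer Λ and Γ together
contribute one more. -/
theorem hasFDerivAt_tracePow (n : ℕ) (p : HS E × HS E) :
    HasFDerivAt (fun p => tracePow n p) ((n + 1 : ℂ) • traceForm (opProd p ^ n) p) p := by
  have h1 : HasFDerivAt (fun p : HS E × HS E => toOpL E p.1)
      (toOpL E ∘L ContinuousLinearMap.fst ℂ _ _) p := (toOpL E).hasFDerivAt.comp p hasFDerivAt_fst
  have h2 : HasFDerivAt (fun p : HS E × HS E => toOpL E p.2)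
      (toOpL E ∘L ContinuousLinearMap.snd ℂ _ _) p := (toOpL E).hasFDerivAt.comp p hasFDerivAt_snd
  have h3 : HasFDerivAt (opProd (E := E)) _ p := h1.mul' h2
  obtain ⟨D, hD, h4⟩ : ∃ D : HS E × HS E →L[ℂ] E →L[ℂ] E, (∀ v, D v =
      ∑ i ∈ Finset.range n, opProd p ^ (n.pred - i) *
        (toOp E p.1 * toOp E v.2 + toOp E v.1 * toOp E p.2) * opProd p ^ i) ∧
      HasFDerivAt (fun p => opProd p ^ n) D p :=
    ⟨_, fun v => by rw [sum_apply]; rfl, h3.pow' n⟩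
  have h5 := (mulRight E).hasFDerivAt_of_bilinear h4
    (hasFDerivAt_snd (𝕜 := ℂ) (p := p))
  have h6 := (pair E).hasFDerivAt_of_bilinear (hasFDerivAt_fst (𝕜 := ℂ) (p := p)) h5
  refine h6.congr_fderiv (ContinuousLinearMap.ext fun v => ?_)
  have h7 : pair E p.1 (mulRight E (D v) p.2) = n * traceForm (opProd p ^ n) p v := by
    rw [hD, map_sum, sum_apply, map_sum,
      Finset.sum_congr rfl fun i hi => pair_mulRight_pow_mul p v (n := n) (by
      have := Finset.mem_range.1 hi
      rw [Nat.pred_eq_sub_one]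
      omega)]
    simp
  change pair E p.1 (mulRight E (opProd p ^ n) v.2 + mulRight E (D v) p.2) +
    pair E v.1 (mulRight E (opProd p ^ n) p.2) = (n + 1 : ℂ) * traceForm (opProd p ^ n) p v
  rw [map_add, h7, traceForm_apply, pair_comm p.1, pair_eq_of_mul_eq (S := mulRight E _ v.2)
    (S' := v.2) (T' := mulLeft E (opProd p ^ n) p.1) (by simp [mul_assoc])]
  ring

/-- The weight 1/(n+1) cancels the factor n+1 of each differential. What remains is dominated by a
geometric series on a ball of radius ρ < 1 and sums to the Neumann series. -/
theorem hasFDerivAt_tsum_tracePow {p : HS E × HS E} (h1 : ‖p.1‖ < 1) (h2 : ‖p.2‖ < 1) :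
    HasFDerivAt (fun p : HS E × HS E => ∑' n : ℕ, (1 / ((n : ℂ) + 1)) * tracePow n p)
      (traceForm (∑' n : ℕ, opProd p ^ n) p) p := by
  have hp : ‖p‖ < 1 := max_lt h1 h2
  obtain ⟨ρ, hρ, hρ1⟩ := exists_between hp
  have hρ0 : 0 ≤ ρ := (norm_nonneg p).trans hρ.le
  have hu : Summable fun n : ℕ => (ρ * ρ) ^ n * (ρ + ρ) :=
    (summable_geometric_of_lt_one (by positivity) (by nlinarith)).mul_right _
  have hb : ∀ (n : ℕ) (x : HS E × HS E), x ∈ Metric.ball (0 : HS E × HS E) ρ →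
      ‖traceForm (opProd x ^ n) x‖ ≤ (ρ * ρ) ^ n * (ρ + ρ) := by
    intro n x hx
    rw [mem_ball_zero_iff] at hx
    have h1 := (norm_fst_le x).trans hx.le
    have h2 := (norm_snd_le x).trans hx.le
    refine (norm_traceForm_le _ _).trans ?_
    gcongr
    refine (norm_opProd_pow_le _ _).trans ?_
    gcongr
  have hX : ‖opProd p‖ < 1 := (norm_opProd_le p).trans_lt
    (by nlinarith [norm_nonneg p.1, norm_nonneg p.2])
  have hsX : Summable fun n => opProd p ^ n := summable_geometric_of_norm_lt_one hX
  have key := hasFDerivAt_tsum_of_isPreconnected hu (Metric.isOpen_ball (x := 0) (ε := ρ))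
    (convex_ball (0 : HS E × HS E) ρ).isPreconnected
    (f := fun (n : ℕ) p => (1 / ((n : ℂ) + 1)) * tracePow n p)
    (f' := fun n p => traceForm (opProd p ^ n) p) (fun n x _ => by
      have h := (hasFDerivAt_tracePow n x).const_mul (1 / ((n : ℂ) + 1))
      refine h.congr_fderiv ?_
      rw [smul_smul, one_div_mul_cancel (Nat.cast_add_one_ne_zero n), one_smul]) hb
    (x₀ := 0) (Metric.mem_ball_self ((norm_nonneg p).trans_lt hρ))
    (by simp [tracePow]) (x := p) (by simpa using hρ)
  refine key.congr_fderiv ?_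
  refine ContinuousLinearMap.ext fun v => ?_
  have hs : Summable fun n => traceForm (opProd p ^ n) p :=
    .of_norm_bounded hu fun n => hb n p (by simpa using hρ)
  rw [← ContinuousLinearMap.apply_apply v (∑' n, _), ContinuousLinearMap.map_tsum _ hs]
  refine HasSum.tsum_eq ?_
  have e1 := (((pair E).flip v.1).comp ((mulRight E).flip p.2)).hasSum hsX.hasSum
  have e2 := (((pair E).flip v.2).comp ((mulLeft E).flip p.1)).hasSum hsX.hasSum
  have := e1.add e2
  simpa [traceForm_apply, pair_comm] using this

end LogDet

/-! ### Multiplication operators and Fourier multipliers -/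

section Multipliers

theorem mulOp_apply_ae {m : ℝ → ℂ} (hm : MemLp m ⊤ volume) (h : L2) :
    mulOp m h =ᵐ[volume] fun x => m x * h x := by
  rw [mulOp, dif_pos hm]
  refine (ContinuousLinearMap.coeFn_holder (r := 2) (ContinuousLinearMap.mul ℂ ℂ)
    (hm.toLp m) h).trans ?_
  filter_upwards [hm.coeFn_toLp] with x hx
  simp [hx]

theorem memLp_top_mul {m n : ℝ → ℂ} (hm : MemLp m ⊤ volume) (hn : MemLp n ⊤ volume) :
    MemLp (fun x => m x * n x) ⊤ volume := hn.mul' hm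

theorem mulOp_mul {m n : ℝ → ℂ} (hm : MemLp m ⊤ volume) (hn : MemLp n ⊤ volume) :
    mulOp (fun x => m x * n x) = mulOp m * mulOp n := by
  refine ContinuousLinearMap.ext fun h => Lp.ext ?_
  filter_upwards [mulOp_apply_ae (memLp_top_mul hm hn) h, mulOp_apply_ae hm (mulOp n h),
    mulOp_apply_ae hn h] with x h1 h2 h3
  rw [h1, mul_apply_eq_comp, h2, h3, mul_assoc]

theorem mulOp_add {m n : ℝ → ℂ} (hm : MemLp m ⊤ volume) (hn : MemLp n ⊤ volume) :
    mulOp (fun x => m x + n x) = mulOp m + mulOp n := by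
  refine ContinuousLinearMap.ext fun h => Lp.ext ?_
  filter_upwards [mulOp_apply_ae (hm.add hn) h, mulOp_apply_ae hm h,
    mulOp_apply_ae hn h, Lp.coeFn_add (mulOp m h) (mulOp n h)] with x h1 h2 h3 h4
  rw [add_apply, h4, Pi.add_apply, h2, h3, ← add_mul]
  exact h1

theorem mulOp_const_mul (c : ℂ) {m : ℝ → ℂ} (hm : MemLp m ⊤ volume) :
    mulOp (fun x => c * m x) = c • mulOp m := by
  refine ContinuousLinearMap.ext fun h => Lp.ext ?_
  filter_upwards [mulOp_apply_ae (hm.const_mul c) h, mulOp_apply_ae hm h,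
    Lp.coeFn_smul c (mulOp m h)] with x h1 h2 h3
  rw [h1, smul_apply, h3, Pi.smul_apply, h2, smul_eq_mul, mul_assoc]

theorem memLp_top_conj {m : ℝ → ℂ} (hm : MemLp m ⊤ volume) :
    MemLp (fun x => (starRingEnd ℂ) (m x)) ⊤ volume :=
  hm.star

theorem adjoint_mulOp {m : ℝ → ℂ} (hm : MemLp m ⊤ volume) :
    adjoint (mulOp m) = mulOp fun x => (starRingEnd ℂ) (m x) := by
  symm
  rw [ContinuousLinearMap.eq_adjoint_iff]
  intro f g
  rw [L2.inner_def, L2.inner_def]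
  refine integral_congr_ae ?_
  filter_upwards [mulOp_apply_ae hm g, mulOp_apply_ae (memLp_top_conj hm) f] with x h1 h2
  rw [h1, h2]
  simp [mul_comm, mul_left_comm, mul_assoc]

/-- The Fourier transform on `L²`. -/
abbrev FT : L2 ≃ₗᵢ[ℂ] L2 := Lp.fourierTransformₗᵢ ℝ ℂ

theorem FT_fourierMul (m : ℝ → ℂ) (h : L2) :
    FT (fourierMul m h) = mulOp (fun y => m (2 * Real.pi * y)) (FT h) :=
  FT.apply_symm_apply _

theorem fourierMul_comp (m n : ℝ → ℂ) (h : L2) :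
    FT ((fourierMul m * fourierMul n) h) =
      (mulOp (fun y => m (2 * Real.pi * y)) * mulOp (fun y => n (2 * Real.pi * y))) (FT h) := by
  rw [mul_apply_eq_comp, mul_apply_eq_comp, FT_fourierMul, FT_fourierMul]

theorem adjoint_fourierMul {m : ℝ → ℂ} (hm : MemLp (fun y => m (2 * Real.pi * y)) ⊤ volume) :
    adjoint (fourierMul m) = fourierMul fun ξ => (starRingEnd ℂ) (m ξ) := by
  symm
  rw [ContinuousLinearMap.eq_adjoint_iff]
  intro f g
  rw [← FT.inner_map_map, ← FT.inner_map_map f, FT_fourierMul, FT_fourierMul,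
    ← adjoint_mulOp hm, ContinuousLinearMap.adjoint_inner_left]

end Multipliers

/-! ### Products of Schwartz functions and convolution -/

section Schwartz

/-- The pointwise product of Schwartz functions. -/
def sMul (f g : 𝓢(ℝ, ℂ)) : 𝓢(ℝ, ℂ) := SchwartzMap.pairing (ContinuousLinearMap.mul ℂ ℂ) f g

@[simp] theorem sMul_apply (f g : 𝓢(ℝ, ℂ)) (x : ℝ) : sMul f g x = f x * g x := rfl

/-- The complex conjugate of a Schwartz function. -/
def sConj (f : 𝓢(ℝ, ℂ)) : 𝓢(ℝ, ℂ) :=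
  SchwartzMap.postcompCLM (Complex.conjCLE : ℂ →L[ℝ] ℂ) f

@[simp] theorem sConj_apply (f : 𝓢(ℝ, ℂ)) (x : ℝ) : sConj f x = (starRingEnd ℂ) (f x) := rfl

/-- The function `η ↦ f (ξ - η)`. -/
def sRefl (f : 𝓢(ℝ, ℂ)) (ξ : ℝ) : 𝓢(ℝ, ℂ) :=
  SchwartzMap.compSubConstCLM ℂ ξ
    (SchwartzMap.compCLMOfContinuousLinearEquiv ℂ (ContinuousLinearEquiv.neg ℝ) f)

@[simp] theorem sRefl_apply (f : 𝓢(ℝ, ℂ)) (ξ η : ℝ) : sRefl f ξ η = f (ξ - η) := by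
  simp [sRefl]

theorem schwartz_memLp_top (f : 𝓢(ℝ, ℂ)) : MemLp (fun x => f x) ⊤ volume := f.memLp ⊤ volume

theorem mulOp_toLp (f h : 𝓢(ℝ, ℂ)) :
    mulOp (fun x => f x) (h.toLp 2) = (sMul f h).toLp 2 := by
  refine Lp.ext ?_
  filter_upwards [mulOp_apply_ae (schwartz_memLp_top f) (h.toLp 2), h.coeFn_toLp 2 volume,
    (sMul f h).coeFn_toLp 2 volume] with x h1 h2 h3
  rw [h1, h2, h3, sMul_apply]

theorem fourier_fourier_apply (f : 𝓢(ℝ, ℂ)) (x : ℝ) : 𝓕 (𝓕 f) x = f (-x) := by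
  have h := SchwartzMap.fourierInv_apply_eq (𝓕 f)
  rw [FourierTransform.fourierInv_fourier_eq] at h
  conv_rhs => rw [h]
  simp

theorem fourier_sMul (f h : 𝓢(ℝ, ℂ)) (ξ : ℝ) :
    𝓕 (sMul f h) ξ = ∫ η, 𝓕 f (ξ - η) * 𝓕 h η := by
  have h1 : 𝓕 (sMul f h) =
      SchwartzMap.convolution (ContinuousLinearMap.mul ℂ ℂ) (𝓕 h) (𝓕 f) := by
    refine (FourierTransform.fourierEquiv ℂ 𝓢(ℝ, ℂ)).injective ?_
    change (𝓕 (𝓕 (sMul f h) : 𝓢(ℝ, ℂ)) : 𝓢(ℝ, ℂ)) =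
      𝓕 (SchwartzMap.convolution (ContinuousLinearMap.mul ℂ ℂ) (𝓕 h) (𝓕 f))
    rw [SchwartzMap.fourier_convolution]
    ext x
    simp [fourier_fourier_apply, mul_comm]
  rw [h1, SchwartzMap.convolution_apply]
  simp [MeasureTheory.convolution, mul_comm]

theorem integral_sRefl_mul (f : 𝓢(ℝ, ℂ)) (ξ : ℝ) (g : L2) :
    ∫ η, f (ξ - η) * g η = ⟪(sConj (sRefl f ξ)).toLp 2, g⟫_ℂ := by
  rw [L2.inner_def]
  refine integral_congr_ae ?_
  filter_upwards [(sConj (sRefl f ξ)).coeFn_toLp 2 volume] with x hx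
  rw [hx]
  simp [mul_comm]

/-- The convolution theorem, extended from Schwartz h by density: at each fixed ξ the right side is
continuous in h, while the left side converges almost everywhere along a subsequence. -/
theorem FT_mulOp (f : 𝓢(ℝ, ℂ)) (h : L2) :
    FT (mulOp (fun x => f x) h) =ᵐ[volume]
      fun ξ => ⟪(sConj (sRefl (𝓕 f) ξ)).toLp 2, FT h⟫_ℂ := by
  have hdense := SchwartzMap.denseRange_toLpCLM (E := ℝ) (F := ℂ) (p := 2) (μ := volume)
    ENNReal.ofNat_ne_top
  refine hdense.induction_on (p := fun h => FT (mulOp (fun x => f x) h) =ᵐ[volume]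
      fun ξ => ⟪(sConj (sRefl (𝓕 f) ξ)).toLp 2, FT h⟫_ℂ) h ?_ ?_
  · refine IsSeqClosed.isClosed fun u h hu hlim => ?_
    have h1 : Filter.Tendsto (fun n => FT (mulOp (fun x => f x) (u n))) Filter.atTop
        (nhds (FT (mulOp (fun x => f x) h))) :=
      ((FT.continuous.comp (mulOp fun x => f x).continuous).tendsto h).comp hlim
    obtain ⟨φ, hφ, hae⟩ := (tendstoInMeasure_of_tendsto_Lp h1).exists_seq_tendsto_ae
    have h2 : ∀ᵐ ξ, ∀ n, FT (mulOp (fun x => f x) (u n)) ξ =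
        ⟪(sConj (sRefl (𝓕 f) ξ)).toLp 2, FT (u n)⟫_ℂ := ae_all_iff.2 hu
    filter_upwards [hae, h2] with ξ h3 h4
    simp_rw [h4] at h3
    refine tendsto_nhds_unique h3 ?_
    have h5 : Continuous fun h => ⟪(sConj (sRefl (𝓕 f) ξ)).toLp 2, FT h⟫_ℂ :=
      continuous_const.inner FT.continuous
    exact ((h5.tendsto h).comp hlim).comp hφ.tendsto_atTop
  · intro h
    have h1 : ∀ g : 𝓢(ℝ, ℂ), FT (g.toLp 2) = (𝓕 g).toLp 2 := SchwartzMap.toLp_fourier_eq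
    rw [toLpCLM_apply, mulOp_toLp, h1, h1]
    filter_upwards [(𝓕 (sMul f h)).coeFn_toLp 2 volume] with ξ h2
    rw [h2, fourier_sMul, ← integral_sRefl_mul]
    refine integral_congr_ae ?_
    filter_upwards [(𝓕 h).coeFn_toLp 2 volume] with η h3
    rw [h3]

end Schwartz

/-! ### Hilbert–Schmidt norms and traces of operators given by rows on the Fourier side -/

section Rows

/-- Distinct members lie at distance √2, so balls of radius 1/2 around them are disjoint.
Countability provides one null set that serves all basis vectors at once. -/
theorem orthonormal_countable {E : Type} [NormedAddCommGroup E] [InnerProductSpace ℂ E]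
    [TopologicalSpace.SeparableSpace E] {ι : Type} {v : ι → E} (hv : Orthonormal ℂ v) :
    Countable ι := by
  have h : (Set.univ : Set ι).Countable := by
    refine Set.PairwiseDisjoint.countable_of_isOpen (s := fun i => Metric.ball (v i) (1 / 2))
      ?_ (fun i _ => Metric.isOpen_ball) (fun i _ => Metric.nonempty_ball.2 (by norm_num))
    intro i _ j _ hij
    refine Metric.ball_disjoint_ball ?_
    have h1 : ‖v i - v j‖ ^ 2 = 2 := by
      rw [@norm_sub_sq ℂ, hv.1 i, hv.1 j, hv.2 hij]
      norm_num
    rw [dist_eq_norm]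
    nlinarith [norm_nonneg (v i - v j)]
  exact Set.countable_univ_iff.1 h

instance : TopologicalSpace.SeparableSpace L2 :=
  haveI : Fact ((2 : ℝ≥0∞) ≠ ⊤) := ⟨ENNReal.ofNat_ne_top⟩
  inferInstanceAs (TopologicalSpace.SeparableSpace (Lp ℂ 2 (volume : Measure ℝ)))

instance : Countable (stdIndex L2) := orthonormal_countable (stdBasis L2).orthonormal

/-- The basis of `L²` whose Fourier transform is the standard basis. -/
def fourierBasis : HilbertBasis (stdIndex L2) ℂ L2 := .ofRepr (FT.trans (stdBasis L2).repr)

theorem FT_fourierBasis (i : stdIndex L2) : FT (fourierBasis i) = stdBasis L2 i := by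
  classical
  rw [← HilbertBasis.repr_symm_single, ← HilbertBasis.repr_symm_single]
  exact FT.apply_symm_apply _

/-- On the Fourier side, `T` is the integral operator whose row at the frequency `ξ` is the
complex conjugate of `ρ ξ`. -/
def HasRows (T : L2 →L[ℂ] L2) (ρ : ℝ → L2) : Prop :=
  ∀ h : L2, FT (T h) =ᵐ[volume] fun ξ => ⟪ρ ξ, FT h⟫_ℂ

theorem L2_enorm_sq (f : L2) : ‖f‖ₑ ^ 2 = ∫⁻ x, ‖f x‖ₑ ^ 2 := by
  rw [Lp.enorm_def, eLpNorm_eq_lintegral_rpow_enorm_toReal two_ne_zero ENNReal.ofNat_ne_top,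
    ← ENNReal.rpow_natCast, ← ENNReal.rpow_mul]
  simp

theorem L2_integrable_sq (f : L2) : Integrable fun x => ‖f x‖ ^ 2 :=
  (memLp_two_iff_integrable_sq_norm (Lp.aestronglyMeasurable f)).1 (Lp.memLp f)

theorem L2_norm_sq (f : L2) : ‖f‖ ^ 2 = ∫ x, ‖f x‖ ^ 2 := by
  rw [integral_eq_lintegral_of_nonneg_ae (.of_forall fun _ => by positivity)
    (L2_integrable_sq f).aestronglyMeasurable]
  simp_rw [ENNReal.ofReal_pow (norm_nonneg _), ofReal_norm]
  rw [← L2_enorm_sq]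
  simp

/-- In the basis whose Fourier transform is the standard one, Parseval can be applied to the row at
each frequency, under the integral. -/
theorem HasRows.hsSq_eq {T : L2 →L[ℂ] L2} {ρ : ℝ → L2} (h : HasRows T ρ) :
    hsSq fourierBasis T = ∫⁻ ξ, ‖ρ ξ‖ₑ ^ 2 := by
  have h1 : ∀ i, ‖T (fourierBasis i)‖ₑ ^ 2 = ∫⁻ ξ, ‖⟪stdBasis L2 i, ρ ξ⟫_ℂ‖ₑ ^ 2 := by
    intro i
    rw [← FT.enorm_map, L2_enorm_sq]
    refine lintegral_congr_ae ?_
    filter_upwards [h (fourierBasis i)] with ξ hξ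
    rw [hξ, FT_fourierBasis, ← ofReal_norm, norm_inner_symm, ofReal_norm]
  unfold hsSq
  simp_rw [h1]
  rw [← lintegral_tsum]
  · simp_rw [tsum_enorm_inner_sq]
  · intro i
    have h2 : AEMeasurable (fun ξ => ‖FT (T (fourierBasis i)) ξ‖ₑ ^ 2) volume :=
      ((Lp.aestronglyMeasurable _).enorm).pow_const 2
    refine h2.congr ?_
    filter_upwards [h (fourierBasis i)] with ξ hξ
    rw [hξ, FT_fourierBasis, ← ofReal_norm, norm_inner_symm, ofReal_norm]

/-- Plancherel writes each diagonal entry as an integral over frequencies. The Hilbert–Schmidt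
bounds justify exchanging sum and integral, and Parseval then sums over the basis at each ξ. The
adjoint of `S` enters because `S` is moved to the left slot of the inner product. -/
theorem HasRows.pair_eq {S T : HS L2} {σ ρ : ℝ → L2}
    (hS : HasRows (adjoint (HS.toOp L2 S)) σ) (hT : HasRows (HS.toOp L2 T) ρ) :
    HS.pair L2 S T = ∫ ξ, ⟪ρ ξ, σ ξ⟫_ℂ := by
  have h1 := HS.hasTrace_mul S T _ fourierBasis
  let F : stdIndex L2 → ℝ → ℂ := fun i ξ =>
    ⟪FT (adjoint (HS.toOp L2 S) (fourierBasis i)) ξ, FT (HS.toOp L2 T (fourierBasis i)) ξ⟫_ℂ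
  have h2 : ∀ i, ⟪fourierBasis i, (HS.toOp L2 S * HS.toOp L2 T) (fourierBasis i)⟫_ℂ =
      ∫ ξ, F i ξ := by
    intro i
    rw [mul_apply_eq_comp, ← ContinuousLinearMap.adjoint_inner_left, ← FT.inner_map_map,
      L2.inner_def]
  have h3 : ∀ i, Integrable (F i) := fun i => L2.integrable_inner _ _
  have h4 : Summable fun i => ∫ ξ, ‖F i ξ‖ := by
    have hs : ∀ T : HS L2, Summable fun i => ‖HS.toOp L2 T (fourierBasis i)‖ ^ 2 := by
      intro T
      have h := ENNReal.summable_toReal (HS.hsSq_ne_top T fourierBasis)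
      simpa using h
    refine Summable.of_nonneg_of_le (fun i => integral_nonneg fun _ => norm_nonneg _) (fun i => ?_)
      ((hs (HS.adj S)).add (hs T))
    calc ∫ ξ, ‖F i ξ‖ ≤ ∫ ξ, (‖FT (adjoint (HS.toOp L2 S) (fourierBasis i)) ξ‖ ^ 2 +
          ‖FT (HS.toOp L2 T (fourierBasis i)) ξ‖ ^ 2) := by
          refine integral_mono (h3 i).norm
            ((L2_integrable_sq _).add (L2_integrable_sq _)) fun ξ => ?_
          refine (norm_inner_le_norm _ _).trans ?_
          nlinarith [sq_nonneg (‖FT (adjoint (HS.toOp L2 S) (fourierBasis i)) ξ‖ -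
            ‖FT (HS.toOp L2 T (fourierBasis i)) ξ‖),
            sq_nonneg (‖FT (adjoint (HS.toOp L2 S) (fourierBasis i)) ξ‖),
            sq_nonneg (‖FT (HS.toOp L2 T (fourierBasis i)) ξ‖)]
      _ = _ := by
          rw [integral_add (L2_integrable_sq _) (L2_integrable_sq _),
            ← L2_norm_sq, ← L2_norm_sq, FT.norm_map, FT.norm_map]
          rfl
  have h5 := hasSum_integral_of_summable_integral_norm h3 h4
  simp_rw [h2] at h1
  rw [h1.unique h5]
  refine integral_congr_ae ?_
  have h6 : ∀ᵐ ξ, ∀ i, F i ξ = ⟪ρ ξ, stdBasis L2 i⟫_ℂ * ⟪stdBasis L2 i, σ ξ⟫_ℂ := by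
    refine ae_all_iff.2 fun i => ?_
    filter_upwards [hS (fourierBasis i), hT (fourierBasis i)] with ξ e1 e2
    simp only [F]
    rw [e1, e2, FT_fourierBasis]
    simp
  filter_upwards [h6] with ξ e
  simp_rw [e]
  exact (stdBasis L2).tsum_inner_mul_inner _ _

end Rows

/-! ### Multiplication by a Schwartz function between two Fourier multipliers -/

section Sandwich

theorem FT_toLp (f : 𝓢(ℝ, ℂ)) : FT (f.toLp 2) = (𝓕 f).toLp 2 := SchwartzMap.toLp_fourier_eq f

/-- The operator `m(-i∂) f n(-i∂)`. -/
def sandwich (m : ℝ → ℂ) (f : 𝓢(ℝ, ℂ)) (n : ℝ → ℂ) : L2 →L[ℂ] L2 :=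
  fourierMul m * mulOp (fun x => f x) * fourierMul n

/-- The rows of `sandwich m f n`. -/
def sandwichRow (m : ℝ → ℂ) (f : 𝓢(ℝ, ℂ)) (n : ℝ → ℂ) (ξ : ℝ) : L2 :=
  (starRingEnd ℂ) (m (2 * Real.pi * ξ)) •
    mulOp (fun y => (starRingEnd ℂ) (n (2 * Real.pi * y))) ((sConj (sRefl (𝓕 f) ξ)).toLp 2)

variable {m n : ℝ → ℂ} (hm : MemLp (fun y => m (2 * Real.pi * y)) ⊤ volume)
  (hn : MemLp (fun y => n (2 * Real.pi * y)) ⊤ volume)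

include hm hn

theorem hasRows_sandwich (f : 𝓢(ℝ, ℂ)) : HasRows (sandwich m f n) (sandwichRow m f n) := by
  intro h
  rw [sandwich, mul_assoc, mul_apply_eq_comp, FT_fourierMul, mul_apply_eq_comp]
  refine (mulOp_apply_ae hm _).trans ?_
  filter_upwards [FT_mulOp f (fourierMul n h)] with ξ h1
  rw [h1, FT_fourierMul, sandwichRow, inner_smul_left, RingHomCompTriple.comp_apply,
    ← adjoint_mulOp hn, ContinuousLinearMap.adjoint_inner_left]
  simp

omit hm in
theorem sandwichRow_ae (f : 𝓢(ℝ, ℂ)) (ξ : ℝ) : sandwichRow m f n ξ =ᵐ[volume] fun η =>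
    (starRingEnd ℂ) (m (2 * Real.pi * ξ) * 𝓕 f (ξ - η) * n (2 * Real.pi * η)) := by
  filter_upwards [Lp.coeFn_smul ((starRingEnd ℂ) (m (2 * Real.pi * ξ)))
    (mulOp (fun y => (starRingEnd ℂ) (n (2 * Real.pi * y))) ((sConj (sRefl (𝓕 f) ξ)).toLp 2)),
    mulOp_apply_ae (memLp_top_conj hn) ((sConj (sRefl (𝓕 f) ξ)).toLp 2),
    (sConj (sRefl (𝓕 f) ξ)).coeFn_toLp 2 volume] with η h1 h2 h3
  rw [sandwichRow, h1, Pi.smul_apply, h2, h3]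
  simp
  ring

omit hm in
theorem enorm_sandwichRow_sq (f : 𝓢(ℝ, ℂ)) (ξ : ℝ) : ‖sandwichRow m f n ξ‖ₑ ^ 2 =
    ∫⁻ η, ‖m (2 * Real.pi * ξ)‖ₑ ^ 2 * ‖𝓕 f (ξ - η)‖ₑ ^ 2 * ‖n (2 * Real.pi * η)‖ₑ ^ 2 := by
  rw [L2_enorm_sq]
  refine lintegral_congr_ae ?_
  filter_upwards [sandwichRow_ae hn f ξ] with η h1
  rw [h1, ← mul_pow, ← mul_pow, ← enorm_mul, ← enorm_mul]
  congr 1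
  rw [← ofReal_norm, RCLike.norm_conj, ofReal_norm]

theorem adjoint_sandwich (f : 𝓢(ℝ, ℂ)) : adjoint (sandwich m f n) =
    sandwich (fun ξ => (starRingEnd ℂ) (n ξ)) (sConj f) (fun ξ => (starRingEnd ℂ) (m ξ)) := by
  simp only [sandwich, ContinuousLinearMap.mul_def, ContinuousLinearMap.adjoint_comp]
  rw [adjoint_fourierMul hm, adjoint_fourierMul hn, adjoint_mulOp (schwartz_memLp_top f)]
  rfl

/-- The kernel is m(2πξ) f̂(ξ − η) n(2πη). The inequality 2|m|²|n|² ≤ |m|⁴ + |n|⁴ separates the two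
symbols, and translation invariance then integrates |f̂|² alone. -/
theorem two_mul_hsSq_sandwich_le (f : 𝓢(ℝ, ℂ)) (hm' : Measurable m) (hn' : Measurable n) :
    2 * hsSq fourierBasis (sandwich m f n) ≤
      ((∫⁻ ξ, ‖m (2 * Real.pi * ξ)‖ₑ ^ 4) + ∫⁻ ξ, ‖n (2 * Real.pi * ξ)‖ₑ ^ 4) *
        ‖f.toLp 2‖ₑ ^ 2 := by
  have hF : ‖f.toLp 2‖ₑ ^ 2 = ∫⁻ ξ, ‖𝓕 f ξ‖ₑ ^ 2 := by
    rw [← FT.enorm_map, FT_toLp, L2_enorm_sq]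
    refine lintegral_congr_ae ?_
    filter_upwards [(𝓕 f).coeFn_toLp 2 volume] with x hx
    rw [hx]
  have hF' : ∫⁻ ξ, ‖𝓕 f ξ‖ₑ ^ 2 ≠ ⊤ := by
    rw [← hF]
    finiteness
  have mF : Measurable fun p : ℝ × ℝ => ‖𝓕 f (p.1 - p.2)‖ₑ ^ 2 :=
    (((𝓕 f).continuous.measurable.comp (measurable_fst.sub measurable_snd)).enorm).pow_const 2
  rw [(hasRows_sandwich hm hn f).hsSq_eq]
  simp_rw [enorm_sandwichRow_sq hn f]
  calc 2 * ∫⁻ ξ, ∫⁻ η, ‖m (2 * Real.pi * ξ)‖ₑ ^ 2 * ‖𝓕 f (ξ - η)‖ₑ ^ 2 * ‖n (2 * Real.pi * η)‖ₑ ^ 2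
      = ∫⁻ ξ, ∫⁻ η, 2 * (‖m (2 * Real.pi * ξ)‖ₑ ^ 2 * ‖𝓕 f (ξ - η)‖ₑ ^ 2 *
          ‖n (2 * Real.pi * η)‖ₑ ^ 2) := by
        rw [← lintegral_const_mul' _ _ (by norm_num)]
        simp_rw [← lintegral_const_mul' _ _ (ENNReal.ofNat_ne_top (n := 2))]
    _ ≤ ∫⁻ ξ, ∫⁻ η, (‖m (2 * Real.pi * ξ)‖ₑ ^ 4 * ‖𝓕 f (ξ - η)‖ₑ ^ 2 +
          ‖n (2 * Real.pi * η)‖ₑ ^ 4 * ‖𝓕 f (ξ - η)‖ₑ ^ 2) := by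
        refine lintegral_mono fun ξ => lintegral_mono fun η => ?_
        simp only [enorm_eq_nnnorm]
        norm_cast
        have h := two_mul_le_add_sq (‖m (2 * Real.pi * ξ)‖₊ ^ 2) (‖n (2 * Real.pi * η)‖₊ ^ 2)
        calc _ = (2 * ‖m (2 * Real.pi * ξ)‖₊ ^ 2 * ‖n (2 * Real.pi * η)‖₊ ^ 2) *
              ‖𝓕 f (ξ - η)‖₊ ^ 2 := by ring
          _ ≤ ((‖m (2 * Real.pi * ξ)‖₊ ^ 2) ^ 2 + (‖n (2 * Real.pi * η)‖₊ ^ 2) ^ 2) *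
              ‖𝓕 f (ξ - η)‖₊ ^ 2 := by gcongr
          _ = _ := by ring
    _ = (∫⁻ ξ, ∫⁻ η, ‖m (2 * Real.pi * ξ)‖ₑ ^ 4 * ‖𝓕 f (ξ - η)‖ₑ ^ 2) +
          ∫⁻ ξ, ∫⁻ η, ‖n (2 * Real.pi * η)‖ₑ ^ 4 * ‖𝓕 f (ξ - η)‖ₑ ^ 2 := by
        rw [← lintegral_add_left]
        · refine lintegral_congr fun ξ => lintegral_add_left ?_ _
          exact (mF.comp measurable_prodMk_left).const_mul _
        · refine Measurable.lintegral_prod_right ?_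
          exact ((hm'.comp (measurable_fst.const_mul _)).enorm.pow_const 4).mul mF
    _ = _ := by
        rw [hF, add_mul]
        congr 1
        · rw [← lintegral_mul_const' _ _ hF']
          refine lintegral_congr fun ξ => ?_
          rw [lintegral_const_mul' _ _ (by finiteness)]
          congr 1
          exact lintegral_sub_left_eq_self (fun η => ‖𝓕 f η‖ₑ ^ 2) ξ
        · rw [lintegral_lintegral_swap]
          · rw [← lintegral_mul_const' _ _ hF']
            refine lintegral_congr fun η => ?_
            rw [lintegral_const_mul' _ _ (by finiteness)]
            congr 1
            exact lintegral_sub_right_eq_self (fun η => ‖𝓕 f η‖ₑ ^ 2) η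
          · refine Measurable.aemeasurable ?_
            exact ((hn'.comp (measurable_snd.const_mul _)).enorm.pow_const 4).mul mF

end Sandwich

/-! ### The symbols of the half inverses -/

section Symbols

/-- The symbol of `(∂ + c)^{-1/2}`. -/
def halfSymbol (c ξ : ℝ) : ℂ := (Complex.I * ξ + c) ^ (-(1 / 2) : ℂ)

theorem halfInv_eq (c : ℝ) : halfInv c = fourierMul (halfSymbol c) := rfl

theorem normSq_symbol (c ξ : ℝ) : ‖Complex.I * ξ + (c : ℂ)‖ ^ 2 = ξ ^ 2 + c ^ 2 := by
  rw [← Complex.normSq_eq_norm_sq, Complex.normSq_apply]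
  simp
  ring

theorem symbol_ne_zero {c : ℝ} (hc : c ≠ 0) (ξ : ℝ) : Complex.I * ξ + (c : ℂ) ≠ 0 := by
  intro h
  have := normSq_symbol c ξ
  rw [h] at this
  simp at this
  have : 0 < c ^ 2 := by positivity
  nlinarith [sq_nonneg ξ]

theorem halfSymbol_mul_self {c : ℝ} (hc : c ≠ 0) (ξ : ℝ) :
    halfSymbol c ξ * halfSymbol c ξ = (Complex.I * ξ + c)⁻¹ := by
  rw [halfSymbol, ← Complex.cpow_add _ _ (symbol_ne_zero hc ξ), ← Complex.cpow_neg_one]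
  norm_num

theorem norm_halfSymbol_sq {c : ℝ} (hc : c ≠ 0) (ξ : ℝ) :
    ‖halfSymbol c ξ‖ ^ 4 = (ξ ^ 2 + c ^ 2)⁻¹ := by
  have h : ‖halfSymbol c ξ‖ ^ 4 = (‖halfSymbol c ξ * halfSymbol c ξ‖) ^ 2 := by
    rw [norm_mul]; ring
  rw [h, halfSymbol_mul_self hc, norm_inv, inv_pow, normSq_symbol]

theorem measurable_halfSymbol (c : ℝ) : Measurable (halfSymbol c) := by
  unfold halfSymbol
  fun_prop

theorem memLp_halfSymbol {c : ℝ} (hc : c ≠ 0) :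
    MemLp (fun y => halfSymbol c (2 * Real.pi * y)) ⊤ volume := by
  refine memLp_top_of_bound ((measurable_halfSymbol c).comp
    (measurable_id.const_mul _)).aestronglyMeasurable (1 + (c ^ 2)⁻¹) (.of_forall fun y => ?_)
  have h : ‖halfSymbol c (2 * Real.pi * y)‖ ^ 4 ≤ (c ^ 2)⁻¹ := by
    rw [norm_halfSymbol_sq hc]
    gcongr
    nlinarith [sq_nonneg (2 * Real.pi * y)]
  -- A norm above 1 is at most its fourth power, hence at most c⁻².
  by_cases h1 : ‖halfSymbol c (2 * Real.pi * y)‖ ≤ 1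
  · exact h1.trans (le_add_of_nonneg_right (by positivity))
  · push Not at h1
    have := le_self_pow₀ h1.le (n := 4) (by norm_num)
    linarith

theorem integrable_inv_sq_add_sq {c : ℝ} (hc : c ≠ 0) :
    Integrable fun ξ : ℝ => ((2 * Real.pi * ξ) ^ 2 + c ^ 2)⁻¹ := by
  have h1 := (integrable_inv_one_add_sq.comp_mul_left' (R := 2 * Real.pi / c)
    (by positivity)).const_mul (c ^ 2)⁻¹
  refine h1.congr (.of_forall fun ξ => ?_)
  field_simp
  ring

theorem integral_inv_sq_add_sq {c : ℝ} (hc : c ≠ 0) :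
    ∫ ξ : ℝ, ((2 * Real.pi * ξ) ^ 2 + c ^ 2)⁻¹ = (2 * |c|)⁻¹ := by
  have h1 : ∀ ξ : ℝ, ((2 * Real.pi * ξ) ^ 2 + c ^ 2)⁻¹ =
      (c ^ 2)⁻¹ * (1 + (2 * Real.pi / c * ξ) ^ 2)⁻¹ := by
    intro ξ
    field_simp
    ring
  simp_rw [h1]
  rw [integral_const_mul, Measure.integral_comp_mul_left (fun x : ℝ => (1 + x ^ 2)⁻¹),
    integral_univ_inv_one_add_sq]
  have hpi := Real.pi_pos
  rw [smul_eq_mul, inv_div, abs_div, abs_of_pos (by positivity : 0 < 2 * Real.pi), ← sq_abs c]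
  have : 0 < |c| := abs_pos.2 hc
  field_simp

theorem lintegral_halfSymbol {c : ℝ} (hc : c ≠ 0) :
    ∫⁻ ξ, ‖halfSymbol c (2 * Real.pi * ξ)‖ₑ ^ 4 = ENNReal.ofReal (2 * |c|)⁻¹ := by
  rw [← integral_inv_sq_add_sq hc, ofReal_integral_eq_lintegral_ofReal
    (integrable_inv_sq_add_sq hc) (.of_forall fun _ => by positivity)]
  refine lintegral_congr fun ξ => ?_
  rw [← norm_halfSymbol_sq hc, ENNReal.ofReal_pow (norm_nonneg _), ofReal_norm]

theorem hsSq_halfInv_le {a b : ℝ} (ha : a ≠ 0) (hb : b ≠ 0) (hab : |a| = |b|) (f : 𝓢(ℝ, ℂ)) :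
    hsSq (stdBasis L2) (halfInv a * mulOp (fun x => f x) * halfInv b) ≤
      ENNReal.ofReal ((√(2 * |a|)⁻¹ * ‖f.toLp 2‖) ^ 2) := by
  have h := two_mul_hsSq_sandwich_le (memLp_halfSymbol ha) (memLp_halfSymbol hb) f
    (measurable_halfSymbol a) (measurable_halfSymbol b)
  rw [lintegral_halfSymbol ha, lintegral_halfSymbol hb, ← hab, ← two_mul, mul_assoc,
    ENNReal.mul_le_mul_iff_right (by norm_num) (by norm_num)] at h
  rw [hsSq_eq _ fourierBasis, mul_pow, Real.sq_sqrt (by positivity),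
    ENNReal.ofReal_mul (by positivity), ENNReal.ofReal_pow (norm_nonneg _), ofReal_norm]
  exact h

/-- `(∂ + a)^{-1/2} f (∂ + b)^{-1/2}` as a Hilbert–Schmidt operator. -/
def halfSandwich {a b : ℝ} (ha : a ≠ 0) (hb : b ≠ 0) (hab : |a| = |b|) :
    𝓢(ℝ, ℂ) →ₗ[ℂ] HS L2 where
  toFun f := HS.mk (halfInv a * mulOp (fun x => f x) * halfInv b)
    (ne_top_of_le_ne_top ENNReal.ofReal_ne_top (hsSq_halfInv_le ha hb hab f))
  map_add' f g := HS.toOp_injective (by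
    have h := mulOp_add (schwartz_memLp_top f) (schwartz_memLp_top g)
    simp [h, mul_add, add_mul])
  map_smul' c f := HS.toOp_injective (by
    have h := mulOp_const_mul c (schwartz_memLp_top f)
    simp [h])

theorem toOp_halfSandwich {a b : ℝ} (ha : a ≠ 0) (hb : b ≠ 0) (hab : |a| = |b|) (f : 𝓢(ℝ, ℂ)) :
    HS.toOp L2 (halfSandwich ha hb hab f) = halfInv a * mulOp (fun x => f x) * halfInv b := rfl

theorem norm_halfSandwich_le {a b : ℝ} (ha : a ≠ 0) (hb : b ≠ 0) (hab : |a| = |b|)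
    (f : 𝓢(ℝ, ℂ)) : ‖halfSandwich ha hb hab f‖ ≤ √(2 * |a|)⁻¹ * ‖f.toLp 2‖ :=
  HS.norm_le_of_hsSq_le (by positivity) (hsSq_halfInv_le ha hb hab f)

end Symbols

/-! ### The commutator identity for resolvents -/

section Commutator

/-- `f' + c f`. -/
def sDeriv (c : ℝ) (f : 𝓢(ℝ, ℂ)) : 𝓢(ℝ, ℂ) := SchwartzMap.derivCLM ℂ ℂ f + (c : ℂ) • f

theorem sDeriv_apply (c : ℝ) (f : 𝓢(ℝ, ℂ)) (x : ℝ) : sDeriv c f x = deriv f x + c * f x := rfl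

theorem fourier_sDeriv (c : ℝ) (f : 𝓢(ℝ, ℂ)) (ξ : ℝ) :
    𝓕 (sDeriv c f) ξ = (Complex.I * (2 * Real.pi * ξ : ℝ) + c) * 𝓕 f ξ := by
  have h : 𝓕 (SchwartzMap.derivCLM ℂ ℂ f) ξ = (2 * Real.pi * Complex.I * ξ) • 𝓕 f ξ := by
    rw [SchwartzMap.fourier_coe, SchwartzMap.fourier_coe]
    exact congrFun (Real.fourier_deriv f.integrable f.differentiable
      (SchwartzMap.derivCLM ℂ ℂ f).integrable) ξ
  rw [sDeriv, FourierTransform.fourier_add, FourierTransform.fourier_smul, add_apply, smul_apply, h]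
  push_cast
  simp only [smul_eq_mul]
  ring

/-- `(∂ + c)^{-1}`. -/
def resolvent (c : ℝ) : L2 →L[ℂ] L2 := halfInv c * halfInv c

theorem FT_resolvent {c : ℝ} (hc : c ≠ 0) (h : L2) :
    FT (resolvent c h) =ᵐ[volume] fun y => (Complex.I * (2 * Real.pi * y : ℝ) + c)⁻¹ * FT h y := by
  rw [resolvent, halfInv_eq, fourierMul_comp,
    ← mulOp_mul (memLp_halfSymbol hc) (memLp_halfSymbol hc)]
  filter_upwards [mulOp_apply_ae (memLp_top_mul (memLp_halfSymbol hc) (memLp_halfSymbol hc))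
    (FT h)] with y hy
  rw [hy, halfSymbol_mul_self hc]

theorem integrable_sRefl_mul (f : 𝓢(ℝ, ℂ)) (ξ : ℝ) (g : L2) :
    Integrable fun η => f (ξ - η) * g η := by
  refine (L2.integrable_inner (𝕜 := ℂ) ((sConj (sRefl f ξ)).toLp 2) g).congr ?_
  filter_upwards [(sConj (sRefl f ξ)).coeFn_toLp 2 volume] with x hx
  rw [hx]
  simp [mul_comm]

/-- Formally, f' + (a − b)f = (∂ + a)f − f(∂ + b). On the Fourier side no unbounded operator
appears: 2πi(ξ − η) + a − b is the difference of the two symbols. -/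
theorem resolvent_mul_sDeriv_mul_resolvent {a b : ℝ} (ha : a ≠ 0) (hb : b ≠ 0) (f : 𝓢(ℝ, ℂ)) :
    resolvent a * mulOp (fun x => sDeriv (a - b) f x) * resolvent b =
      mulOp (fun x => f x) * resolvent b - resolvent a * mulOp (fun x => f x) := by
  refine ContinuousLinearMap.ext fun h => FT.injective (Lp.ext ?_)
  simp only [mul_apply_eq_comp, sub_apply, map_sub]
  filter_upwards [FT_resolvent ha (mulOp (fun x => sDeriv (a - b) f x) (resolvent b h)),
    FT_resolvent ha (mulOp (fun x => f x) h), FT_mulOp f h, FT_mulOp f (resolvent b h),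
    FT_mulOp (sDeriv (a - b) f) (resolvent b h),
    Lp.coeFn_sub (FT (mulOp (fun x => f x) (resolvent b h)))
      (FT (resolvent a (mulOp (fun x => f x) h)))] with ξ h1 h2 h3 h4 h5 h6
  rw [h6, Pi.sub_apply, h1, h2, h3, h4, h5, ← integral_sRefl_mul, ← integral_sRefl_mul,
    ← integral_sRefl_mul, ← integral_const_mul, ← integral_const_mul,
    ← integral_sub (integrable_sRefl_mul _ _ _) ((integrable_sRefl_mul _ _ _).const_mul _)]
  refine integral_congr_ae ?_
  filter_upwards [FT_resolvent hb h] with η h7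
  rw [h7, fourier_sDeriv]
  have e1 := symbol_ne_zero ha (2 * Real.pi * ξ)
  have e2 := symbol_ne_zero hb (2 * Real.pi * η)
  field_simp
  push_cast
  ring

end Commutator

/-! ### The trace of the product of two sandwiches -/

section LeadingTrace

theorem norm_symbol_inv_le (a : ℝ) {t : ℝ} (ht : t ≠ 0) :
    ‖(Complex.I * (2 * Real.pi * t : ℝ) + a)⁻¹‖ ≤ |t|⁻¹ := by
  rw [norm_inv]
  have ht' := abs_pos.2 ht
  refine inv_anti₀ ht' ?_
  refine le_of_sq_le_sq ?_ (norm_nonneg _)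
  rw [normSq_symbol, sq_abs]
  have : 1 ≤ (2 * Real.pi) ^ 2 := by nlinarith [Real.pi_gt_three]
  nlinarith [sq_nonneg t, sq_nonneg a]

theorem continuous_symbol_inv {a : ℝ} (ha : a ≠ 0) :
    Continuous fun t : ℝ => (Complex.I * (2 * Real.pi * t : ℝ) + a)⁻¹ :=
  Continuous.inv₀ (by fun_prop) fun t => symbol_ne_zero ha _

/-- Neither term is integrable alone. A primitive of the difference is the integral over the window
from x − ζ to x, where the integrand is O(1/|x|), so it vanishes at both ends. -/
theorem integral_symbol_inv_sub_translate {a : ℝ} (ha : a ≠ 0) (ζ : ℝ)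
    (hint : Integrable fun ξ : ℝ => (Complex.I * (2 * Real.pi * ξ : ℝ) + a)⁻¹ -
      (Complex.I * (2 * Real.pi * (ξ - ζ) : ℝ) + a)⁻¹) :
    ∫ ξ : ℝ, ((Complex.I * (2 * Real.pi * ξ : ℝ) + a)⁻¹ -
      (Complex.I * (2 * Real.pi * (ξ - ζ) : ℝ) + a)⁻¹) = 0 := by
  set k : ℝ → ℂ := fun t => (Complex.I * (2 * Real.pi * t : ℝ) + a)⁻¹ with hk
  have hc : Continuous k := continuous_symbol_inv ha
  have hd : ∀ x, HasDerivAt (fun x => ∫ t in (0 : ℝ)..x, k t) (k x) x := fun x =>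
    intervalIntegral.integral_hasDerivAt_right (hc.intervalIntegrable _ _)
      (hc.stronglyMeasurableAtFilter _ _) hc.continuousAt
  have hΘ : ∀ x, HasDerivAt (fun x => (∫ t in (0 : ℝ)..x, k t) - ∫ t in (0 : ℝ)..(x - ζ), k t)
      (k x - k (x - ζ)) x := fun x => (hd x).sub ((hd (x - ζ)).comp_sub_const x ζ)
  have hb : ∀ x, |ζ| < |x| → ‖(∫ t in (0 : ℝ)..x, k t) - ∫ t in (0 : ℝ)..(x - ζ), k t‖ ≤
      (|x| - |ζ|)⁻¹ * |ζ| := by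
    intro x hx
    rw [intervalIntegral.integral_interval_sub_left (hc.intervalIntegrable _ _)
      (hc.intervalIntegrable _ _)]
    have h := intervalIntegral.norm_integral_le_of_norm_le_const (a := x - ζ) (b := x) (f := k)
      (C := (|x| - |ζ|)⁻¹) fun t ht => ?_
    · simpa using h
    · have h1 : |x - t| ≤ |ζ| := by
        have := Set.abs_sub_left_of_mem_uIcc (Set.uIoc_subset_uIcc ht)
        have := Set.abs_sub_right_of_mem_uIcc (Set.uIoc_subset_uIcc ht)
        simp at this
        simpa using this
      have h2 : |x| - |ζ| ≤ |t| := by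
        have := abs_sub_abs_le_abs_sub x t
        linarith
      have h3 : 0 < |t| := by linarith
      exact (norm_symbol_inv_le a (abs_pos.1 h3)).trans (inv_anti₀ (by linarith) h2)
  have ht : ∀ l : Filter ℝ, Filter.Tendsto (fun x : ℝ => |x|) l Filter.atTop →
      Filter.Tendsto (fun x => (∫ t in (0 : ℝ)..x, k t) - ∫ t in (0 : ℝ)..(x - ζ), k t) l
        (nhds 0) := by
    intro l hl
    refine squeeze_zero_norm' ((hl.eventually_gt_atTop |ζ|).mono hb) ?_
    have h1 := (tendsto_inv_atTop_zero.comp (Filter.tendsto_atTop_add_const_right l (-|ζ|) hl)).mul_const |ζ|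
    simpa [sub_eq_add_neg] using h1
  have h := integral_of_hasDerivAt_of_tendsto hΘ hint (ht _ Filter.tendsto_abs_atBot_atTop)
    (ht _ Filter.tendsto_abs_atTop_atTop)
  rw [sub_self] at h
  exact h

theorem fourier_sConj (f : 𝓢(ℝ, ℂ)) (ξ : ℝ) :
    𝓕 (sConj f) ξ = (starRingEnd ℂ) (𝓕 f (-ξ)) := by
  rw [SchwartzMap.fourier_coe, SchwartzMap.fourier_coe, Real.fourier_eq', Real.fourier_eq',
    ← integral_conj]
  refine integral_congr_ae (.of_forall fun x => ?_)
  simp [← Complex.exp_conj, map_ofNat]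

/-- For ζ = 0 the integrand is −2a/((2πξ)² + a²), with integral −sgn a. Translating the second term
by ζ changes nothing. -/
theorem integral_symbol_inv_sub_symbol_inv {a : ℝ} (ha : a ≠ 0) (ζ : ℝ)
    (hint : Integrable fun ξ : ℝ => (Complex.I * (2 * Real.pi * ξ : ℝ) + (-a : ℝ))⁻¹ -
      (Complex.I * (2 * Real.pi * (ξ - ζ) : ℝ) + a)⁻¹) :
    ∫ ξ : ℝ, ((Complex.I * (2 * Real.pi * ξ : ℝ) + (-a : ℝ))⁻¹ -
      (Complex.I * (2 * Real.pi * (ξ - ζ) : ℝ) + a)⁻¹) = -(Real.sign a : ℂ) := by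
  have h1 : ∀ ξ : ℝ, (Complex.I * (2 * Real.pi * ξ : ℝ) + (-a : ℝ))⁻¹ -
      (Complex.I * (2 * Real.pi * ξ : ℝ) + a)⁻¹ =
      ((-(2 * a) * ((2 * Real.pi * ξ) ^ 2 + a ^ 2)⁻¹ : ℝ) : ℂ) := by
    intro ξ
    have e1 := symbol_ne_zero (neg_ne_zero.2 ha) (2 * Real.pi * ξ)
    have e2 := symbol_ne_zero ha (2 * Real.pi * ξ)
    have e3 : (((2 * Real.pi * ξ) ^ 2 + a ^ 2 : ℝ) : ℂ) =
        -((Complex.I * (2 * Real.pi * ξ : ℝ) + (-a : ℝ)) *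
          (Complex.I * (2 * Real.pi * ξ : ℝ) + a)) := by
      push_cast
      ring_nf
      simp
    have e4 : ((-(2 * a) * ((2 * Real.pi * ξ) ^ 2 + a ^ 2)⁻¹ : ℝ) : ℂ) =
        -(2 * a) * (((2 * Real.pi * ξ) ^ 2 + a ^ 2 : ℝ) : ℂ)⁻¹ := by
      push_cast
      ring
    rw [e4, e3]
    field_simp
    push_cast
    ring
  have hi1 : Integrable fun ξ : ℝ => ((-(2 * a) * ((2 * Real.pi * ξ) ^ 2 + a ^ 2)⁻¹ : ℝ) : ℂ) :=
    ((integrable_inv_sq_add_sq ha).const_mul _).ofReal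
  have h2 : ∀ ξ : ℝ, (Complex.I * (2 * Real.pi * ξ : ℝ) + (-a : ℝ))⁻¹ -
      (Complex.I * (2 * Real.pi * (ξ - ζ) : ℝ) + a)⁻¹ =
      ((-(2 * a) * ((2 * Real.pi * ξ) ^ 2 + a ^ 2)⁻¹ : ℝ) : ℂ) +
        ((Complex.I * (2 * Real.pi * ξ : ℝ) + a)⁻¹ -
          (Complex.I * (2 * Real.pi * (ξ - ζ) : ℝ) + a)⁻¹) := by
    intro ξ
    rw [← h1]
    ring
  have hi2 : Integrable fun ξ : ℝ => (Complex.I * (2 * Real.pi * ξ : ℝ) + a)⁻¹ -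
      (Complex.I * (2 * Real.pi * (ξ - ζ) : ℝ) + a)⁻¹ := by
    refine (hint.sub hi1).congr (.of_forall fun ξ => ?_)
    simp only [Pi.sub_apply]
    rw [h2]
    ring
  simp_rw [h2]
  rw [integral_add hi1 hi2, integral_symbol_inv_sub_translate ha ζ hi2, integral_complex_ofReal,
    integral_const_mul, integral_inv_sq_add_sq ha, add_zero, ← Complex.ofReal_neg]
  congr 1
  rcases lt_or_gt_of_ne ha with h | h
  · rw [Real.sign_of_neg h, abs_of_neg h]
    field_simp
  · rw [Real.sign_of_pos h, abs_of_pos h]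
    field_simp

theorem symbol_inv_sub_symbol_inv {a : ℝ} (ha : a ≠ 0) (ξ ζ : ℝ) :
    (Complex.I * (2 * Real.pi * ξ : ℝ) + (-a : ℝ))⁻¹ -
      (Complex.I * (2 * Real.pi * (ξ - ζ) : ℝ) + a)⁻¹ =
    (Complex.I * (2 * Real.pi * -ζ : ℝ) + (a - -a : ℝ)) *
      ((Complex.I * (2 * Real.pi * ξ : ℝ) + (-a : ℝ))⁻¹ *
      (Complex.I * (2 * Real.pi * (ξ - ζ) : ℝ) + a)⁻¹) := by
  have e1 := symbol_ne_zero (neg_ne_zero.2 ha) (2 * Real.pi * ξ)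
  have e2 := symbol_ne_zero ha (2 * Real.pi * (ξ - ζ))
  field_simp
  push_cast
  ring

theorem norm_symbol_inv_mul_le {a : ℝ} (ξ η : ℝ) :
    ‖(Complex.I * (2 * Real.pi * ξ : ℝ) + (-a : ℝ))⁻¹ *
      (Complex.I * (2 * Real.pi * η : ℝ) + a)⁻¹‖ ≤
      ((2 * Real.pi * ξ) ^ 2 + a ^ 2)⁻¹ + ((2 * Real.pi * η) ^ 2 + a ^ 2)⁻¹ := by
  rw [norm_mul, norm_inv, norm_inv, ← normSq_symbol a (2 * Real.pi * η), ← neg_sq a,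
    ← normSq_symbol (-a) (2 * Real.pi * ξ), ← inv_pow, ← inv_pow]
  nlinarith [sq_nonneg (‖Complex.I * (2 * Real.pi * ξ : ℝ) + (-a : ℝ)‖⁻¹ -
    ‖Complex.I * (2 * Real.pi * η : ℝ) + a‖⁻¹),
    sq_nonneg (‖Complex.I * (2 * Real.pi * ξ : ℝ) + (-a : ℝ)‖⁻¹),
    sq_nonneg (‖Complex.I * (2 * Real.pi * η : ℝ) + a‖⁻¹)]

/-- As a product of two inverse symbols the difference decays like ξ⁻². The factor depending on ζ
which this costs is absorbed into the transform of `sDeriv`, which still decays rapidly. -/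
theorem integrable_leadingKernel {a : ℝ} (ha : a ≠ 0) (f r : 𝓢(ℝ, ℂ)) :
    Integrable (fun p : ℝ × ℝ => (𝓕 r p.2 * 𝓕 f (-p.2)) *
      ((Complex.I * (2 * Real.pi * p.1 : ℝ) + (-a : ℝ))⁻¹ -
        (Complex.I * (2 * Real.pi * (p.1 - p.2) : ℝ) + a)⁻¹)) (volume.prod volume) := by
  have hΦ : Integrable fun ζ => 𝓕 r ζ * 𝓕 (sDeriv (a - -a) f) (-ζ) :=
    ((sMul (𝓕 r) (sRefl (𝓕 (sDeriv (a - -a) f)) 0)).integrable).congr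
      (.of_forall fun ζ => by simp)
  have hw := integrable_inv_sq_add_sq ha
  have h1 := hw.mul_prod hΦ.norm
  have h2 := hΦ.norm.convolution_integrand (ContinuousLinearMap.mul ℝ ℝ) hw
  refine (h1.add h2).mono' ?_ (.of_forall fun p => ?_)
  · refine Continuous.aestronglyMeasurable ?_
    have c1 := continuous_symbol_inv ha
    have c2 := continuous_symbol_inv (neg_ne_zero.2 ha)
    have c3 := (𝓕 f).continuous
    have c4 := (𝓕 r).continuous
    exact ((c4.comp continuous_snd).mul (c3.comp continuous_snd.neg)).mul
      ((c2.comp continuous_fst).sub (c1.comp (continuous_fst.sub continuous_snd)))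
  · rw [symbol_inv_sub_symbol_inv ha]
    have e : 𝓕 r p.2 * 𝓕 f (-p.2) * ((Complex.I * (2 * Real.pi * -p.2 : ℝ) + (a - -a : ℝ)) *
        ((Complex.I * (2 * Real.pi * p.1 : ℝ) + (-a : ℝ))⁻¹ *
        (Complex.I * (2 * Real.pi * (p.1 - p.2) : ℝ) + a)⁻¹)) =
        (𝓕 r p.2 * 𝓕 (sDeriv (a - -a) f) (-p.2)) *
        ((Complex.I * (2 * Real.pi * p.1 : ℝ) + (-a : ℝ))⁻¹ *
        (Complex.I * (2 * Real.pi * (p.1 - p.2) : ℝ) + a)⁻¹) := by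
      rw [fourier_sDeriv]
      ring
    rw [e, norm_mul]
    refine (mul_le_mul_of_nonneg_left (norm_symbol_inv_mul_le _ _) (norm_nonneg _)).trans
      (le_of_eq ?_)
    simp only [Pi.add_apply, ContinuousLinearMap.mul_apply']
    ring

/-- The lowest-order trace. The Fourier integrals of the two resolvents are not absolutely
convergent separately, so their difference is kept together; its integral over ξ is −sgn a for every
shift ζ, and the rest is Parseval. -/
theorem pair_halfSandwich_sDeriv {a : ℝ} (ha : a ≠ 0) (hb : -a ≠ 0) (hab : |a| = |-a|)
    (hba : |-a| = |a|) (f r : 𝓢(ℝ, ℂ)) :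
    HS.pair L2 (halfSandwich ha hb hab (sDeriv (a - -a) f)) (halfSandwich hb ha hba r) =
      -(Real.sign a : ℂ) * ∫ x, f x * r x := by
  have hS := hasRows_sandwich (m := fun ξ => (starRingEnd ℂ) (halfSymbol (-a) ξ))
    (n := fun ξ => (starRingEnd ℂ) (halfSymbol a ξ)) (memLp_top_conj (memLp_halfSymbol hb))
    (memLp_top_conj (memLp_halfSymbol ha)) (sConj (sDeriv (a - -a) f))
  have hT := hasRows_sandwich (memLp_halfSymbol hb) (memLp_halfSymbol ha) r
  rw [← adjoint_sandwich (memLp_halfSymbol ha) (memLp_halfSymbol hb)] at hS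
  rw [HasRows.pair_eq (S := halfSandwich ha hb hab (sDeriv (a - -a) f))
    (T := halfSandwich hb ha hba r) hS hT]
  have h1 : ∀ ξ, ⟪sandwichRow (halfSymbol (-a)) r (halfSymbol a) ξ,
      sandwichRow (fun ξ => (starRingEnd ℂ) (halfSymbol (-a) ξ)) (sConj (sDeriv (a - -a) f))
        (fun ξ => (starRingEnd ℂ) (halfSymbol a ξ)) ξ⟫_ℂ =
      ∫ ζ, (𝓕 r ζ * 𝓕 f (-ζ)) * ((Complex.I * (2 * Real.pi * ξ : ℝ) + (-a : ℝ))⁻¹ -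
        (Complex.I * (2 * Real.pi * (ξ - ζ) : ℝ) + a)⁻¹) := by
    intro ξ
    rw [L2.inner_def, ← integral_sub_left_eq_self (fun ζ => (𝓕 r ζ * 𝓕 f (-ζ)) *
      ((Complex.I * (2 * Real.pi * ξ : ℝ) + (-a : ℝ))⁻¹ -
        (Complex.I * (2 * Real.pi * (ξ - ζ) : ℝ) + a)⁻¹)) volume ξ]
    refine integral_congr_ae ?_
    filter_upwards [sandwichRow_ae (m := halfSymbol (-a)) (memLp_halfSymbol ha) r ξ,
      sandwichRow_ae (m := fun ξ => (starRingEnd ℂ) (halfSymbol (-a) ξ))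
        (n := fun ξ => (starRingEnd ℂ) (halfSymbol a ξ))
        (memLp_top_conj (memLp_halfSymbol ha)) (sConj (sDeriv (a - -a) f)) ξ] with η h1 h2
    rw [h1, h2, symbol_inv_sub_symbol_inv ha, ← halfSymbol_mul_self hb,
      sub_sub_cancel, ← halfSymbol_mul_self ha, fourier_sConj, fourier_sDeriv]
    simp
    ring
  simp_rw [h1]
  have hG := integrable_leadingKernel ha f r
  rw [integral_integral_swap hG]
  have h2 : ∀ᵐ ζ, ∫ ξ : ℝ, (𝓕 r ζ * 𝓕 f (-ζ)) *
      ((Complex.I * (2 * Real.pi * ξ : ℝ) + (-a : ℝ))⁻¹ -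
        (Complex.I * (2 * Real.pi * (ξ - ζ) : ℝ) + a)⁻¹) =
      -(Real.sign a : ℂ) * (𝓕 r ζ * 𝓕⁻ f ζ) := by
    filter_upwards [hG.prod_left_ae] with ζ h
    have e : 𝓕⁻ f ζ = 𝓕 f (-ζ) := by
      rw [SchwartzMap.fourierInv_apply_eq]
      simp
    rw [e]
    -- A nonzero coefficient can be divided out to get integrability of the bare difference; a zero
    -- one makes both sides vanish.
    by_cases h0 : 𝓕 r ζ * 𝓕 f (-ζ) = 0
    · rw [h0]; simp
    · rw [integral_const_mul, integral_symbol_inv_sub_symbol_inv ha ζ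
        ((integrable_const_mul_iff (IsUnit.mk0 _ h0) _).1 h), mul_comm]
  rw [integral_congr_ae h2, integral_const_mul, SchwartzMap.integral_fourier_mul_eq]
  simp [mul_comm]

end LeadingTrace

/-! ### Identities between traces -/

section TraceIdentities

open HS

theorem HS.pair_eq_sub_of_mul_eq {E : Type} [NormedAddCommGroup E] [InnerProductSpace ℂ E]
    [CompleteSpace E] {S T S₁ T₁ S₂ T₂ : HS E}
    (h : toOp E S * toOp E T = toOp E S₁ * toOp E T₁ - toOp E S₂ * toOp E T₂) :
    pair E S T = pair E S₁ T₁ - pair E S₂ T₂ :=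
  (hasSum_pair S T).unique (((hasSum_pair S₁ T₁).sub (hasSum_pair S₂ T₂)).congr_fun fun i => by
    rw [h, sub_apply, inner_sub_right])

/-- J and K stand for the half inverses of ∂ + a and ∂ + b, and KNJ for Γ. With Γ on both sides of
the commutator, each resulting term is again a product of two Hilbert–Schmidt operators. -/
theorem mul_sandwich_mul_of_commutator {R : Type} [Ring R] {J K F M N : R}
    (h : J * J * F * (K * K) = M * (K * K) - J * J * M) :
    (K * N * J) * (J * F * K) * (K * N * J) =
      (K * (N * M) * K) * (K * N * J) - (K * N * J) * (J * (M * N) * J) := by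
  have h1 : (K * N * J) * (J * F * K) * (K * N * J) =
      K * N * (J * J * F * (K * K)) * N * J := by noncomm_ring
  rw [h1, h]
  noncomm_ring

theorem mul_diag_mul_of_commutator {R : Type} [Ring R] {J K F M N L : R}
    (h : K * K * F * (K * K) = M * (K * K) - K * K * M) :
    (J * L * K) * (K * F * K) * (K * N * J) =
      (J * (L * M) * K) * (K * N * J) - (J * L * K) * (K * (M * N) * J) := by
  have h1 : (J * L * K) * (K * F * K) * (K * N * J) =
      J * L * (K * K * F * (K * K)) * N * J := by noncomm_ring
  rw [h1, h]
  noncomm_ring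

theorem mulOp_sMul (f g : 𝓢(ℝ, ℂ)) :
    mulOp (fun x => sMul f g x) = mulOp (fun x => f x) * mulOp (fun x => g x) :=
  mulOp_mul (schwartz_memLp_top f) (schwartz_memLp_top g)

theorem sMul_comm (f g : 𝓢(ℝ, ℂ)) : sMul f g = sMul g f := by
  ext x
  simp [mul_comm]

variable {a b : ℝ} (ha : a ≠ 0) (hb : b ≠ 0) (hab : |a| = |b|) (hba : |b| = |a|)
  (κ : ℂ) (q r : 𝓢(ℝ, ℂ))

/-- The Hilbert–Schmidt operator `(∂ + a)^{-1/2} κ f (∂ + b)^{-1/2}`. -/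
def lamHS : 𝓢(ℝ, ℂ) →ₗ[ℂ] HS L2 := κ • halfSandwich ha hb hab

theorem toOp_lamHS (f : 𝓢(ℝ, ℂ)) : toOp L2 (lamHS ha hb hab κ f) =
    κ • (halfInv a * mulOp (fun x => f x) * halfInv b) := rfl

theorem toOp_lamHS_mul_sDeriv_mul (f : 𝓢(ℝ, ℂ)) :
    toOp L2 (lamHS hb ha hba κ r) * toOp L2 (lamHS ha hb hab κ (sDeriv (a - b) f)) *
      toOp L2 (lamHS hb ha hba κ r) =
    κ ^ 2 • (toOp L2 (halfSandwich hb hb rfl (sMul f r)) * toOp L2 (lamHS hb ha hba κ r) -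
      toOp L2 (lamHS hb ha hba κ r) * toOp L2 (halfSandwich ha ha rfl (sMul f r))) := by
  have h := mul_sandwich_mul_of_commutator (N := mulOp fun x => r x)
    (resolvent_mul_sDeriv_mul_resolvent ha hb f)
  simp only [toOp_lamHS, toOp_halfSandwich, smul_mul_assoc, mul_smul_comm, smul_smul]
  rw [h, mulOp_sMul]
  -- The first diagonal factor requires the two multiplications in the opposite order; they commute.
  conv_rhs => enter [2, 1, 2]; rw [← mulOp_sMul, sMul_comm, mulOp_sMul]
  rw [smul_sub, smul_sub, smul_smul, smul_smul, pow_two, mul_assoc κ κ κ]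

theorem toOp_lamHS_mul_diag_mul (f : 𝓢(ℝ, ℂ)) :
    toOp L2 (lamHS ha hb hab κ q) * toOp L2 (halfSandwich hb hb rfl (sDeriv 0 f)) *
      toOp L2 (lamHS hb ha hba κ r) =
    toOp L2 (lamHS ha hb hab κ (sMul q f)) * toOp L2 (lamHS hb ha hba κ r) -
      toOp L2 (lamHS ha hb hab κ q) * toOp L2 (lamHS hb ha hba κ (sMul r f)) := by
  have h0 := resolvent_mul_sDeriv_mul_resolvent hb hb f
  rw [sub_self] at h0
  have h := mul_diag_mul_of_commutator (J := halfInv a) (L := mulOp fun x => q x)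
    (N := mulOp fun x => r x) h0
  simp only [toOp_lamHS, toOp_halfSandwich, smul_mul_assoc, mul_smul_comm, smul_smul]
  rw [h, sMul_comm r f, mulOp_sMul, mulOp_sMul, smul_sub]

variable {P Q : L2 →L[ℂ] L2}

/-- Write F for the sandwich of f' + (a − b)f. Expanding P = 1 + ΛΓP splits off tr(FΓ), the
lowest-order trace. Rotating the remainder to tr(ΓPFΓΛ) and using ΓP = QΓ exposes ΓFΓ, to which the
commutator identity applies. -/
theorem pair_lamHS_sDeriv (hneg : b = -a)
    (hP : P = 1 + toOp L2 (lamHS ha hb hab κ q) * toOp L2 (lamHS hb ha hba κ r) * P)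
    (hQ : toOp L2 (lamHS hb ha hba κ r) * P = Q * toOp L2 (lamHS hb ha hba κ r))
    (hPQ : P * toOp L2 (lamHS ha hb hab κ q) = toOp L2 (lamHS ha hb hab κ q) * Q)
    (f : 𝓢(ℝ, ℂ)) :
    pair L2 (lamHS ha hb hab κ (sDeriv (a - b) f)) (mulRight L2 P (lamHS hb ha hba κ r)) =
      κ ^ 2 * ((pair L2 (halfSandwich hb hb rfl (sMul f r))
          (mulLeft L2 (toOp L2 (lamHS hb ha hba κ r)) (mulLeft L2 P (lamHS ha hb hab κ q))) -
        pair L2 (halfSandwich ha ha rfl (sMul f r))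
          (mulLeft L2 (toOp L2 (lamHS ha hb hab κ q)) (mulRight L2 P (lamHS hb ha hba κ r)))) -
        Real.sign a * ∫ x, f x * r x) := by
  set Λ := lamHS ha hb hab κ q
  set Γ := lamHS hb ha hba κ r with hΓ
  set F := lamHS ha hb hab κ (sDeriv (a - b) f) with hF
  have h0 : pair L2 F Γ = -(κ ^ 2 * (Real.sign a * ∫ x, f x * r x)) := by
    subst hneg
    have := pair_halfSandwich_sDeriv ha hb hab hba f r
    rw [hF, hΓ, lamHS, lamHS]
    simp only [LinearMap.smul_apply, map_smul, smul_apply, smul_eq_mul]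
    rw [this]
    ring
  have h1 : mulRight L2 P Γ = Γ + mulRight L2 (toOp L2 Λ * toOp L2 Γ * P) Γ := by
    refine toOp_injective ?_
    rw [map_add, toOp_mulRight, toOp_mulRight]
    conv_lhs => rw [hP]
    rw [mul_add, mul_one]
  have hid := toOp_lamHS_mul_sDeriv_mul ha hb hab hba κ r f
  rw [← hF, ← hΓ] at hid
  have h2 : pair L2 F (mulRight L2 (toOp L2 Λ * toOp L2 Γ * P) Γ) =
      pair L2 (κ ^ 2 • halfSandwich hb hb rfl (sMul f r))
        (mulLeft L2 (toOp L2 Γ) (mulLeft L2 P Λ)) -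
      pair L2 (κ ^ 2 • halfSandwich ha ha rfl (sMul f r))
        (mulLeft L2 (toOp L2 Λ) (mulRight L2 P Γ)) := by
    rw [pair_eq_of_mul_eq (S' := mulLeft L2 (toOp L2 F * toOp L2 Γ) Λ) (T' := mulRight L2 P Γ)
      (by simp [mul_assoc]), pair_comm,
      pair_eq_sub_of_mul_eq (S₁ := mulLeft L2 Q (mulLeft L2 (toOp L2
        (κ ^ 2 • halfSandwich hb hb rfl (sMul f r))) Γ)) (T₁ := Λ)
        (S₂ := mulLeft L2 (toOp L2 Γ * P) (κ ^ 2 • halfSandwich ha ha rfl (sMul f r)))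
        (T₂ := Λ) ?_]
    · congr 1
      · rw [pair_eq_of_mul_eq (S' := mulLeft L2 Q (κ ^ 2 • halfSandwich hb hb rfl (sMul f r)))
          (T' := mulLeft L2 (toOp L2 Γ) Λ) (by simp [mul_assoc]), pair_comm,
          pair_eq_of_mul_eq (S' := mulLeft L2 (toOp L2 Γ) (mulLeft L2 P Λ))
          (T' := κ ^ 2 • halfSandwich hb hb rfl (sMul f r)) ?_, pair_comm]
        simp only [toOp_mulLeft]
        rw [hPQ]
        simp only [mul_assoc]
      · rw [pair_comm, pair_eq_of_mul_eq (S' := mulLeft L2 (toOp L2 Λ) (mulRight L2 P Γ))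
          (T' := κ ^ 2 • halfSandwich ha ha rfl (sMul f r)) (by simp [mul_assoc]), pair_comm]
    · simp only [toOp_mulLeft, toOp_mulRight, map_smul, smul_apply]
      calc toOp L2 Γ * P * (toOp L2 F * toOp L2 Γ * toOp L2 Λ)
          = Q * (toOp L2 Γ * toOp L2 F * toOp L2 Γ) * toOp L2 Λ := by rw [hQ]; noncomm_ring
        _ = _ := by
          rw [hid, hQ, smul_sub]
          simp only [mul_sub, sub_mul, mul_smul_comm, smul_mul_assoc, mul_assoc]
  rw [h1, map_add, h0, h2]
  simp only [map_smul, smul_apply, smul_eq_mul]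
  rw [h1]
  ring

/-- Rotation places the diagonal operator between Λ and Γ. With equal resolvents on its two sides
the commutator identity involves f' alone. -/
theorem pair_halfSandwich_deriv (f : 𝓢(ℝ, ℂ)) :
    pair L2 (halfSandwich hb hb rfl (sDeriv 0 f))
        (mulLeft L2 (toOp L2 (lamHS hb ha hba κ r)) (mulLeft L2 P (lamHS ha hb hab κ q))) =
      pair L2 (lamHS ha hb hab κ (sMul q f)) (mulRight L2 P (lamHS hb ha hba κ r)) -
        pair L2 (lamHS hb ha hba κ (sMul r f)) (mulLeft L2 P (lamHS ha hb hab κ q)) := by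
  set Λ := lamHS ha hb hab κ q with hΛ
  set Γ := lamHS hb ha hba κ r with hΓ
  have hid := toOp_lamHS_mul_diag_mul ha hb hab hba κ q r f
  rw [← hΛ, ← hΓ] at hid
  rw [pair_eq_of_mul_eq (S' := mulRight L2 (toOp L2 Γ * P) (halfSandwich hb hb rfl (sDeriv 0 f)))
    (T' := Λ) (by simp [mul_assoc]), pair_comm,
    pair_eq_sub_of_mul_eq (S₁ := lamHS ha hb hab κ (sMul q f)) (T₁ := mulRight L2 P Γ)
    (S₂ := Λ) (T₂ := mulRight L2 P (lamHS hb ha hba κ (sMul r f))) ?_]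
  · congr 1
    rw [pair_comm, pair_eq_of_mul_eq]
    simp [mul_assoc]
  · simp only [toOp_mulRight]
    rw [← mul_assoc, ← mul_assoc, hid, sub_mul, mul_assoc, mul_assoc]

end TraceIdentities

/-! ### The trace functionals and their weak differential equations -/

section Functionals

open HS

theorem neumann_left {R : Type} [NormedRing R] [CompleteSpace R] {x : R} (hx : ‖x‖ < 1) :
    ∑' n : ℕ, x ^ n = 1 + x * ∑' n : ℕ, x ^ n := by
  have h := mul_neg_geom_series x hx
  rw [sub_mul, one_mul] at h
  exact (eq_add_of_sub_eq h)

theorem mul_neumann {R : Type} [NormedRing R] [CompleteSpace R] {x y : R} (hx : ‖x * y‖ < 1)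
    (hy : ‖y * x‖ < 1) : y * ∑' n : ℕ, (x * y) ^ n = (∑' n : ℕ, (y * x) ^ n) * y := by
  have h1 := (summable_geometric_of_norm_lt_one hx).hasSum.mul_left y
  have h2 := (summable_geometric_of_norm_lt_one hy).hasSum.mul_right y
  refine h1.unique (h2.congr_fun fun n => ?_)
  induction n with
  | zero => simp
  | succ n ih => rw [pow_succ, ← mul_assoc, ih, pow_succ]; noncomm_ring

/-- `N`, the difference of the two diagonal traces, closes the system for the partial differentials
`U` and `V`. The equation for `V` is that for `U` with (a, q, P) and (b, r, Q) exchanged, Q = (1 −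
ΓΛ)⁻¹; the exchange reverses both `N` and sgn a. -/
theorem exists_trace_functional {a b : ℝ} (ha : a ≠ 0) (hb : b ≠ 0) (hab : |a| = |b|)
    (hba : |b| = |a|) (hneg : b = -a) (κ : ℂ) (q r : 𝓢(ℝ, ℂ)) {P : L2 →L[ℂ] L2}
    (hΛ : ‖lamHS ha hb hab κ q‖ < 1) (hΓ : ‖lamHS hb ha hba κ r‖ < 1)
    (hP : P = ∑' n : ℕ, opProd (lamHS ha hb hab κ q, lamHS hb ha hba κ r) ^ n)
    {U V : 𝓢(ℝ, ℂ) →ₗ[ℂ] ℂ}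
    (hU : ∀ f, U f = pair L2 (lamHS ha hb hab κ f) (mulRight L2 P (lamHS hb ha hba κ r)))
    (hV : ∀ f, V f = pair L2 (lamHS hb ha hba κ f) (mulLeft L2 P (lamHS ha hb hab κ q))) :
    ∃ N : 𝓢(ℝ, ℂ) →ₗ[ℂ] ℂ, (∃ C, ∀ f, ‖N f‖ ≤ C * ‖f.toLp 2‖) ∧
      (∀ f, U (sDeriv (2 * a) f) = κ ^ 2 * (N (sMul f r) - Real.sign a * ∫ x, f x * r x)) ∧
      (∀ f, V (sDeriv (-(2 * a)) f) =
        -(κ ^ 2 * (N (sMul f q) - Real.sign a * ∫ x, f x * q x))) ∧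
      ∀ f, N (sDeriv 0 f) = 2 * (U (sMul q f) - V (sMul r f)) := by
  set Λ := lamHS ha hb hab κ q
  set Γ := lamHS hb ha hba κ r
  have hx : ‖toOp L2 Λ * toOp L2 Γ‖ < 1 := (norm_opProd_le (Λ, Γ)).trans_lt
    (by nlinarith [norm_nonneg Λ, norm_nonneg Γ])
  have hy : ‖toOp L2 Γ * toOp L2 Λ‖ < 1 := (norm_opProd_le (Γ, Λ)).trans_lt
    (by nlinarith [norm_nonneg Λ, norm_nonneg Γ])
  change P = ∑' n : ℕ, (toOp L2 Λ * toOp L2 Γ) ^ n at hP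
  obtain ⟨Q, hQ⟩ : ∃ Q, Q = ∑' n : ℕ, (toOp L2 Γ * toOp L2 Λ) ^ n := ⟨_, rfl⟩
  have hP1 : P = 1 + toOp L2 Λ * toOp L2 Γ * P := by rw [hP]; exact neumann_left hx
  have hQ1 : Q = 1 + toOp L2 Γ * toOp L2 Λ * Q := by rw [hQ]; exact neumann_left hy
  have hPQ : toOp L2 Γ * P = Q * toOp L2 Γ := by rw [hP, hQ]; exact mul_neumann hx hy
  have hQP : toOp L2 Λ * Q = P * toOp L2 Λ := by rw [hP, hQ]; exact mul_neumann hy hx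
  have eΛ : mulLeft L2 P Λ = mulRight L2 Q Λ := toOp_injective hQP.symm
  have eΓ : mulRight L2 P Γ = mulLeft L2 Q Γ := toOp_injective hPQ
  set B := mulLeft L2 (toOp L2 Γ) (mulLeft L2 P Λ) with hB
  set A := mulLeft L2 (toOp L2 Λ) (mulRight L2 P Γ) with hA
  have hA' : A = mulLeft L2 (toOp L2 Λ) (mulLeft L2 Q Γ) := by rw [hA, eΓ]
  have hB' : B = mulLeft L2 (toOp L2 Γ) (mulRight L2 Q Λ) := by rw [hB, eΛ]
  refine ⟨((pair L2).flip B).toLinearMap ∘ₗ halfSandwich hb hb rfl -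
    ((pair L2).flip A).toLinearMap ∘ₗ halfSandwich ha ha rfl,
    ⟨√(2 * |b|)⁻¹ * ‖B‖ + √(2 * |a|)⁻¹ * ‖A‖, fun f => ?_⟩, fun f => ?_, fun f => ?_, fun f => ?_⟩
  · change ‖pair L2 (halfSandwich hb hb rfl f) B - pair L2 (halfSandwich ha ha rfl f) A‖ ≤ _
    refine (norm_sub_le _ _).trans ?_
    have h1 := (norm_pair_le (halfSandwich hb hb rfl f) B).trans
      (mul_le_mul_of_nonneg_right (norm_halfSandwich_le hb hb rfl f) (norm_nonneg _))
    have h2 := (norm_pair_le (halfSandwich ha ha rfl f) A).trans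
      (mul_le_mul_of_nonneg_right (norm_halfSandwich_le ha ha rfl f) (norm_nonneg _))
    calc _ ≤ _ := add_le_add h1 h2
      _ = _ := by ring
  · have h := pair_lamHS_sDeriv ha hb hab hba κ q r hneg hP1 hPQ hQP.symm f
    rw [hU, show 2 * a = a - b by rw [hneg]; ring]
    exact h
  · have h := pair_lamHS_sDeriv hb ha hba hab κ r q (by rw [hneg, neg_neg]) hQ1 hQP hPQ.symm f
    rw [hV, show -(2 * a) = b - a by rw [hneg]; ring, eΛ]
    refine h.trans ?_
    change κ ^ 2 * ((pair L2 (halfSandwich ha ha rfl (sMul f q))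
      (mulLeft L2 (toOp L2 Λ) (mulLeft L2 Q Γ)) - pair L2 (halfSandwich hb hb rfl (sMul f q))
      (mulLeft L2 (toOp L2 Γ) (mulRight L2 Q Λ))) - _) = _
    have hs : Real.sign b = -Real.sign a := by rw [hneg, Real.sign_neg]
    rw [← hA', ← hB', hs]
    change _ = -(κ ^ 2 * (pair L2 (halfSandwich hb hb rfl (sMul f q)) B -
      pair L2 (halfSandwich ha ha rfl (sMul f q)) A - _))
    push_cast
    ring
  -- The second diagonal trace gives the opposite of the first and is subtracted, whence the factor
  -- 2.
  · have h1 := pair_halfSandwich_deriv (P := P) ha hb hab hba κ q r f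
    have h2 := pair_halfSandwich_deriv (P := Q) hb ha hba hab κ r q f
    change pair L2 (halfSandwich hb hb rfl (sDeriv 0 f)) B -
      pair L2 (halfSandwich ha ha rfl (sDeriv 0 f)) A = _
    rw [hU, hV]
    change pair L2 (halfSandwich ha ha rfl (sDeriv 0 f))
      (mulLeft L2 (toOp L2 Λ) (mulLeft L2 Q Γ)) = pair L2 _ (mulRight L2 Q Λ) -
      pair L2 _ (mulLeft L2 Q Γ) at h2
    rw [← hA', ← eΛ, ← eΓ] at h2
    rw [h2]
    refine (congrArg (· - _) h1).trans ?_
    ring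

end Functionals

/-! ### First order linear equations -/

section FirstOrder

/-- The inverse equals c⁻²(c − 2πiy)(1 + (2πy/c)²)⁻¹, a polynomial times a power of 1 + ‖·‖². -/
theorem hasTemperateGrowth_symbol_inv {c : ℝ} (hc : c ≠ 0) :
    Function.HasTemperateGrowth fun y : ℝ => (Complex.I * (2 * Real.pi * y : ℝ) + c)⁻¹ := by
  have h1 : Function.HasTemperateGrowth fun y : ℝ => (2 * Real.pi / c) * y := by fun_prop
  have h2 := (Function.hasTemperateGrowth_one_add_norm_sq_rpow ℝ (-1)).comp h1
  have h3 : Function.HasTemperateGrowth fun y : ℝ =>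
      (((c ^ 2)⁻¹ : ℝ) : ℂ) * ((c : ℂ) - Complex.I * (2 * Real.pi * y : ℝ)) *
      (((1 + ‖(2 * Real.pi / c) * y‖ ^ 2) ^ (-1 : ℝ) : ℝ) : ℂ) := by
    have h4 : Function.HasTemperateGrowth fun y : ℝ =>
        (((1 + ‖(2 * Real.pi / c) * y‖ ^ 2) ^ (-1 : ℝ) : ℝ) : ℂ) :=
      Function.HasTemperateGrowth.comp Function.Complex.hasTemperateGrowth_ofReal h2
    have h5 : Function.HasTemperateGrowth fun y : ℝ => ((2 * Real.pi * y : ℝ) : ℂ) :=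
      Function.HasTemperateGrowth.comp Function.Complex.hasTemperateGrowth_ofReal (by fun_prop)
    exact ((Function.HasTemperateGrowth.const _).mul ((Function.HasTemperateGrowth.const _).sub
      ((Function.HasTemperateGrowth.const _).mul h5))).mul h4
  convert h3 using 1
  ext y
  rw [inv_eq_iff_eq_inv, Real.rpow_neg_one]
  have hs := symbol_ne_zero hc (2 * Real.pi * y)
  refine eq_inv_of_mul_eq_one_left ?_
  have hd : (0 : ℝ) < 1 + ‖(2 * Real.pi / c) * y‖ ^ 2 := by positivity
  have hI : (Complex.I * (2 * Real.pi * y : ℝ) + c) * ((c : ℂ) - Complex.I * (2 * Real.pi * y : ℝ))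
      = ((c ^ 2 * (1 + ‖(2 * Real.pi / c) * y‖ ^ 2) : ℝ) : ℂ) := by
    rw [Real.norm_eq_abs, sq_abs]
    have : c ^ 2 * (1 + ((2 * Real.pi / c) * y) ^ 2) = c ^ 2 + (2 * Real.pi * y) ^ 2 := by
      field_simp
    rw [this]
    push_cast
    linear_combination (-(2 * Real.pi * y : ℂ) ^ 2) * Complex.I_sq
  have hc' : (c : ℂ) ≠ 0 := by exact_mod_cast hc
  calc _ = (Complex.I * (2 * Real.pi * y : ℝ) + c) * ((c : ℂ) - Complex.I * (2 * Real.pi * y : ℝ)) *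
        (((c ^ 2)⁻¹ * (1 + ‖(2 * Real.pi / c) * y‖ ^ 2)⁻¹ : ℝ) : ℂ) := by push_cast; ring
    _ = 1 := by
      rw [hI, ← Complex.ofReal_mul, ← mul_inv, mul_inv_cancel₀ (by positivity), Complex.ofReal_one]

theorem sDeriv_surjective {c : ℝ} (hc : c ≠ 0) (g : 𝓢(ℝ, ℂ)) : ∃ f, sDeriv c f = g := by
  refine ⟨𝓕⁻ (smulLeftCLM ℂ (fun y : ℝ => (Complex.I * (2 * Real.pi * y : ℝ) + c)⁻¹) (𝓕 g)), ?_⟩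
  refine (FourierTransform.fourierEquiv ℂ 𝓢(ℝ, ℂ)).injective ?_
  change 𝓕 (sDeriv c _) = 𝓕 g
  ext y
  rw [fourier_sDeriv, FourierTransform.fourier_fourierInv_eq,
    smulLeftCLM_apply_apply (hasTemperateGrowth_symbol_inv hc), smul_eq_mul,
    mul_inv_cancel_left₀ (symbol_ne_zero hc _)]

/-- The solution `x ↦ eˣ ∫_x^∞ e⁻ʸ G(y) dy` of `A' = A - G`. -/
def backwardSol (G : ℝ → ℂ) (x : ℝ) : ℂ := ∫ y in Set.Ioi x, (Real.exp (x - y) : ℂ) * G y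

variable {G : ℝ → ℂ}

theorem norm_sq_integrable (hG : MemLp G 2 volume) : Integrable fun y => ‖G y‖ ^ 2 :=
  (memLp_two_iff_integrable_sq_norm hG.1).1 hG

/-- With e = exp(x − y) ≤ 1 and g = ‖G y‖, eg ≤ e² + g² ≤ e + g²; and e has integral 1 over y > x.
-/
theorem norm_exp_sub_mul_le {x y : ℝ} (h : y ∈ Set.Ioi x) :
    ‖(Real.exp (x - y) : ℂ) * G y‖ ≤ Real.exp x * Real.exp (-y) + ‖G y‖ ^ 2 := by
  have h1 : Real.exp (x - y) ≤ 1 := Real.exp_le_one_iff.2 (by linarith [Set.mem_Ioi.1 h])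
  rw [norm_mul, Complex.norm_real, Real.norm_of_nonneg (Real.exp_nonneg _), ← Real.exp_add,
    ← sub_eq_add_neg]
  nlinarith [Real.exp_pos (x - y), norm_nonneg (G y), sq_nonneg (Real.exp (x - y) - ‖G y‖),
    sq_nonneg (Real.exp (x - y) + ‖G y‖)]

theorem integrableOn_exp_neg_Ioi' (x : ℝ) :
    IntegrableOn (fun y => Real.exp x * Real.exp (-y)) (Set.Ioi x) :=
  (integrableOn_exp_neg_Ioi x).const_mul _

theorem integrableOn_backwardSol (hG : MemLp G 2 volume) (x : ℝ) :
    IntegrableOn (fun y => (Real.exp (x - y) : ℂ) * G y) (Set.Ioi x) := by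
  refine ((integrableOn_exp_neg_Ioi' x).add (norm_sq_integrable hG).integrableOn).mono' ?_ ?_
  · exact ((by fun_prop : Continuous fun y : ℝ => (Real.exp (x - y) : ℂ)).aestronglyMeasurable.mul
      hG.1).restrict
  · exact (ae_restrict_mem measurableSet_Ioi).mono fun y hy => norm_exp_sub_mul_le hy

theorem integral_norm_backwardSol_le (hG : MemLp G 2 volume) (x : ℝ) :
    ∫ y in Set.Ioi x, ‖(Real.exp (x - y) : ℂ) * G y‖ ≤ 1 + ∫ y, ‖G y‖ ^ 2 := by
  have h := setIntegral_mono_on (integrableOn_backwardSol hG x).norm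
    ((integrableOn_exp_neg_Ioi' x).add (norm_sq_integrable hG).integrableOn) measurableSet_Ioi
    fun y hy => norm_exp_sub_mul_le hy
  refine h.trans ?_
  simp only [Pi.add_apply]
  rw [integral_add (integrableOn_exp_neg_Ioi' x) (norm_sq_integrable hG).integrableOn,
    integral_const_mul, integral_exp_neg_Ioi, ← Real.exp_add, add_neg_cancel, Real.exp_zero]
  exact add_le_add le_rfl (setIntegral_le_integral (norm_sq_integrable hG)
    (.of_forall fun _ => by positivity))

theorem norm_backwardSol_le (hG : MemLp G 2 volume) (x : ℝ) :
    ‖backwardSol G x‖ ≤ 1 + ∫ y, ‖G y‖ ^ 2 :=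
  (norm_integral_le_integral_norm _).trans (integral_norm_backwardSol_le hG x)

theorem integrableOn_exp_neg_mul (hG : MemLp G 2 volume) (x : ℝ) :
    IntegrableOn (fun y => (Real.exp (-y) : ℂ) * G y) (Set.Ioi x) := by
  refine ((integrableOn_backwardSol hG x).const_mul (Real.exp (-x) : ℂ)).congr
    (.of_forall fun y => ?_)
  change _ * (_ * _) = _
  rw [← mul_assoc, ← Complex.ofReal_mul, ← Real.exp_add]
  ring_nf

theorem backwardSol_eq (hG : MemLp G 2 volume) (x : ℝ) : backwardSol G x =
    Real.exp x * ((∫ y in Set.Ioi 0, (Real.exp (-y) : ℂ) * G y) -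
      ∫ y in 0..x, (Real.exp (-y) : ℂ) * G y) := by
  rw [← intervalIntegral.integral_Ioi_sub_Ioi' (integrableOn_exp_neg_mul hG 0)
    (integrableOn_exp_neg_mul hG x), sub_sub_cancel, ← integral_const_mul, backwardSol]
  refine integral_congr_ae (.of_forall fun y => ?_)
  change (Real.exp (x - y) : ℂ) * G y = _ * (_ * _)
  rw [← mul_assoc, ← Complex.ofReal_mul, ← Real.exp_add, sub_eq_add_neg]

theorem intervalIntegrable_exp_neg_mul (hG : MemLp G 2 volume) (a b : ℝ) :
    IntervalIntegrable (fun y => (Real.exp (-y) : ℂ) * G y) volume a b := by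
  rw [intervalIntegrable_iff]
  exact (integrableOn_exp_neg_mul hG (min a b)).mono_set fun y hy => hy.1

theorem continuous_backwardSol (hG : MemLp G 2 volume) : Continuous (backwardSol G) := by
  have h := intervalIntegral.continuous_primitive (intervalIntegrable_exp_neg_mul hG) 0
  rw [funext (backwardSol_eq hG)]
  fun_prop

theorem hasDerivAt_backwardSol (hG : MemLp G 2 volume) (hG' : Continuous G) (x : ℝ) :
    HasDerivAt (backwardSol G) (backwardSol G x - G x) x := by
  have hc : Continuous fun y => (Real.exp (-y) : ℂ) * G y := by fun_prop
  have h := intervalIntegral.integral_hasDerivAt_right (intervalIntegrable_exp_neg_mul hG 0 x)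
    (hc.stronglyMeasurableAtFilter _ _) hc.continuousAt
  have h2 := (Real.hasDerivAt_exp x).ofReal_comp.mul
    (h.const_sub (∫ y in Set.Ioi 0, (Real.exp (-y) : ℂ) * G y))
  rw [funext (backwardSol_eq hG)]
  refine h2.congr_deriv ?_
  have h3 : (Real.exp x : ℂ) * Real.exp (-x) = 1 := by
    rw [← Complex.ofReal_mul, ← Real.exp_add, add_neg_cancel, Real.exp_zero, Complex.ofReal_one]
  linear_combination (-G x) * h3

theorem setIntegral_exp_mul_sDeriv (f : 𝓢(ℝ, ℂ)) (y : ℝ) :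
    ∫ x in Set.Iio y, (Real.exp (x - y) : ℂ) * sDeriv 1 f x = f y := by
  rw [← integral_Iic_eq_integral_Iio]
  have hd : ∀ x, HasDerivAt (fun x => (Real.exp (x - y) : ℂ) * f x)
      ((Real.exp (x - y) : ℂ) * sDeriv 1 f x) x := by
    intro x
    have h1 : HasDerivAt (fun x : ℝ => Real.exp (x - y)) (Real.exp (x - y)) x := by
      simpa using ((hasDerivAt_id x).sub_const y).exp
    refine (h1.ofReal_comp.mul (f.differentiableAt (x := x)).hasDerivAt).congr_deriv ?_
    rw [sDeriv_apply]
    push_cast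
    ring
  have hle : ∀ x ∈ Set.Iic y, ‖(Real.exp (x - y) : ℂ)‖ ≤ 1 := fun x hx => by
    rw [Complex.norm_real, Real.norm_of_nonneg (Real.exp_nonneg _)]
    exact Real.exp_le_one_iff.2 (by linarith [Set.mem_Iic.1 hx])
  rw [integral_Iic_of_hasDerivAt_of_tendsto (m := 0) (hd y).continuousAt.continuousWithinAt
    (fun x _ => hd x)]
  · simp
  · refine (sDeriv 1 f).integrable.integrableOn.norm.mono' ?_ ?_
    · exact (Continuous.mul (by fun_prop) (sDeriv 1 f).continuous).aestronglyMeasurable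
    · refine (ae_restrict_mem measurableSet_Iic).mono fun x hx => ?_
      rw [norm_mul]
      exact mul_le_of_le_one_left (norm_nonneg _) (hle x hx)
  · refine squeeze_zero_norm' ?_ (((zero_at_infty f).mono_left
      atBot_le_cocompact).norm.trans (by rw [norm_zero]))
    filter_upwards [Filter.eventually_le_atBot y] with x hx
    rw [norm_mul]
    exact mul_le_of_le_one_left (norm_nonneg _) (hle x hx)

/-- Fubini on the region x < y: the integral of exp(x − y)(f' + f) over x < y is f(y). -/
theorem integral_sDeriv_mul_backwardSol (hG : MemLp G 2 volume) (f : 𝓢(ℝ, ℂ)) :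
    ∫ x, sDeriv 1 f x * backwardSol G x = ∫ x, f x * G x := by
  set ψ := sDeriv 1 f with hψ
  set S : Set (ℝ × ℝ) := {p | p.1 < p.2} with hS
  have hSm : MeasurableSet S := measurableSet_lt measurable_fst measurable_snd
  set F : ℝ → ℝ → ℂ := fun x y =>
    S.indicator (fun p => ψ p.1 * ((Real.exp (p.1 - p.2) : ℂ) * G p.2)) (x, y) with hF
  have hF1 : ∀ x, F x = (Set.Ioi x).indicator
      (fun y => ψ x * ((Real.exp (x - y) : ℂ) * G y)) := by
    intro x
    ext y
    simp [hF, hS, Set.indicator_apply]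
  have hF2 : ∀ y, (fun x => F x y) = (Set.Iio y).indicator
      (fun x => ψ x * ((Real.exp (x - y) : ℂ) * G y)) := by
    intro y
    ext x
    simp [hF, hS, Set.indicator_apply]
  have hint : Integrable (Function.uncurry F) (volume.prod volume) := by
    have hm : AEStronglyMeasurable (Function.uncurry F) (volume.prod volume) := by
      refine AEStronglyMeasurable.indicator ?_ hSm
      refine (ψ.continuous.comp continuous_fst).aestronglyMeasurable.mul
        (AEStronglyMeasurable.mul ?_ hG.1.comp_snd)
      exact (by fun_prop : Continuous fun p : ℝ × ℝ =>
        (Real.exp (p.1 - p.2) : ℂ)).aestronglyMeasurable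
    rw [integrable_prod_iff hm]
    refine ⟨.of_forall fun x => ?_, ?_⟩
    · change Integrable (F x)
      rw [hF1, integrable_indicator_iff measurableSet_Ioi]
      exact (integrableOn_backwardSol hG x).const_mul _
    · refine (ψ.integrable.norm.mul_const (1 + ∫ y, ‖G y‖ ^ 2)).mono'
        hm.norm.integral_prod_right' (.of_forall fun x => ?_)
      rw [Real.norm_of_nonneg (integral_nonneg fun _ => norm_nonneg _)]
      change ∫ y, ‖F x y‖ ≤ _
      rw [hF1]
      simp_rw [norm_indicator_eq_indicator_norm]
      rw [integral_indicator measurableSet_Ioi]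
      simp_rw [norm_mul (ψ x)]
      rw [integral_const_mul]
      exact mul_le_mul_of_nonneg_left (integral_norm_backwardSol_le hG x) (norm_nonneg _)
  have hswap := integral_integral_swap hint
  calc ∫ x, ψ x * backwardSol G x = ∫ x, ∫ y, F x y := by
        refine integral_congr_ae (.of_forall fun x => ?_)
        change _ = ∫ y, F x y
        rw [hF1, integral_indicator measurableSet_Ioi, integral_const_mul]
        rfl
    _ = ∫ y, ∫ x, F x y := hswap
    _ = ∫ x, f x * G x := by
        refine integral_congr_ae (.of_forall fun y => ?_)
        change ∫ x, F x y = _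
        rw [hF2, integral_indicator measurableSet_Iio]
        simp_rw [← mul_assoc]
        rw [integral_mul_const, ← setIntegral_exp_mul_sDeriv f y, ← hψ]
        simp_rw [mul_comm (ψ _)]

theorem ae_eq_of_integral_schwartz_mul {a b : ℝ → ℂ} (ha : LocallyIntegrable a)
    (hb : LocallyIntegrable b) (ha' : ∀ f : 𝓢(ℝ, ℂ), Integrable fun x => f x * a x)
    (hb' : ∀ f : 𝓢(ℝ, ℂ), Integrable fun x => f x * b x)
    (h : ∀ f : 𝓢(ℝ, ℂ), ∫ x, f x * a x = ∫ x, f x * b x) : a =ᵐ[volume] b := by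
  have h0 := ae_eq_zero_of_integral_contDiff_smul_eq_zero (ha.sub hb) fun g hg hgc => by
    have hc : HasCompactSupport fun x => (g x : ℂ) := hgc.comp_left (g := Complex.ofReal) rfl
    have hs : ContDiff ℝ (⊤ : ℕ∞) fun x => (g x : ℂ) := Complex.ofRealCLM.contDiff.comp hg
    have h1 := h (hc.toSchwartzMap hs)
    rw [← sub_eq_zero, ← integral_sub (ha' _) (hb' _)] at h1
    rw [← h1]
    refine integral_congr_ae (.of_forall fun x => ?_)
    change (g x) • (a x - b x) = (g x : ℂ) * a x - (g x : ℂ) * b x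
    rw [Complex.real_smul, mul_sub]
  filter_upwards [h0] with x hx
  exact sub_eq_zero.1 hx

theorem integrable_schwartz_mul (f : 𝓢(ℝ, ℂ)) (hG : MemLp G 2 volume) :
    Integrable fun x => f x * G x := (f.memLp 2 volume).integrable_mul hG

/-- Uniqueness of the weak solution: the test functions `sDeriv 1 g` exhaust the Schwartz space. -/
theorem ae_eq_backwardSol {a : ℝ → ℂ} (ha : MemLp a 2 volume) (hG : MemLp G 2 volume)
    (h : ∀ f : 𝓢(ℝ, ℂ), ∫ x, sDeriv 1 f x * a x = ∫ x, f x * G x) :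
    a =ᵐ[volume] backwardSol G := by
  refine ae_eq_of_integral_schwartz_mul (ha.locallyIntegrable (by norm_num))
    (continuous_backwardSol hG).locallyIntegrable (fun f => integrable_schwartz_mul f ha)
    (fun f => ?_) fun f => ?_
  · exact f.integrable.mul_bdd (continuous_backwardSol hG).aestronglyMeasurable
      (.of_forall (norm_backwardSol_le hG))
  · obtain ⟨g, rfl⟩ := sDeriv_surjective one_ne_zero f
    rw [h, integral_sDeriv_mul_backwardSol hG]

end FirstOrder

/-! ### Regularity of solutions of the weak equations -/

section Regularity

theorem exists_repr_of_bound {U : 𝓢(ℝ, ℂ) →ₗ[ℂ] ℂ} (hU : ∃ C, ∀ f, ‖U f‖ ≤ C * ‖f.toLp 2‖) :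
    ∃ u : ℝ → ℂ, MemLp u 2 volume ∧ ∀ f, U f = ∫ x, f x * u x := by
  set e : 𝓢(ℝ, ℂ) →ₗ[ℂ] L2 := (SchwartzMap.toLpCLM ℂ ℂ 2 volume).toLinearMap
  have hdense : DenseRange e := SchwartzMap.denseRange_toLpCLM ENNReal.ofNat_ne_top
  set w : L2 := (InnerProductSpace.toDual ℂ L2).symm (U.extendOfNorm e)
  refine ⟨fun x => (starRingEnd ℂ) (w x), (Lp.memLp w).star, fun f => ?_⟩
  rw [← LinearMap.extendOfNorm_eq hdense hU f, ← InnerProductSpace.toDual_symm_apply, L2.inner_def]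
  refine integral_congr_ae ?_
  filter_upwards [f.coeFn_toLp 2 volume] with x hx
  change ⟪w x, f.toLp 2 volume x⟫_ℂ = _
  rw [hx]
  simp

/-- `f` is `k` times differentiable, and `f` and its derivatives up to order `k` are bounded. -/
def BddDiff : ℕ → (ℝ → ℂ) → Prop
  | 0, f => ∃ C, ∀ x, ‖f x‖ ≤ C
  | k + 1, f => (∃ C, ∀ x, ‖f x‖ ≤ C) ∧ ∃ f', (∀ x, HasDerivAt f (f' x) x) ∧ BddDiff k f'

theorem BddDiff.bdd {k : ℕ} {f : ℝ → ℂ} (h : BddDiff k f) : ∃ C, ∀ x, ‖f x‖ ≤ C := by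
  cases k with
  | zero => exact h
  | succ k => exact h.1

theorem BddDiff.of_succ {k : ℕ} {f : ℝ → ℂ} (h : BddDiff (k + 1) f) : BddDiff k f := by
  induction k generalizing f with
  | zero => exact h.1
  | succ k ih => exact ⟨h.1, h.2.imp fun f' hf' => ⟨hf'.1, ih hf'.2⟩⟩

theorem BddDiff.bdd_add {k : ℕ} {f g : ℝ → ℂ} (hf : BddDiff k f) (hg : BddDiff k g) :
    ∃ C, ∀ x, ‖f x + g x‖ ≤ C := by
  obtain ⟨C, hC⟩ := hf.bdd
  obtain ⟨D, hD⟩ := hg.bdd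
  exact ⟨C + D, fun x => (norm_add_le _ _).trans (add_le_add (hC x) (hD x))⟩

theorem BddDiff.add {k : ℕ} {f g : ℝ → ℂ} (hf : BddDiff k f) (hg : BddDiff k g) :
    BddDiff k fun x => f x + g x := by
  induction k generalizing f g with
  | zero => exact hf.bdd_add hg
  | succ k ih =>
    refine ⟨hf.bdd_add hg, ?_⟩
    obtain ⟨-, f', hf', hfk⟩ := hf
    obtain ⟨-, g', hg', hgk⟩ := hg
    exact ⟨_, fun x => (hf' x).add (hg' x), ih hfk hgk⟩

theorem BddDiff.bdd_mul {k : ℕ} {f g : ℝ → ℂ} (hf : BddDiff k f) (hg : BddDiff k g) :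
    ∃ C, ∀ x, ‖f x * g x‖ ≤ C := by
  obtain ⟨C, hC⟩ := hf.bdd
  obtain ⟨D, hD⟩ := hg.bdd
  exact ⟨C * D, fun x => (norm_mul_le _ _).trans
    (mul_le_mul (hC x) (hD x) (norm_nonneg _) ((norm_nonneg _).trans (hC x)))⟩

theorem BddDiff.mul {k : ℕ} {f g : ℝ → ℂ} (hf : BddDiff k f) (hg : BddDiff k g) :
    BddDiff k fun x => f x * g x := by
  induction k generalizing f g with
  | zero => exact hf.bdd_mul hg
  | succ k ih =>
    refine ⟨hf.bdd_mul hg, ?_⟩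
    have hf0 := hf.of_succ
    have hg0 := hg.of_succ
    obtain ⟨-, f', hf', hfk⟩ := hf
    obtain ⟨-, g', hg', hgk⟩ := hg
    exact ⟨_, fun x => (hf' x).mul (hg' x), (ih hfk hg0).add (ih hf0 hgk)⟩

theorem BddDiff.const (k : ℕ) (c : ℂ) : BddDiff k fun _ => c := by
  induction k generalizing c with
  | zero => exact ⟨‖c‖, fun _ => le_rfl⟩
  | succ k ih => exact ⟨⟨‖c‖, fun _ => le_rfl⟩, _, fun x => hasDerivAt_const x c, ih 0⟩

theorem BddDiff.const_mul {k : ℕ} {f : ℝ → ℂ} (c : ℂ) (hf : BddDiff k f) :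
    BddDiff k fun x => c * f x := (BddDiff.const k c).mul hf

theorem BddDiff.sub {k : ℕ} {f g : ℝ → ℂ} (hf : BddDiff k f) (hg : BddDiff k g) :
    BddDiff k fun x => f x - g x := by
  have h := hf.add (hg.const_mul (-1))
  simpa [sub_eq_add_neg] using h

theorem bddDiff_schwartz (k : ℕ) (f : 𝓢(ℝ, ℂ)) : BddDiff k f := by
  have hb : ∀ f : 𝓢(ℝ, ℂ), ∃ C, ∀ x, ‖f x‖ ≤ C := fun f => by
    obtain ⟨C, hC⟩ := f.decay 0 0
    exact ⟨C, fun x => by simpa using hC.2 x⟩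
  induction k generalizing f with
  | zero => exact hb f
  | succ k ih => exact ⟨hb f, _, fun x => f.differentiableAt.hasDerivAt,
      ih (SchwartzMap.derivCLM ℂ ℂ f)⟩

theorem BddDiff.iteratedDeriv {k : ℕ} {f : ℝ → ℂ} (hf : BddDiff (k + 1) f) :
    Differentiable ℝ (iteratedDeriv k f) ∧ ∃ C, ∀ x, ‖iteratedDeriv k f x‖ ≤ C := by
  induction k generalizing f with
  | zero =>
    obtain ⟨hb, f', hf', -⟩ := hf
    rw [iteratedDeriv_zero]
    exact ⟨fun x => (hf' x).differentiableAt, hb⟩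
  | succ k ih =>
    obtain ⟨-, f', hf', hk⟩ := hf
    rw [iteratedDeriv_succ', show deriv f = f' from funext fun x => (hf' x).deriv]
    exact ih hk

theorem hasTemperateGrowth_of_bddDiff {f : ℝ → ℂ} (hf : ∀ k, BddDiff k f) :
    Function.HasTemperateGrowth f := by
  refine ⟨contDiff_of_differentiable_iteratedDeriv fun m _ => (hf (m + 1)).iteratedDeriv.1,
    fun m => ?_⟩
  obtain ⟨C, hC⟩ := (hf (m + 1)).iteratedDeriv.2
  exact ⟨0, C, fun x => by
    rw [norm_iteratedFDeriv_eq_norm_iteratedDeriv, pow_zero, mul_one]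
    exact hC x⟩

/-- Both n² and its derivative 2nn' are integrable, which forces n² to vanish at infinity. -/
theorem tendsto_zero_of_memLp_of_hasDerivAt {n n' : ℝ → ℂ} (hn : MemLp n 2 volume)
    (hb : ∃ C, ∀ x, ‖n x‖ ≤ C) (hd : ∀ x, HasDerivAt n (n' x) x) (hn' : Integrable n') :
    Filter.Tendsto n Filter.atTop (nhds 0) ∧ Filter.Tendsto n Filter.atBot (nhds 0) := by
  obtain ⟨C, hC⟩ := hb
  have hc : Continuous n := continuous_iff_continuousAt.2 fun x => (hd x).continuousAt
  have h1 : Integrable fun x => n x ^ 2 := by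
    exact (hn.integrable_mul hn).congr (.of_forall fun x => (pow_two (n x)).symm)
  have h2 : Integrable fun x => 2 * n x * n' x :=
    hn'.bdd_mul (c := 2 * C) (by fun_prop) (.of_forall fun x => by
      rw [norm_mul, Complex.norm_ofNat]
      exact mul_le_mul_of_nonneg_left (hC x) zero_le_two)
  have h3 : ∀ x, HasDerivAt (fun x => n x ^ 2) (2 * n x * n' x) x := fun x => by
    refine ((hd x).pow 2).congr_deriv ?_
    simp
  have h4 : ∀ l : Filter ℝ, Filter.Tendsto (fun x => n x ^ 2) l (nhds 0) →
      Filter.Tendsto n l (nhds 0) := fun l hl => by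
    have h5 := (hl.norm).sqrt
    simp only [norm_pow, Real.sqrt_sq (norm_nonneg _), norm_zero, Real.sqrt_zero] at h5
    exact tendsto_zero_iff_norm_tendsto_zero.2 h5
  exact ⟨h4 _ (tendsto_zero_of_hasDerivAt_of_integrableOn_Ioi (a := 0) (fun x _ => h3 x)
    h2.integrableOn h1.integrableOn), h4 _ (tendsto_zero_of_hasDerivAt_of_integrableOn_Iic (a := 0)
    (fun x _ => h3 x) h2.integrableOn h1.integrableOn)⟩

theorem memLp_schwartz_mul (f : 𝓢(ℝ, ℂ)) {n : ℝ → ℂ} (hn : MemLp n 2 volume) :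
    MemLp (fun x => f x * n x) 2 volume := hn.mul' (schwartz_memLp_top f)

theorem backwardSol_congr {G H : ℝ → ℂ} (h : G =ᵐ[volume] H) : backwardSol G = backwardSol H := by
  ext x
  refine integral_congr_ae (ae_restrict_of_ae ?_)
  filter_upwards [h] with y hy
  rw [hy]

/-! ### From the weak system to Schwartz gradients -/

variable {a : ℝ} {K s : ℂ} {q r : 𝓢(ℝ, ℂ)} {U V N : 𝓢(ℝ, ℂ) →ₗ[ℂ] ℂ}

theorem sDeriv_eq_add (c d : ℝ) (f : 𝓢(ℝ, ℂ)) : sDeriv d f = sDeriv c f + ((d - c : ℝ) : ℂ) • f := by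
  ext x
  simp only [sDeriv_apply, add_apply, smul_apply, smul_eq_mul]
  push_cast
  ring

theorem integral_sub_const_mul {n : ℝ → ℂ} (hn : MemLp n 2 volume)
    (hNn : ∀ f, N f = ∫ x, f x * n x) (p f : 𝓢(ℝ, ℂ)) :
    N (sMul f p) - s * ∫ x, f x * p x = ∫ x, f x * (p x * n x - s * p x) := by
  rw [hNn, ← integral_const_mul, ← integral_sub (integrable_schwartz_mul _ hn)
    ((integrable_schwartz_mul f (p.memLp 2 volume)).const_mul s)]
  congr 1
  ext x
  rw [sMul_apply]
  ring

/-- Riesz gives L² densities. Writing all three equations with `sDeriv 1`, and moving the excess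
multiples to the right sides, identifies each density with `backwardSol` of an L² function, hence
with a bounded continuous one. The right sides then have continuous representatives, and the
equations hold classically. -/
theorem exists_bounded_solution (hUb : ∃ C, ∀ f, ‖U f‖ ≤ C * ‖f.toLp 2‖)
    (hVb : ∃ C, ∀ f, ‖V f‖ ≤ C * ‖f.toLp 2‖) (hNb : ∃ C, ∀ f, ‖N f‖ ≤ C * ‖f.toLp 2‖)
    (hU : ∀ f, U (sDeriv (2 * a) f) = K * (N (sMul f r) - s * ∫ x, f x * r x))
    (hV : ∀ f, V (sDeriv (-(2 * a)) f) = -(K * (N (sMul f q) - s * ∫ x, f x * q x)))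
    (hN : ∀ f, N (sDeriv 0 f) = 2 * (U (sMul q f) - V (sMul r f))) :
    ∃ u v n : ℝ → ℂ, (MemLp u 2 volume ∧ MemLp v 2 volume ∧ MemLp n 2 volume) ∧
      ((∃ C, ∀ x, ‖u x‖ ≤ C) ∧ (∃ C, ∀ x, ‖v x‖ ≤ C) ∧ (∃ C, ∀ x, ‖n x‖ ≤ C)) ∧
      ((∀ f, U f = ∫ x, f x * u x) ∧ (∀ f, V f = ∫ x, f x * v x) ∧ ∀ f, N f = ∫ x, f x * n x) ∧
      (∀ x, HasDerivAt u (2 * a * u x - K * (r x * (n x - s))) x) ∧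
      (∀ x, HasDerivAt v (-(2 * a) * v x + K * (q x * (n x - s))) x) ∧
      ∀ x, HasDerivAt n (-(2 * (q x * u x - r x * v x))) x := by
  obtain ⟨u, hu, hUu⟩ := exists_repr_of_bound hUb
  obtain ⟨v, hv, hVv⟩ := exists_repr_of_bound hVb
  obtain ⟨n, hn, hNn⟩ := exists_repr_of_bound hNb
  set Gu := fun (u n : ℝ → ℂ) (x : ℝ) => K * (r x * n x - s * r x) + (1 - 2 * a : ℂ) * u x with hGu
  set Gv := fun (v n : ℝ → ℂ) (x : ℝ) => (-K) * (q x * n x - s * q x) + (1 + 2 * a : ℂ) * v x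
    with hGv
  set Gn := fun (u v n : ℝ → ℂ) (x : ℝ) => 2 * (q x * u x - r x * v x) + n x with hGn
  have mw : ∀ (p : 𝓢(ℝ, ℂ)) (c : ℂ), MemLp (fun x => c * (p x * n x - s * p x)) 2 volume :=
    fun p c => ((memLp_schwartz_mul p hn).sub ((p.memLp 2 volume).const_mul s)).const_mul c
  have mGu : MemLp (Gu u n) 2 volume := (mw r K).add (hu.const_mul _)
  have mGv : MemLp (Gv v n) 2 volume := (mw q (-K)).add (hv.const_mul _)
  have mGn : MemLp (Gn u v n) 2 volume :=
    (((memLp_schwartz_mul q hu).sub (memLp_schwartz_mul r hv)).const_mul 2).add hn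
  have eu : u =ᵐ[volume] backwardSol (Gu u n) := by
    refine ae_eq_backwardSol hu mGu fun f => ?_
    rw [← hUu, sDeriv_eq_add (2 * a), map_add, hU, map_smul, integral_sub_const_mul hn hNn, hUu, smul_eq_mul,
      ← integral_const_mul, ← integral_const_mul, ← integral_add]
    · congr 1
      ext x
      simp only [hGu]
      push_cast
      ring
    · exact (integrable_schwartz_mul f (mw r 1)).const_mul K |>.congr (.of_forall fun x => by simp)
    · exact (integrable_schwartz_mul f hu).const_mul _
  have ev : v =ᵐ[volume] backwardSol (Gv v n) := by
    refine ae_eq_backwardSol hv mGv fun f => ?_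
    rw [← hVv, sDeriv_eq_add (-(2 * a)), map_add, hV, map_smul, integral_sub_const_mul hn hNn, hVv, smul_eq_mul,
      ← neg_mul, ← integral_const_mul, ← integral_const_mul, ← integral_add]
    · congr 1
      ext x
      simp only [hGv]
      push_cast
      ring
    · exact (integrable_schwartz_mul f (mw q 1)).const_mul (-K) |>.congr
        (.of_forall fun x => by simp)
    · exact (integrable_schwartz_mul f hv).const_mul _
  have en : n =ᵐ[volume] backwardSol (Gn u v n) := by
    refine ae_eq_backwardSol hn mGn fun f => ?_
    rw [← hNn, sDeriv_eq_add 0, map_add, hN, map_smul, hUu, hVv, hNn, smul_eq_mul,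
      ← integral_sub (integrable_schwartz_mul _ hu) (integrable_schwartz_mul _ hv),
      ← integral_const_mul, ← integral_const_mul, ← integral_add]
    · congr 1
      ext x
      simp only [hGn, sMul_apply]
      push_cast
      ring
    · exact ((integrable_schwartz_mul _ hu).sub (integrable_schwartz_mul _ hv)).const_mul 2
    · exact (integrable_schwartz_mul f hn).const_mul _
  obtain ⟨u₁, hu₁⟩ : ∃ u₁, u₁ = backwardSol (Gu u n) := ⟨_, rfl⟩
  obtain ⟨v₁, hv₁⟩ : ∃ v₁, v₁ = backwardSol (Gv v n) := ⟨_, rfl⟩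
  obtain ⟨n₁, hn₁⟩ : ∃ n₁, n₁ = backwardSol (Gn u v n) := ⟨_, rfl⟩
  have cu : Continuous u₁ := hu₁ ▸ continuous_backwardSol mGu
  have cv : Continuous v₁ := hv₁ ▸ continuous_backwardSol mGv
  have cn : Continuous n₁ := hn₁ ▸ continuous_backwardSol mGn
  rw [← hu₁] at eu
  rw [← hv₁] at ev
  rw [← hn₁] at en
  have eGu : Gu u n =ᵐ[volume] Gu u₁ n₁ := by
    filter_upwards [eu, en] with x h1 h2
    simp only [hGu, h1, h2]
  have eGv : Gv v n =ᵐ[volume] Gv v₁ n₁ := by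
    filter_upwards [ev, en] with x h1 h2
    simp only [hGv, h1, h2]
  have eGn : Gn u v n =ᵐ[volume] Gn u₁ v₁ n₁ := by
    filter_upwards [eu, ev, en] with x h1 h2 h3
    simp only [hGn, h1, h2, h3]
  have cr := r.continuous
  have cq := q.continuous
  refine ⟨u₁, v₁, n₁, ⟨(memLp_congr_ae eu).1 hu, (memLp_congr_ae ev).1 hv,
    (memLp_congr_ae en).1 hn⟩, ⟨⟨_, fun x => hu₁ ▸ norm_backwardSol_le mGu x⟩,
    ⟨_, fun x => hv₁ ▸ norm_backwardSol_le mGv x⟩, ⟨_, fun x => hn₁ ▸ norm_backwardSol_le mGn x⟩⟩,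
    ⟨fun f => ?_, fun f => ?_, fun f => ?_⟩, fun x => ?_, fun x => ?_, fun x => ?_⟩
  · rw [hUu]
    refine integral_congr_ae ?_
    filter_upwards [eu] with x hx
    rw [hx]
  · rw [hVv]
    refine integral_congr_ae ?_
    filter_upwards [ev] with x hx
    rw [hx]
  · rw [hNn]
    refine integral_congr_ae ?_
    filter_upwards [en] with x hx
    rw [hx]
  · have h := hasDerivAt_backwardSol ((memLp_congr_ae eGu).1 mGu) (by fun_prop) x
    rw [← backwardSol_congr eGu, ← hu₁] at h
    refine h.congr_deriv ?_
    simp only [hGu]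
    ring
  · have h := hasDerivAt_backwardSol ((memLp_congr_ae eGv).1 mGv) (by fun_prop) x
    rw [← backwardSol_congr eGv, ← hv₁] at h
    refine h.congr_deriv ?_
    simp only [hGv]
    ring
  · have h := hasDerivAt_backwardSol ((memLp_congr_ae eGn).1 mGn) (by fun_prop) x
    rw [← backwardSol_congr eGn, ← hn₁] at h
    refine h.congr_deriv ?_
    simp only [hGn]
    ring

theorem bddDiff_solution {u v n : ℝ → ℂ}
    (hb : (∃ C, ∀ x, ‖u x‖ ≤ C) ∧ (∃ C, ∀ x, ‖v x‖ ≤ C) ∧ (∃ C, ∀ x, ‖n x‖ ≤ C))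
    (hu : ∀ x, HasDerivAt u (2 * a * u x - K * (r x * (n x - s))) x)
    (hv : ∀ x, HasDerivAt v (-(2 * a) * v x + K * (q x * (n x - s))) x)
    (hn : ∀ x, HasDerivAt n (-(2 * (q x * u x - r x * v x))) x) (k : ℕ) :
    BddDiff k u ∧ BddDiff k v ∧ BddDiff k n := by
  induction k with
  | zero => exact hb
  | succ k ih =>
    obtain ⟨hu', hv', hn'⟩ := ih
    have hw := hn'.sub (BddDiff.const k s)
    refine ⟨⟨hb.1, _, hu, (hu'.const_mul _).sub (((bddDiff_schwartz k r).mul hw).const_mul _)⟩,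
      ⟨hb.2.1, _, hv, (hv'.const_mul _).add (((bddDiff_schwartz k q).mul hw).const_mul _)⟩,
      ⟨hb.2.2, _, hn, ?_⟩⟩
    have h := (((bddDiff_schwartz k q).mul hu').sub ((bddDiff_schwartz k r).mul hv')).const_mul (-2)
    simpa only [neg_mul] using h

/-- The transpose of ∂ + c is −∂ + c, which is onto Schwartz space because c ≠ 0. The Schwartz
solution y of −y' + cy = g has the same pairings as w, so it equals w. -/
theorem exists_schwartz_repr {c : ℝ} (hc : c ≠ 0) {W : 𝓢(ℝ, ℂ) →ₗ[ℂ] ℂ} {g : 𝓢(ℝ, ℂ)}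
    {w : ℝ → ℂ} (hwc : Continuous w) (hw : MemLp w 2 volume) (hW : ∀ f, W f = ∫ x, f x * w x)
    (hWd : ∀ f, W (sDeriv c f) = ∫ x, f x * g x) : ∃ z : 𝓢(ℝ, ℂ), ⇑z = w := by
  obtain ⟨y, hy⟩ := sDeriv_surjective (neg_ne_zero.2 hc) (-g)
  refine ⟨y, ?_⟩
  refine MeasureTheory.Measure.eq_of_ae_eq (μ := volume) ?_ y.continuous hwc
  refine ae_eq_of_integral_schwartz_mul y.continuous.locallyIntegrable
    hwc.locallyIntegrable (fun f => integrable_schwartz_mul f (y.memLp 2 volume))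
    (fun f => integrable_schwartz_mul f hw) fun f => ?_
  obtain ⟨f, rfl⟩ := sDeriv_surjective hc f
  rw [← hW, hWd]
  have h1 := SchwartzMap.integral_mul_deriv_eq_neg_deriv_mul f y
  have h2 : ∀ x, f x * g x = -(f x * deriv y x) + c * (f x * y x) := fun x => by
    have := DFunLike.congr_fun hy x
    rw [sDeriv_apply] at this
    simp only [neg_apply] at this
    push_cast at this
    linear_combination (f x) * this
  have i1 : Integrable fun x => f x * y x := (sMul f y).integrable
  have i2 : Integrable fun x => -(f x * deriv y x) :=
    (sMul f (SchwartzMap.derivCLM ℂ ℂ y)).integrable.neg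
  have i3 : Integrable fun x => deriv f x * y x := (sMul (SchwartzMap.derivCLM ℂ ℂ f) y).integrable
  simp_rw [h2, sDeriv_apply, add_mul, mul_assoc]
  rw [integral_add i3 (i1.const_mul _), integral_add i2 (i1.const_mul _), integral_neg, h1,
    neg_neg]

/-- Bootstrapping bounds all derivatives of n, so r(n − s) and q(n − s) are Schwartz; inverting ∂ ∓
2a then makes u and v Schwartz. Only decay to 0 is obtained for n. -/
theorem exists_schwartz_solution (ha : a ≠ 0) (hUb : ∃ C, ∀ f, ‖U f‖ ≤ C * ‖f.toLp 2‖)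
    (hVb : ∃ C, ∀ f, ‖V f‖ ≤ C * ‖f.toLp 2‖) (hNb : ∃ C, ∀ f, ‖N f‖ ≤ C * ‖f.toLp 2‖)
    (hU : ∀ f, U (sDeriv (2 * a) f) = K * (N (sMul f r) - s * ∫ x, f x * r x))
    (hV : ∀ f, V (sDeriv (-(2 * a)) f) = -(K * (N (sMul f q) - s * ∫ x, f x * q x)))
    (hN : ∀ f, N (sDeriv 0 f) = 2 * (U (sMul q f) - V (sMul r f))) :
    ∃ (u v : 𝓢(ℝ, ℂ)) (n : ℝ → ℂ),
      ((∀ f, U f = ∫ x, f x * u x) ∧ (∀ f, V f = ∫ x, f x * v x)) ∧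
      (Filter.Tendsto n Filter.atTop (nhds 0) ∧ Filter.Tendsto n Filter.atBot (nhds 0)) ∧
      (∀ x, HasDerivAt u (2 * a * u x - K * (r x * (n x - s))) x) ∧
      (∀ x, HasDerivAt v (-(2 * a) * v x + K * (q x * (n x - s))) x) ∧
      ∀ x, HasDerivAt n (-(2 * (q x * u x - r x * v x))) x := by
  obtain ⟨u, v, n, ⟨mu, mv, mn⟩, hb, ⟨hUu, hVv, hNn⟩, du, dv, dn⟩ :=
    exists_bounded_solution hUb hVb hNb hU hV hN
  have hnT : Function.HasTemperateGrowth fun x => n x - s :=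
    (hasTemperateGrowth_of_bddDiff fun k => (bddDiff_solution hb du dv dn k).2.2).sub
      (Function.HasTemperateGrowth.const s)
  have cu : Continuous u := continuous_iff_continuousAt.2 fun x => (du x).continuousAt
  have cv : Continuous v := continuous_iff_continuousAt.2 fun x => (dv x).continuousAt
  have h2a : 2 * a ≠ 0 := mul_ne_zero two_ne_zero ha
  have hS : ∀ p : 𝓢(ℝ, ℂ), ∃ g : 𝓢(ℝ, ℂ), ∀ x, g x = K * (p x * (n x - s)) := fun p =>
    ⟨K • smulLeftCLM ℂ (fun x => n x - s) p, fun x => by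
      rw [smul_apply, smulLeftCLM_apply_apply hnT, smul_eq_mul, smul_eq_mul, mul_comm (p x)]⟩
  obtain ⟨gr, hgr⟩ := hS r
  obtain ⟨gq, hgq⟩ := hS q
  have hW : ∀ p f : 𝓢(ℝ, ℂ), K * (N (sMul f p) - s * ∫ x, f x * p x) =
      ∫ x, f x * (K * (p x * (n x - s))) := fun p f => by
    rw [integral_sub_const_mul mn hNn, ← integral_const_mul]
    congr 1
    ext x
    ring
  obtain ⟨u', rfl⟩ := exists_schwartz_repr h2a (g := gr) cu mu hUu fun f => by
    simp_rw [hU, hW, hgr]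
  obtain ⟨v', rfl⟩ := exists_schwartz_repr (neg_ne_zero.2 h2a) (g := -gq) cv mv hVv fun f => by
    simp_rw [hV, hW, ← integral_neg, neg_apply, hgq, mul_neg]
  refine ⟨u', v', n, ⟨hUu, hVv⟩, tendsto_zero_of_memLp_of_hasDerivAt mn hb.2.2 dn ?_, du, dv, dn⟩
  exact (((sMul q u').integrable.sub (sMul r v').integrable).const_mul 2).neg

end Regularity

/-! ### The Poisson bracket of two solutions -/

section Bracket

/-- The gradients `u`, `v` at `(q, r)` and their differential equations, with parameter `K = κ²`. -/
structure GradientSystem (K s : ℂ) (q r u v : 𝓢(ℝ, ℂ)) (n : ℝ → ℂ) : Prop where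
  tendsto_atTop : Filter.Tendsto n Filter.atTop (nhds 0)
  tendsto_atBot : Filter.Tendsto n Filter.atBot (nhds 0)
  deriv_u : ∀ x, HasDerivAt u (2 * (Complex.I * K) * u x - K * (r x * (n x - s))) x
  deriv_v : ∀ x, HasDerivAt v (-(2 * (Complex.I * K)) * v x + K * (q x * (n x - s))) x
  deriv_n : ∀ x, HasDerivAt n (-(2 * (q x * u x - r x * v x))) x

variable {K L s s' : ℂ} {q r u v u' v' : 𝓢(ℝ, ℂ)} {n n' : ℝ → ℂ}

theorem schwartz_tendsto_zero (f : 𝓢(ℝ, ℂ)) :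
    Filter.Tendsto f Filter.atTop (nhds 0) ∧ Filter.Tendsto f Filter.atBot (nhds 0) :=
  ⟨(zero_at_infty f).mono_left atTop_le_cocompact, (zero_at_infty f).mono_left atBot_le_cocompact⟩

theorem integrable_mul_deriv (f g : 𝓢(ℝ, ℂ)) : Integrable fun x => f x * deriv g x :=
  (sMul f (SchwartzMap.derivCLM ℂ ℂ g)).integrable

/-- In the derivative of F the product (n − s)(n' − s') cancels the terms in n − s left by the
derivatives of u and v. What survives is a multiple of the bracket density, and F tends to −ss'/2 at
both ends. -/
theorem GradientSystem.integral_bracket (h : GradientSystem K s q r u v n)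
    (h' : GradientSystem L s' q r u' v' n') (hK : K ≠ 0) (hL : L ≠ 0) (hKL : K ≠ L) :
    ∫ x, (v x * deriv u' x + u x * deriv v' x) = 0 := by
  set F : ℝ → ℂ := fun x =>
    -(1 / 2) * ((n x - s) * (n' x - s')) - K⁻¹ * (v x * u' x + u x * v' x) with hF
  have hd : ∀ x, HasDerivAt F ((L⁻¹ - K⁻¹) * (v x * deriv u' x + u x * deriv v' x)) x := by
    intro x
    have e := ((((h.deriv_n x).sub_const s).mul ((h'.deriv_n x).sub_const s')).const_mul
      (-(1 / 2) : ℂ)).sub ((((h.deriv_v x).mul (h'.deriv_u x)).add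
        ((h.deriv_u x).mul (h'.deriv_v x))).const_mul K⁻¹)
    refine e.congr_deriv ?_
    rw [(h'.deriv_u x).deriv, (h'.deriv_v x).deriv]
    field_simp
    ring
  have hlim : ∀ l : Filter ℝ, Filter.Tendsto n l (nhds 0) → Filter.Tendsto n' l (nhds 0) →
      (∀ f : 𝓢(ℝ, ℂ), Filter.Tendsto f l (nhds 0)) →
      Filter.Tendsto F l (nhds (-(1 / 2) * ((0 - s) * (0 - s')) - K⁻¹ * (0 * 0 + 0 * 0))) :=
    fun l hn hn' hS => (((hn.sub_const s).mul (hn'.sub_const s')).const_mul _).sub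
      ((((hS v).mul (hS u')).add ((hS u).mul (hS v'))).const_mul _)
  have h0 := integral_of_hasDerivAt_of_tendsto hd
    (((integrable_mul_deriv v u').add (integrable_mul_deriv u v')).const_mul _)
    (hlim _ h.tendsto_atBot h'.tendsto_atBot fun f => (schwartz_tendsto_zero f).2)
    (hlim _ h.tendsto_atTop h'.tendsto_atTop fun f => (schwartz_tendsto_zero f).1)
  rw [integral_const_mul, sub_self] at h0
  refine (mul_eq_zero.1 h0).resolve_left fun h1 => hKL ?_
  exact (inv_injective (sub_eq_zero.1 h1)).symm

theorem integral_bracket_self (u v : 𝓢(ℝ, ℂ)) :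
    ∫ x, (v x * deriv u x + u x * deriv v x) = 0 := by
  rw [integral_add (integrable_mul_deriv v u) (integrable_mul_deriv u v),
    SchwartzMap.integral_mul_deriv_eq_neg_deriv_mul]
  simp_rw [mul_comm (deriv _ _)]
  exact neg_add_cancel _

end Bracket

/-! ### Sobolev norm -/

section Sobolev

theorem norm_toLp_sq_eq (f : 𝓢(ℝ, ℂ)) : ‖f.toLp 2‖ ^ 2 = ∫ y, ‖𝓕 f y‖ ^ 2 := by
  rw [← FT.norm_map, FT_toLp, L2_norm_sq]
  refine integral_congr_ae ?_
  filter_upwards [(𝓕 f).coeFn_toLp 2 volume] with y hy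
  rw [hy]

theorem integrable_weight_mul_norm_sq {s : ℝ} (hs1 : s < 1) (f : 𝓢(ℝ, ℂ)) :
    Integrable fun y : ℝ => (4 + (2 * Real.pi * y) ^ 2) ^ s * ‖f y‖ ^ 2 := by
  obtain ⟨C, hC0, hC⟩ := f.decay 0 0
  have hC' : ∀ y, ‖f y‖ ≤ C := fun y => by simpa using hC y
  have h1 : Integrable fun y : ℝ => C * (4 * ‖f y‖ + (2 * Real.pi) ^ 2 * (‖y‖ ^ 2 * ‖f y‖)) :=
    ((f.integrable.norm.const_mul 4).add ((f.integrable_pow_mul volume 2).const_mul _)).const_mul C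
  have hb : ∀ y : ℝ, 1 ≤ 4 + (2 * Real.pi * y) ^ 2 := fun y => by
    nlinarith [sq_nonneg (2 * Real.pi * y)]
  have hc : Continuous fun y : ℝ => (4 + (2 * Real.pi * y) ^ 2) ^ s * ‖f y‖ ^ 2 := by
    refine Continuous.mul (Continuous.rpow_const (by fun_prop) fun y => Or.inl ?_) (by fun_prop)
    linarith [hb y]
  refine h1.mono' hc.aestronglyMeasurable (.of_forall fun y => ?_)
  have h2 : (4 + (2 * Real.pi * y) ^ 2) ^ s ≤ 4 + (2 * Real.pi * y) ^ 2 := by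
    simpa using Real.rpow_le_rpow_of_exponent_le (hb y) hs1.le
  have h3 : 0 ≤ (4 + (2 * Real.pi * y) ^ 2) ^ s := Real.rpow_nonneg (by linarith [hb y]) _
  rw [Real.norm_of_nonneg (by positivity), Real.norm_eq_abs y, sq_abs]
  calc _ ≤ (4 + (2 * Real.pi * y) ^ 2) * (C * ‖f y‖) :=
        mul_le_mul h2 (by rw [pow_two]; exact mul_le_mul_of_nonneg_right (hC' y) (norm_nonneg _))
          (by positivity) (by linarith [hb y])
    _ = _ := by ring

/-- The weight is at least 1, and the substitution ξ = 2πy absorbs the normalising constant. -/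
theorem norm_toLp_le_sobolevNorm {s : ℝ} (hs0 : 0 ≤ s) (hs1 : s < 1) (f : 𝓢(ℝ, ℂ)) :
    ‖f.toLp 2‖ ≤ sobolevNorm s f := by
  rw [sobolevNorm]
  refine Real.le_sqrt_of_sq_le ?_
  have hpi : (0 : ℝ) < 2 * Real.pi := by positivity
  have h1 := Measure.integral_comp_div (fun y => (4 + (2 * Real.pi * y) ^ 2) ^ s *
    ‖((Real.sqrt (2 * Real.pi))⁻¹ : ℂ) * 𝓕 f y‖ ^ 2) (2 * Real.pi)
  have h2 : ∀ ξ : ℝ, 2 * Real.pi * (ξ / (2 * Real.pi)) = ξ := fun ξ => by field_simp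
  simp only [h2] at h1
  have hn : ‖((Real.sqrt (2 * Real.pi))⁻¹ : ℂ)‖ ^ 2 = (2 * Real.pi)⁻¹ := by
    rw [norm_inv, Complex.norm_real, Real.norm_of_nonneg (Real.sqrt_nonneg _), inv_pow,
      Real.sq_sqrt hpi.le]
  rw [h1, abs_of_pos hpi, smul_eq_mul, ← integral_const_mul, norm_toLp_sq_eq]
  have h3 : ∀ y : ℝ, 2 * Real.pi * ((4 + (2 * Real.pi * y) ^ 2) ^ s *
      ‖((Real.sqrt (2 * Real.pi))⁻¹ : ℂ) * 𝓕 f y‖ ^ 2) =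
      (4 + (2 * Real.pi * y) ^ 2) ^ s * ‖𝓕 f y‖ ^ 2 := fun y => by
    rw [norm_mul, mul_pow ‖_‖, hn]
    field_simp
  simp_rw [h3]
  refine integral_mono ?_ (integrable_weight_mul_norm_sq hs1 (𝓕 f)) fun y => ?_
  -- The weight with exponent 0.
  · simpa using integrable_weight_mul_norm_sq zero_lt_one (𝓕 f)
  · refine le_mul_of_one_le_left (by positivity) (Real.one_le_rpow ?_ hs0)
    nlinarith [sq_nonneg (2 * Real.pi * y)]

end Sobolev

/-! ### The functional derivatives of `A` -/

section Gradient

open HS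

variable {κ : ℂ} {μ : ℝ} (hμ : μ ≠ 0)

/-- `Λ(κ)` as a Hilbert–Schmidt operator. -/
def lamS (κ : ℂ) : 𝓢(ℝ, ℂ) →ₗ[ℂ] HS L2 := lamHS hμ (neg_ne_zero.2 hμ) (abs_neg μ).symm κ

/-- `Γ(κ)` as a Hilbert–Schmidt operator. -/
def gamS (κ : ℂ) : 𝓢(ℝ, ℂ) →ₗ[ℂ] HS L2 := lamHS (neg_ne_zero.2 hμ) hμ (abs_neg μ) κ

theorem norm_lamHS_le {a b : ℝ} (ha : a ≠ 0) (hb : b ≠ 0) (hab : |a| = |b|) (κ : ℂ)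
    (f : 𝓢(ℝ, ℂ)) : ‖lamHS ha hb hab κ f‖ ≤ ‖κ‖ * √(2 * |a|)⁻¹ * ‖f.toLp 2‖ := by
  rw [lamHS, LinearMap.smul_apply, norm_smul, mul_assoc]
  exact mul_le_mul_of_nonneg_left (norm_halfSandwich_le ha hb hab f) (norm_nonneg _)

/-- The condition on κ makes the constant ‖κ‖(2|a|)^{-1/2} equal to 1/√2, so one radius serves all
κ. -/
theorem norm_lamHS_lt_one {a b : ℝ} (ha : a ≠ 0) (hb : b ≠ 0) (hab : |a| = |b|)
    (hκ : ‖κ‖ ^ 2 = |a|) {f : 𝓢(ℝ, ℂ)} (hf : ‖f.toLp 2‖ ≤ 1) : ‖lamHS ha hb hab κ f‖ < 1 := by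
  refine (norm_lamHS_le ha hb hab κ f).trans_lt ?_
  have ha' := abs_pos.2 ha
  have h1 : ‖κ‖ * √(2 * |a|)⁻¹ < 1 := by
    rw [← abs_of_nonneg (mul_nonneg (norm_nonneg κ) (Real.sqrt_nonneg _)), ← sq_lt_one_iff_abs_lt_one,
      mul_pow, Real.sq_sqrt (by positivity), hκ, mul_inv]
    field_simp
    norm_num
  calc _ ≤ ‖κ‖ * √(2 * |a|)⁻¹ * 1 := mul_le_mul_of_nonneg_left hf (by positivity)
    _ < 1 := by rwa [mul_one]

theorem norm_sq_eq_abs (hκ : Complex.I * κ ^ 2 = μ) : ‖κ‖ ^ 2 = |μ| := by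
  have := congrArg norm hκ
  rwa [norm_mul, Complex.norm_I, one_mul, norm_pow, Complex.norm_real] at this

theorem Lam_eq (hκ : Complex.I * κ ^ 2 = μ) (q : 𝓢(ℝ, ℂ)) : Lam κ q = toOp L2 (lamS hμ κ q) := by
  rw [Lam, lamS, toOp_lamHS, hκ, mulOp_const_mul κ (schwartz_memLp_top q), ← Complex.ofReal_neg,
    ← smul_mul_assoc, ← mul_smul_comm, mul_assoc]
  rfl

theorem Gam_eq (hκ : Complex.I * κ ^ 2 = μ) (r : 𝓢(ℝ, ℂ)) : Gam κ r = toOp L2 (gamS hμ κ r) := by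
  rw [Gam, gamS, toOp_lamHS, hκ, mulOp_const_mul κ (schwartz_memLp_top r), ← Complex.ofReal_neg,
    ← smul_mul_assoc, ← mul_smul_comm, mul_assoc]
  rfl

theorem hasTrace_Lam_Gam_pow (hκ : Complex.I * κ ^ 2 = μ) (q r : 𝓢(ℝ, ℂ)) (m : ℕ) :
    HasTrace ((Lam κ q ∘L Gam κ r) ^ (m + 1)) (tracePow m (lamS hμ κ q, gamS hμ κ r)) := by
  rw [Lam_eq hμ hκ, Gam_eq hμ hκ]
  exact hasTrace_opProd_pow m (lamS hμ κ q, gamS hμ κ r)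

/-- `∑ (1/m) tr (ΛΓ)^m` on pairs of Hilbert–Schmidt operators. -/
def logDet (p : HS L2 × HS L2) : ℂ := ∑' m : ℕ, (1 / ((m : ℂ) + 1)) * tracePow m p

theorem A_eq (hκ : Complex.I * κ ^ 2 = μ) (q r : 𝓢(ℝ, ℂ)) :
    A κ q r = -(Real.sign μ : ℂ) * logDet (lamS hμ κ q, gamS hμ κ r) := by
  rw [A, hκ, Complex.ofReal_re, logDet]
  simp_rw [(hasTrace_Lam_Gam_pow hμ hκ q r _).trace_eq]

theorem aConverges (hμ : μ ≠ 0) (hκ : Complex.I * κ ^ 2 = μ) {q r : 𝓢(ℝ, ℂ)} (hq : ‖q.toLp 2‖ ≤ 1)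
    (hr : ‖r.toLp 2‖ ≤ 1) : AConverges κ q r := by
  refine ⟨fun m => ⟨_, hasTrace_Lam_Gam_pow hμ hκ q r m⟩, ?_⟩
  simp_rw [(hasTrace_Lam_Gam_pow hμ hκ q r _).trace_eq]
  have h1 : ‖lamS hμ κ q‖ < 1 := norm_lamHS_lt_one _ _ _ (norm_sq_eq_abs hκ) hq
  have h2 : ‖gamS hμ κ r‖ < 1 := norm_lamHS_lt_one _ _ _
    ((norm_sq_eq_abs hκ).trans (abs_neg μ).symm) hr
  have h3 : ‖lamS hμ κ q‖ * ‖gamS hμ κ r‖ < 1 := by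
    nlinarith [norm_nonneg (lamS hμ κ q), norm_nonneg (gamS hμ κ r)]
  refine Summable.of_nonneg_of_le (fun _ => norm_nonneg _) (fun m => ?_)
    ((summable_nat_add_iff 1).2 (summable_geometric_of_lt_one (by positivity) h3))
  rw [norm_mul]
  have h4 : ‖1 / ((m : ℂ) + 1)‖ ≤ 1 := by
    rw [norm_div, norm_one, ← Nat.cast_succ, Complex.norm_natCast]
    exact div_le_one_of_le₀ (by norm_num) (by positivity)
  exact (mul_le_of_le_one_left (norm_nonneg _) h4).trans (norm_tracePow_le m _)

/-- These are the gradients of `logDet`; the factor −sgn μ is restored in `hasFunDeriv_A`. -/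
theorem exists_gradient (hκ : Complex.I * κ ^ 2 = μ) {q r : 𝓢(ℝ, ℂ)} (hq : ‖q.toLp 2‖ ≤ 1)
    (hr : ‖r.toLp 2‖ ≤ 1) : ∃ (u v : 𝓢(ℝ, ℂ)) (n : ℝ → ℂ) (D : HS L2 × HS L2 →L[ℂ] ℂ),
      GradientSystem (κ ^ 2) (Real.sign μ) q r u v n ∧
      HasFDerivAt logDet D (lamS hμ κ q, gamS hμ κ r) ∧
      ∀ f h, D (lamS hμ κ f, gamS hμ κ h) = (∫ x, f x * u x) + ∫ x, h x * v x := by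
  have h1 : ‖lamS hμ κ q‖ < 1 := norm_lamHS_lt_one _ _ _ (norm_sq_eq_abs hκ) hq
  have h2 : ‖gamS hμ κ r‖ < 1 := norm_lamHS_lt_one _ _ _
    ((norm_sq_eq_abs hκ).trans (abs_neg μ).symm) hr
  set P := ∑' n : ℕ, opProd (lamS hμ κ q, gamS hμ κ r) ^ n with hP
  set U : 𝓢(ℝ, ℂ) →ₗ[ℂ] ℂ :=
    ((pair L2).flip (mulRight L2 P (gamS hμ κ r))).toLinearMap ∘ₗ lamS hμ κ with hU
  set V : 𝓢(ℝ, ℂ) →ₗ[ℂ] ℂ :=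
    ((pair L2).flip (mulLeft L2 P (lamS hμ κ q))).toLinearMap ∘ₗ gamS hμ κ with hV
  obtain ⟨N, hNb, hNU, hNV, hN⟩ := exists_trace_functional hμ (neg_ne_zero.2 hμ) (abs_neg μ).symm
    (abs_neg μ) rfl κ q r h1 h2 hP (U := U) (V := V) (fun _ => rfl) (fun _ => rfl)
  have hbound : ∀ {a b : ℝ} (ha : a ≠ 0) (hb : b ≠ 0) (hab : |a| = |b|) (T : HS L2),
      ∃ C, ∀ f : 𝓢(ℝ, ℂ), ‖pair L2 (lamHS ha hb hab κ f) T‖ ≤ C * ‖f.toLp 2‖ :=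
    fun {a b} ha hb hab T => ⟨‖κ‖ * √(2 * |a|)⁻¹ * ‖T‖, fun f =>
      (norm_pair_le _ _).trans ((mul_le_mul_of_nonneg_right (norm_lamHS_le ha hb hab κ f)
        (norm_nonneg _)).trans_eq (by ring))⟩
  obtain ⟨u, v, n, ⟨hUu, hVv⟩, ⟨ht, hb⟩, du, dv, dn⟩ := exists_schwartz_solution hμ
    (hbound _ _ _ _) (hbound _ _ _ _) hNb hNU hNV hN
  refine ⟨u, v, n, _, ⟨ht, hb, fun x => ?_, fun x => ?_, dn⟩, hasFDerivAt_tsum_tracePow h1 h2,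
    fun f h => ?_⟩
  · rw [hκ]; exact du x
  · rw [hκ]; exact dv x
  · rw [traceForm_apply, ← hUu, ← hVv]
    rfl

theorem hasFunDeriv_A (hκ : Complex.I * κ ^ 2 = μ) {q r u v : 𝓢(ℝ, ℂ)}
    {D : HS L2 × HS L2 →L[ℂ] ℂ} (hD : HasFDerivAt logDet D (lamS hμ κ q, gamS hμ κ r))
    (hD' : ∀ f h, D (lamS hμ κ f, gamS hμ κ h) = (∫ x, f x * u x) + ∫ x, h x * v x) :
    HasFunDeriv (A κ) q r (-(Real.sign μ : ℂ) • u) (-(Real.sign μ : ℂ) • v) := by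
  intro f h
  have hc : HasDerivAt (fun θ : ℝ => (lamS hμ κ q, gamS hμ κ r) +
      θ • ((lamS hμ κ f, gamS hμ κ h) : HS L2 × HS L2)) (lamS hμ κ f, gamS hμ κ h) 0 := by
    simpa using ((hasDerivAt_id (0 : ℝ)).smul_const
      ((lamS hμ κ f, gamS hμ κ h) : HS L2 × HS L2)).const_add (lamS hμ κ q, gamS hμ κ r)
  have h1 := ((hD.restrictScalars ℝ).comp_hasDerivAt_of_eq (0 : ℝ) hc (by simp)).const_mul
    (-(Real.sign μ : ℂ))
  refine (h1.congr_deriv ?_).congr_of_eventuallyEq (.of_forall fun θ => ?_)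
  · change _ * D _ = _
    rw [hD', mul_add, ← integral_const_mul, ← integral_const_mul]
    congr 1 <;> · congr 1; ext x; rw [smul_apply, smul_eq_mul]; ring
  · have hs : ∀ g : 𝓢(ℝ, ℂ), θ • g = (θ : ℂ) • g := fun g => by ext x; simp
    change A κ (q + θ • f) (r + θ • h) = _
    rw [A_eq hμ hκ, hs, hs, map_add, map_add, map_smul, map_smul]
    rfl

/-- `funDeriv` is a choice, so its value is known only through uniqueness. -/
theorem HasFunDeriv.unique {F : 𝓢(ℝ, ℂ) → 𝓢(ℝ, ℂ) → ℂ} {q r u v u' v' : 𝓢(ℝ, ℂ)}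
    (h : HasFunDeriv F q r u v) (h' : HasFunDeriv F q r u' v') : u = u' ∧ v = v' := by
  have key : ∀ {u u' : 𝓢(ℝ, ℂ)}, (∀ f : 𝓢(ℝ, ℂ), ∫ x, f x * u x = ∫ x, f x * u' x) → u = u' := by
    intro u u' he
    refine DFunLike.coe_injective (MeasureTheory.Measure.eq_of_ae_eq (μ := volume)
      (ae_eq_of_integral_schwartz_mul u.continuous.locallyIntegrable
      u'.continuous.locallyIntegrable (fun f => integrable_schwartz_mul f (u.memLp 2 volume))
      (fun f => integrable_schwartz_mul f (u'.memLp 2 volume)) he) u.continuous u'.continuous)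
  exact ⟨key fun f => by simpa using (h f 0).unique (h' f 0),
    key fun f => by simpa using (h 0 f).unique (h' 0 f)⟩

theorem HasFunDeriv.funDerivQ_eq {F : 𝓢(ℝ, ℂ) → 𝓢(ℝ, ℂ) → ℂ} {q r u v : 𝓢(ℝ, ℂ)}
    (h : HasFunDeriv F q r u v) : funDerivQ F q r = u ∧ funDerivR F q r = v := by
  have hd : FunDifferentiableAt F q r := ⟨(u, v), h⟩
  rw [funDerivQ, funDerivR, funDeriv, dif_pos hd]
  exact hd.choose_spec.unique h

theorem Admissible.exists_real (hκ : Admissible κ) :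
    ∃ μ : ℝ, μ ≠ 0 ∧ Complex.I * κ ^ 2 = μ := by
  refine ⟨(Complex.I * κ ^ 2).re, fun h => ?_, Complex.ext rfl (by simpa using hκ.1)⟩
  have := hκ.2
  rw [h, abs_zero] at this
  linarith

theorem Admissible.sq_ne_zero (hκ : Admissible κ) : κ ^ 2 ≠ 0 := fun h => by
  have := hκ.2
  rw [h] at this
  norm_num at this

theorem integral_smul_bracket {c d : ℂ} {u v u' v' : 𝓢(ℝ, ℂ)}
    (h : ∫ x, (v x * deriv u' x + u x * deriv v' x) = 0) :
    ∫ x, ((c • v) x * deriv (⇑(d • u')) x + (c • u) x * deriv (⇑(d • v')) x) = 0 := by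
  have e : ∀ (g : 𝓢(ℝ, ℂ)) (x : ℝ), deriv (⇑(d • g)) x = d * deriv g x := fun g x =>
    deriv_const_mul d g.differentiableAt
  have e2 : ∀ x, (c • v) x * deriv (⇑(d • u')) x + (c • u) x * deriv (⇑(d • v')) x =
      c * d * (v x * deriv u' x + u x * deriv v' x) := fun x => by
    rw [e, e, smul_apply, smul_apply, smul_eq_mul, smul_eq_mul]
    ring
  simp_rw [e2]
  rw [integral_const_mul, h, mul_zero]

theorem poissonBracket_A {ϰ : ℂ} (hκ : Admissible κ) (hϰ : Admissible ϰ) (hne : κ ^ 2 ≠ ϰ ^ 2)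
    {q r : 𝓢(ℝ, ℂ)} (hq : ‖q.toLp 2‖ ≤ 1) (hr : ‖r.toLp 2‖ ≤ 1) :
    poissonBracket (A κ) (A ϰ) q r = 0 := by
  obtain ⟨μ, hμ, hκμ⟩ := hκ.exists_real
  obtain ⟨ν, hν, hϰν⟩ := hϰ.exists_real
  obtain ⟨u, v, n, D, hG, hD, hD'⟩ := exists_gradient hμ hκμ hq hr
  obtain ⟨u', v', n', D', hG', hE, hE'⟩ := exists_gradient hν hϰν hq hr
  have h1 := (hasFunDeriv_A hμ hκμ hD hD').funDerivQ_eq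
  have h2 := (hasFunDeriv_A hν hϰν hE hE').funDerivQ_eq
  rw [poissonBracket, h1.1, h1.2, h2.1, h2.2]
  exact integral_smul_bracket (hG.integral_bracket hG' hκ.sq_ne_zero hϰ.sq_ne_zero hne)

theorem funDifferentiableAt_A (hκ : Admissible κ) {q r : 𝓢(ℝ, ℂ)} (hq : ‖q.toLp 2‖ ≤ 1)
    (hr : ‖r.toLp 2‖ ≤ 1) : FunDifferentiableAt (A κ) q r := by
  obtain ⟨μ, hμ, hκμ⟩ := hκ.exists_real
  obtain ⟨u, v, n, D, -, hD, hD'⟩ := exists_gradient hμ hκμ hq hr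
  exact ⟨(-(Real.sign μ : ℂ) • u, -(Real.sign μ : ℂ) • v), hasFunDeriv_A hμ hκμ hD hD'⟩

theorem smul_comp_smul {E : Type} [NormedAddCommGroup E] [NormedSpace ℂ E] (c : ℂ)
    (S T : E →L[ℂ] E) : (c • S) ∘L (c • T) = c ^ 2 • (S ∘L T) := by
  ext x
  simp [smul_smul, pow_two]

theorem comp_smul_comp {E : Type} [NormedAddCommGroup E] [NormedSpace ℂ E] (c : ℂ)
    (R S T : E →L[ℂ] E) : R ∘L (c • S) ∘L T = c • (R ∘L S ∘L T) := by
  ext x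
  simp

/-- The half inverses involve κ² only, and the scalar factors κ of Λ and Γ multiply to κ². This
covers ϰ = −κ. -/
theorem A_eq_of_sq_eq {ϰ : ℂ} (h : κ ^ 2 = ϰ ^ 2) : A κ = A ϰ := by
  have hL : ∀ q r : 𝓢(ℝ, ℂ), Lam κ q ∘L Gam κ r = Lam ϰ q ∘L Gam ϰ r := fun q r => by
    rw [Lam, Gam, Lam, Gam, h]
    simp only [mulOp_const_mul _ (schwartz_memLp_top q), mulOp_const_mul _ (schwartz_memLp_top r)]
    rw [comp_smul_comp, comp_smul_comp, comp_smul_comp, comp_smul_comp, smul_comp_smul,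
      smul_comp_smul, h]
  funext q r
  rw [A, A, hL, h]

end Gradient

/-! ### Conservation -/

section Conservation

open HS

/-- Schwartz space is not normed, so the derivative is a little-o statement in a topological vector
space; a continuous linear map carries it to a normed space. -/
theorem hasDerivWithinAt_clm_comp {F : Type} [NormedAddCommGroup F] [NormedSpace ℝ F]
    (L : 𝓢(ℝ, ℂ) →L[ℝ] F) {q : ℝ → 𝓢(ℝ, ℂ)} {q' : 𝓢(ℝ, ℂ)} {J : Set ℝ} {t : ℝ}
    (h : HasDerivWithinAt q q' J t) : HasDerivWithinAt (fun t => L (q t)) (L q') J t :=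
  .of_isLittleOTVS ((L.isBigOTVS_fun_comp.trans_isLittleOTVS h.isLittleOTVS).congr_left
    fun p => by simp)

/-- `lamHS` as a continuous real-linear map. -/
def lamHSCLM {a b : ℝ} (ha : a ≠ 0) (hb : b ≠ 0) (hab : |a| = |b|) (κ : ℂ) :
    𝓢(ℝ, ℂ) →L[ℝ] HS L2 where
  toLinearMap := (lamHS ha hb hab κ).restrictScalars ℝ
  cont := by
    have hc : Continuous fun f : 𝓢(ℝ, ℂ) => ‖f.toLp 2 volume‖ :=
      (SchwartzMap.toLpCLM ℂ ℂ 2 volume).continuous.norm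
    refine continuous_of_continuousAt_zero (lamHS ha hb hab κ) ?_
    rw [ContinuousAt, map_zero]
    refine squeeze_zero_norm (fun f => norm_lamHS_le ha hb hab κ f) ?_
    have h0 := (hc.const_mul (‖κ‖ * √(2 * |a|)⁻¹)).tendsto 0
    have h1 : (0 : 𝓢(ℝ, ℂ)).toLp 2 volume = 0 := map_zero (SchwartzMap.toLpCLM ℂ ℂ 2 volume)
    simpa [h1] using h0

theorem hasDerivWithinAt_A_flow {κ ϰ : ℂ} (hκ : Admissible κ) (hϰ : Admissible ϰ) {J : Set ℝ}
    {q r : ℝ → 𝓢(ℝ, ℂ)} (hflow : IsHamiltonianFlow (A κ) J q r) {t : ℝ} (ht : t ∈ J)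
    (hq : ‖(q t).toLp 2‖ ≤ 1) (hr : ‖(r t).toLp 2‖ ≤ 1) :
    HasDerivWithinAt (fun t => A ϰ (q t) (r t)) 0 J t := by
  obtain ⟨μ, hμ, hκμ⟩ := hκ.exists_real
  obtain ⟨ν, hν, hϰν⟩ := hϰ.exists_real
  obtain ⟨u, v, n, D, hG, hD, hD'⟩ := exists_gradient hμ hκμ hq hr
  obtain ⟨u', v', n', D', hG', hE, hE'⟩ := exists_gradient hν hϰν hq hr
  have h1 := hasFunDeriv_A hμ hκμ hD hD'
  have h2 := hasFunDeriv_A hν hϰν hE hE'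
  obtain ⟨-, hdq, hdr⟩ := hflow t ht
  set w := funDerivQ (A κ) (q t) (r t) with hw
  set z := funDerivR (A κ) (q t) (r t) with hz
  have hbr : (∫ x, deriv z x * u' x) + ∫ x, deriv w x * v' x = 0 := by
    have hb : ∫ x, (v' x * deriv w x + u' x * deriv z x) = 0 := by
      -- With equal squares the two functionals coincide, and the bracket vanishes by integration by
      -- parts.
      by_cases hne : κ ^ 2 = ϰ ^ 2
      · rw [A_eq_of_sq_eq hne, h2.funDerivQ_eq.1] at hw
        rw [A_eq_of_sq_eq hne, h2.funDerivQ_eq.2] at hz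
        rw [hw, hz]
        simpa only [one_smul] using integral_smul_bracket (c := 1) (integral_bracket_self u' v')
      · rw [h1.funDerivQ_eq.1] at hw
        rw [h1.funDerivQ_eq.2] at hz
        rw [hw, hz]
        have := hG'.integral_bracket hG hϰ.sq_ne_zero hκ.sq_ne_zero (Ne.symm hne)
        simpa only [one_smul] using integral_smul_bracket (c := 1) this
    rw [integral_add (integrable_mul_deriv v' w) (integrable_mul_deriv u' z), add_comm] at hb
    simpa only [mul_comm] using hb
  have hc := (hasDerivWithinAt_clm_comp (lamHSCLM hν (neg_ne_zero.2 hν) (abs_neg ν).symm ϰ)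
    hdq).prodMk (hasDerivWithinAt_clm_comp (lamHSCLM (neg_ne_zero.2 hν) hν (abs_neg ν) ϰ) hdr)
  have h3 := ((hE.restrictScalars ℝ).comp_hasDerivWithinAt t hc).const_mul (-(Real.sign ν : ℂ))
  refine (h3.congr_deriv ?_).congr_of_mem (fun t _ => A_eq hν hϰν (q t) (r t)) ht
  refine mul_eq_zero_of_right _ ((hE' _ _).trans ?_)
  exact hbr

end Conservation

end

end DNLS

theorem mainTheorem7 (s : ℝ) (hs0 : 0 < s) (hs1 : s < 1 / 2) :
    ∃ δ : ℝ, 0 < δ ∧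
      -- the Poisson brackets vanish
      (∀ κ ϰ : ℂ, DNLS.Admissible κ → DNLS.Admissible ϰ → κ ^ 2 ≠ ϰ ^ 2 →
        ∀ q r : 𝓢(ℝ, ℂ), DNLS.sobolevNorm s q ≤ δ → DNLS.sobolevNorm s r ≤ δ →
          (DNLS.AConverges κ q r ∧ DNLS.FunDifferentiableAt (DNLS.A κ) q r) ∧
          (DNLS.AConverges ϰ q r ∧ DNLS.FunDifferentiableAt (DNLS.A ϰ) q r) ∧
          DNLS.poissonBracket (DNLS.A κ) (DNLS.A ϰ) q r = 0) ∧
      -- every flow of `A(κ)` conserves `A(ϰ)`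
      (∀ κ ϰ : ℂ, DNLS.Admissible κ → DNLS.Admissible ϰ →
        ∀ (J : Set ℝ) (q r : ℝ → 𝓢(ℝ, ℂ)), J.OrdConnected →
          DNLS.IsHamiltonianFlow (DNLS.A κ) J q r →
          (∀ t ∈ J, DNLS.sobolevNorm s (q t) ≤ δ ∧ DNLS.sobolevNorm s (r t) ≤ δ) →
          ∀ t₀ ∈ J, ∀ t₁ ∈ J, DNLS.A ϰ (q t₁) (r t₁) = DNLS.A ϰ (q t₀) (r t₀)) := by
  have hL : ∀ f : 𝓢(ℝ, ℂ), DNLS.sobolevNorm s f ≤ 1 → ‖f.toLp 2‖ ≤ 1 := fun f hf =>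
    (DNLS.norm_toLp_le_sobolevNorm hs0.le (by linarith) f).trans hf
  have hA : ∀ κ : ℂ, DNLS.Admissible κ → ∀ q r : 𝓢(ℝ, ℂ), ‖q.toLp 2‖ ≤ 1 → ‖r.toLp 2‖ ≤ 1 →
      DNLS.AConverges κ q r ∧ DNLS.FunDifferentiableAt (DNLS.A κ) q r := fun κ hκ q r hq hr => by
    obtain ⟨μ, hμ, hκμ⟩ := hκ.exists_real
    exact ⟨DNLS.aConverges hμ hκμ hq hr, DNLS.funDifferentiableAt_A hκ hq hr⟩
  refine ⟨1, one_pos, fun κ ϰ hκ hϰ hne q r hq hr => ⟨hA κ hκ q r (hL q hq) (hL r hr),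
    hA ϰ hϰ q r (hL q hq) (hL r hr), DNLS.poissonBracket_A hκ hϰ hne (hL q hq) (hL r hr)⟩,
    fun κ ϰ hκ hϰ J q r hJ hflow hball t₀ h₀ t₁ h₁ => ?_⟩
  -- Mean value inequality on the convex set `J`, with derivative bound 0.
  have h := hJ.convex.norm_image_sub_le_of_norm_hasDerivWithin_le (C := 0)
    (fun t ht => DNLS.hasDerivWithinAt_A_flow hκ hϰ hflow ht (hL _ (hball t ht).1)
      (hL _ (hball t ht).2)) (fun _ _ => norm_zero.le) h₀ h₁
  rw [zero_mul] at h
  exact sub_eq_zero.1 (norm_le_zero_iff.1 h)
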